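/- **Setting.** Let $A$ be a finite totally ordered set with an involution $\iota:A\to A$, let $<$ be the short-lex order on the set $A^*$ of words, and let $R$ be a finite set of pairs $(l,r)$ of words such that $l>r$, $l$ and $r$ have no common non-empty prefix, and $|l|\le|r|+2$ (write $\mathrm{SL2}$ for the set of all pairs of words with these three properties). Let $G=\langle A\mid x\,\iota(x)=1\ (x\in A),\ l=r\ ((l,r)\in R)\rangle$, and write $\bar u\in G$ for the value of a word $u$. A *rule* is a pair $(\lambda,\rho)$ of words with $\lambda>\rho$. For a set $T$ of rules, an elementary $T$-reduction replaces a subword $\lambda$ by $\rho$ for some $(\lambda,\rho)\in T$; a word is $T$-irreducible if it contains no left-hand side of $T$; Thue equivalence is the equivalence relation generated by elementary reductions; $T$ is *confluent* if every word can be fully reduced to exactly one irreducible word. $U$ is the set of all rules $(u,v)$ with $\bar u=\bar v$. A rule $(u,v)\in U$ is *$U$-minimal* if $v$ and all proper subwords of $u$ are $U$-irreducible. A word $u$ is in *short-lex normal form* if it is the least word with value $\bar u$. **The procedure.** The following Knuth–Bendix procedure works in passes $n=1,2,\dots$ and is run forever. Its data are * a finite set $\mathsf S$ of rules, divided into $\mathsf{Considered}$,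 $\mathsf{Now}$, $\mathsf{New}$, $\mathsf{Delete}$; * for each pass $n$ a two-variable automaton $\mathrm{Rules}[n]$, reading padded pairs of words, with a single state $0$ that is both initial and final; its rules are the pairs in $L(\mathrm{Rules}[n])\cap \mathrm{SL2}$; * a two-variable automaton $\mathrm{WDiff}$ of the same kind, each of whose states carries a word (the empty word at $0$), and some of whose arrows and states are marked as *needed*. *Aut-reduction* of a word $w$ in pass $n$: as long as $w$ is reducible by the rules of $\mathrm{Rules}[n]$, choose in $w$ a reducible subword $\lambda$ all of whose proper subwords are irreducible (by these rules). If $\mathsf S$ contains rules with left-hand side $\lambda$, apply the one with least right-hand side. Otherwise insert into $\mathsf{New}$, and apply, the rule of $\mathrm{Rules}[n]$ with left-hand side $\lambda$ and least right-hand side. *Minimization* of a rule $(u,v)$ (throughout, $u=u_1\cdots u_p$ and $v=v_1\cdots v_q$ denote the current words): 1. Aut-reduce the maximal proper prefix of $u$. If this gave no change, Aut-reduce the maximal proper suffix of $u$. If $u$ has changed, Aut-reduce $u$. 2. Aut-reduce $v$. 3. If $v>u$, interchange $u$ and $v$. 4. As long as $p>q+2$, or $p=q+2$, $q>0$ and $u_1>v_1$,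 or $p=2$, $q=0$ and $u_1>\iota(u_2)$, replace $(u,v)$ by $(u_1\cdots u_{p-1},v\,\iota(u_p))$. 5. If $p=q+2$ and $u_2>\iota(u_1)$, replace $(u,v)$ by $(u_2\cdots u_p,\iota(u_1)v)$. 6. Cancel common first letters as long as possible, then common last letters as long as possible. 7. If steps 3–6 changed the pair, go back to step 2; otherwise output $(u,v)$. *Treating* a rule $(\lambda,\rho)$ means: minimize it. If the output is not $(\epsilon,\epsilon)$, attach the loop spelling the padded output to $\mathrm{WDiff}$ at $0$, weld, mark this loop as needed, insert the output into $\mathsf{Now}$ unless it is in $\mathsf{Now}$ or $\mathsf{Considered}$, and remove it from $\mathsf{New}$. Then, if some proper subword of $\lambda$ is reducible by $\mathrm{Rules}[n]$, delete $(\lambda,\rho)$ from $\mathsf S$; otherwise, if the output is not $(\lambda,\rho)$, move $(\lambda,\rho)$ to $\mathsf{Delete}$. *Welding*: as long as possible, identify distinct states that are targets of equally labelled arrows from one state, or sources of equally labelled arrows to one state, or that are the two ends of an arrow labelled $(x,x)$ one of whose ends is $0$; then omit all arrows labelled $(x,x)$ from $0$ to $0$. An arrow or state identified with a needed one is needed.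 The word of a new state reached by an arrow labelled $(x,y)$ from a state with word $w$ is a reduction of $\iota(x)wy$ (padding symbols being omitted); identified states keep one of their words. *Start*: all pairs $(x\,\iota(x),\epsilon)$ with $x\in A$ and all pairs in $R$ are in $\mathsf{New}$, the other parts of $\mathsf S$ are empty; $\mathrm{WDiff}=\mathrm{Rules}[1]$ is obtained by welding the loops of all these rules at $0$, and all of it is needed. *Pass $n$*: 1. Treat each rule of $\mathsf{Considered}$. 2. Treat rules of $\mathsf{New}$ until $\mathsf{New}$ is empty. 3. For each rule of $\mathsf{Now}$: move it to $\mathsf{Considered}$. For each overlap $\lambda_1=s_1z$, $\lambda_2=zs_2$, $z\ne\epsilon$, between it and a rule of $\mathsf{Considered}$ (in either order, including itself), Aut-reduce $\rho_1s_2$ and $s_1\rho_2$; if the results differ, insert the rule formed by them into $\mathsf{New}$ unless it is in $\mathsf S$ already. (The overlap of a rule with the whole of itself is left out.) 4. Reduce the words of the states of $\mathrm{WDiff}$ by the rules of $\mathrm{WDiff}$; if distinct states carry the same word, identify them, weld, and repeat this until all words are distinct. Then delete from $\mathrm{WDiff}$ everything that is not needed, let $\mathrm{Rules}[n+1]$ be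 a copy of $\mathrm{WDiff}$, remove all marks, and empty $\mathsf{Delete}$. All choices that are left open (the order of treatment, the choice of $\lambda$ in Aut-reduction, the word kept by identified states) are arbitrary. Time $t=0,1,2,\dots$ counts elementary steps (the treatment of one rule, the analysis of one critical pair, the end of a pass, and so on), and $\mathsf S_t$ is the set of rules in $\mathsf S$ at time $t$. A word is *permanently irreducible* if it is $\mathsf S_t$-irreducible for arbitrarily large $t$. A rule $(\lambda,\rho)$ that belongs to some $\mathsf S_t$ is *permanent* if $\rho$ and every proper subword of $\lambda$ are permanently irreducible. **Statement.** For every execution of the procedure: (i) The set of permanent rules is confluent. (ii) The set of permanent rules equals $\mathsf P=\bigcap_t\bigcup_{s\ge t}\mathsf S_s$. (iii) For every word $u$ and every time $t$, $u$ is least in its Thue class with respect to $\mathsf S_t$ if and only if $u$ is permanently irreducible, and this holds if and only if $u$ is in short-lex normal form. (iv) The permanent rules are exactly the $U$-minimal rules, and for each $U$-minimal rule there is $N$ such that for all $n\ge N$ the procedure reaches pass $n$ and the rule belongs to $L(\mathrm{Rules}[n])\cap\mathrm{SL2}$, so that it is accepted by $\mathrm{Rules}[n]$. -/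

import Mathlib

namespace KnuthBendix

/-! ## Words, rules, elementary reductions -/

/-- A pair of words `(left-hand side, right-hand side)`. -/
abbrev Rule (A : Type*) := List A × List A

section Rewriting

variable {A : Type*}

/-- The elementary reduction `α λ β → α ρ β`, for a rule `(λ, ρ)` in `R`. -/
def Elementary (R : Set (Rule A)) (u v : List A) : Prop :=
  ∃ a b : List A, ∃ r ∈ R, u = a ++ r.1 ++ b ∧ v = a ++ r.2 ++ b

/-- No subword of `w` is a left-hand side of `R`. -/
def IsIrred (R : Set (Rule A)) (w : List A) : Prop :=
  ∀ r ∈ R, ¬ r.1 <:+: w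

/-- Every proper subword of `w` is `R`-irreducible. -/
def ProperIrred (R : Set (Rule A)) (w : List A) : Prop :=
  ∀ s : List A, s <:+: w → s ≠ w → IsIrred R s

/-- `w'` is the result of fully reducing `w` by some sequence of elementary `R`-reductions. -/
def ReducesTo (R : Set (Rule A)) (w w' : List A) : Prop :=
  Relation.ReflTransGen (Elementary R) w w' ∧ IsIrred R w'

/-- Fully reducing a word gives an irreducible word which is independent of the
elementary reductions that were used. -/
def Confluent (R : Set (Rule A)) : Prop :=
  ∀ w : List A, ∃! w' : List A, ReducesTo R w w'

/-- Thue equivalence: the equivalence relation generated by elementary reductions. -/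
def Thue (R : Set (Rule A)) : List A → List A → Prop :=
  Relation.EqvGen (Elementary R)

variable [LinearOrder A]

/-- The strict short-lex order: first by length, then lexicographically. -/
def SLt (u v : List A) : Prop := List.Shortlex (· < ·) u v

/-- `u` is the short-lex least element of its Thue class. -/
def IsThueLeast (R : Set (Rule A)) (u : List A) : Prop :=
  ∀ v : List A, Thue R u v → ¬ SLt v u

/-- The language of the automaton `SL2`: `u` is short-lex greater than `v`, the words have
no common (non-empty) prefix, and `|u| ≤ |v| + 2`. -/
def SL2 (u v : List A) : Prop :=
  SLt v u ∧ (∀ p : List A, p <+: u → p <+: v → p = []) ∧ u.length ≤ v.length + 2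

end Rewriting

/-! ## The group, normal forms and minimal rules -/

section Group

variable {A : Type*} [LinearOrder A] (inv : A → A) (R : Finset (Rule A))

/-- The relators `x · inv x` for `x ∈ A` and `l · r⁻¹` for `(l, r) ∈ R`. -/
def relators : Set (FreeGroup A) :=
  {g | ∃ x : A, g = FreeGroup.of x * FreeGroup.of (inv x)} ∪
  {g | ∃ r ∈ R, g = (r.1.map FreeGroup.of).prod * ((r.2.map FreeGroup.of).prod)⁻¹}

/-- The element of the group `G = ⟨A | x · inv x = 1, l = r ((l, r) ∈ R)⟩` that is
represented by a word. -/
def value (w : List A) : PresentedGroup (relators inv R) :=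
  (w.map (PresentedGroup.of (rels := relators inv R))).prod

/-- `u` is the short-lex least word that represents its element of `G`. -/
def IsNormalForm (u : List A) : Prop :=
  ∀ v : List A, value inv R v = value inv R u → ¬ SLt v u

/-- The universal set of rules `U`. -/
def universalRules : Set (Rule A) :=
  {r | SLt r.2 r.1 ∧ value inv R r.1 = value inv R r.2}

end Group

/-- A rule `(u, v)` of `T` is `T`-minimal if `v` and every proper subword of `u` are
`T`-irreducible. -/
def IsMinimalRule {A : Type*} (T : Set (Rule A)) (r : Rule A) : Prop :=
  r ∈ T ∧ IsIrred T r.2 ∧ ProperIrred T r.1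

/-! ## Two-variable automata

The states are natural numbers; `0` is at the same time the unique initial state and the
unique final state; the labels are pairs of padded letters, `none` being the padding symbol.
-/

/-- The arrows `(source, label, target)` of a two-variable automaton. -/
abbrev Automaton (A : Type*) := Finset (ℕ × (Option A × Option A) × ℕ)

section Automata

variable {A : Type*}

/-- The padded word of a pair of words. -/
def padded (r : Rule A) : List (Option A × Option A) :=
  List.zipWithAll Prod.mk r.1 r.2

/-- The finite state automaton with the given arrows. -/
def Automaton.toNFA (M : Automaton A) : NFA (Option A × Option A) ℕ where
  step s a := {t | (s, a, t) ∈ M}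
  start := {0}
  accept := {0}

/-- The states: the initial state and all sources and targets of arrows. -/
def Automaton.states (M : Automaton A) : Finset ℕ :=
  insert 0 (M.image (fun e => e.1) ∪ M.image (fun e => e.2.2))

variable [LinearOrder A]

/-- The rules extracted from an automaton: the pairs in `L(M) ∩ L(SL2)`. -/
def setOfRules (M : Automaton A) : Set (Rule A) :=
  {r | padded r ∈ M.toNFA.accepts ∧ SL2 r.1 r.2}

end Automata

/-! ## The store of rules, and Aut-reduction -/

/-- The finite set `S` of rules, divided into four parts. -/
structure Store (A : Type*) where
  considered : Finset (Rule A)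
  now : Finset (Rule A)
  new : Finset (Rule A)
  delete : Finset (Rule A)

section Reduction

variable {A : Type*} [LinearOrder A]

namespace Store

/-- All rules in the store. -/
def rules (S : Store A) : Finset (Rule A) :=
  S.considered ∪ S.now ∪ S.new ∪ S.delete

/-- Insert a rule into `New`, unless it is already in the store. -/
def addNew (S : Store A) (r : Rule A) : Store A :=
  if r ∈ S.rules then S else { S with new := insert r S.new }

/-- Delete a rule from the store. -/
def remove (S : Store A) (r : Rule A) : Store A :=
  ⟨S.considered.erase r, S.now.erase r, S.new.erase r, S.delete.erase r⟩

/-- Move a rule to the `Delete` list. -/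
def moveToDelete (S : Store A) (r : Rule A) : Store A :=
  ⟨S.considered.erase r, S.now.erase r, S.new.erase r, insert r S.delete⟩

/-- Insert an output of the minimization routine into `Now`, unless it is already in `Now` or
in `Considered`, and remove it from `New`. The output `(ε, ε)` is ignored. -/
def recordOutput (S : Store A) (o : Rule A) : Store A :=
  if o = ([], []) then S
  else { S with
    now := if o ∈ S.considered then S.now else insert o S.now
    new := S.new.erase o }

end Store

/-- One step of Aut-reduction with the automaton `M`. A left-hand side `l` of a rule of `M`,
all of whose proper subwords are irreducible, is found in the word. If the store contains
rules with left-hand side `l`, the one with the smallest right-hand side is applied.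
Otherwise the rule of `M` with left-hand side `l` and smallest right-hand side is inserted into
`New` and applied. -/
inductive AutStep (M : Automaton A) : Store A × List A → Store A × List A → Prop
  | stored (S : Store A) (a l ρ b : List A)
      (hred : ¬ IsIrred (setOfRules M) l) (hmin : ProperIrred (setOfRules M) l)
      (hρ : (l, ρ) ∈ S.rules) (hleast : ∀ σ, (l, σ) ∈ S.rules → ¬ SLt σ ρ) :
      AutStep M (S, a ++ l ++ b) (S, a ++ ρ ++ b)
  | found (S : Store A) (a l ρ b : List A)
      (hmin : ProperIrred (setOfRules M) l)
      (hnone : ∀ σ, (l, σ) ∉ S.rules)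
      (hρ : (l, ρ) ∈ setOfRules M) (hleast : ∀ σ, (l, σ) ∈ setOfRules M → ¬ SLt σ ρ) :
      AutStep M (S, a ++ l ++ b) (S.addNew (l, ρ), a ++ ρ ++ b)

/-- Aut-reduction of the word `w` to an irreducible word `w'`; the store changes from `S`
to `S'`. -/
def AutReduce (M : Automaton A) (S : Store A) (w : List A) (S' : Store A) (w' : List A) : Prop :=
  Relation.ReflTransGen (AutStep M) (S, w) (S', w') ∧ IsIrred (setOfRules M) w'

end Reduction

/-! ## The minimization routine -/

section Minimization

variable {A : Type*} [LinearOrder A]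

/-- Repeat a step until it is no longer applicable. -/
def Exhaust {α : Type*} (step : α → α → Prop) (a b : α) : Prop :=
  Relation.ReflTransGen step a b ∧ ∀ c, ¬ step b c

/-- Perform a step once if it is applicable. -/
def Once {α : Type*} (step : α → α → Prop) (a b : α) : Prop :=
  step a b ∨ (a = b ∧ ∀ c, ¬ step a c)

/-- The first three steps of minimization, on the left-hand side: reduce the maximal proper
prefix; if this gave no change, reduce the maximal proper suffix; if the word has changed,
reduce the resulting word. -/
inductive ReduceLeft (M : Automaton A) : Store A → List A → Store A → List A → Prop
  | byPrefix {S S₁ S₂ : Store A} {p p' u' : List A} {x : A}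
      (hp : AutReduce M S p S₁ p') (hne : p' ≠ p)
      (hu : AutReduce M S₁ (p' ++ [x]) S₂ u') :
      ReduceLeft M S (p ++ [x]) S₂ u'
  | bySuffix {S S₁ S₂ S₃ : Store A} {p s s' u' : List A} {x y : A} (heq : p ++ [x] = y :: s)
      (hp : AutReduce M S p S₁ p)
      (hs : AutReduce M S₁ s S₂ s') (hne : s' ≠ s)
      (hu : AutReduce M S₂ (y :: s') S₃ u') :
      ReduceLeft M S (p ++ [x]) S₃ u'
  | unchanged {S S₁ S₂ : Store A} {p s : List A} {x y : A} (heq : p ++ [x] = y :: s)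
      (hp : AutReduce M S p S₁ p) (hs : AutReduce M S₁ s S₂ s) :
      ReduceLeft M S (p ++ [x]) S₂ (p ++ [x])

/-- If `v > u`, interchange `u` and `v`. -/
inductive Interchange : Rule A → Rule A → Prop
  | mk (u v : List A) (h : SLt u v) : Interchange (u, v) (v, u)

/-- Move the last letter of the left-hand side to the right-hand side. -/
inductive MoveLast (inv : A → A) : Rule A → Rule A → Prop
  | long (u v : List A) (x : A) (h : v.length + 2 < (u ++ [x]).length) :
      MoveLast inv (u ++ [x], v) (u, v ++ [inv x])
  | first (z y x : A) (u v : List A)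
      (hlen : (z :: u ++ [x]).length = (y :: v).length + 2) (h : y < z) :
      MoveLast inv (z :: u ++ [x], y :: v) (z :: u, y :: v ++ [inv x])
  | two (z x : A) (h : inv x < z) : MoveLast inv ([z, x], []) ([z], [inv x])

/-- Move the first letter of the left-hand side to the right-hand side. -/
inductive MoveFirst (inv : A → A) : Rule A → Rule A → Prop
  | mk (x y : A) (u v : List A) (hlen : (x :: y :: u).length = v.length + 2) (h : inv x < y) :
      MoveFirst inv (x :: y :: u, v) (y :: u, inv x :: v)

/-- Cancel a common first letter. -/
inductive CancelFirst : Rule A → Rule A → Prop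
  | mk (x : A) (u v : List A) : CancelFirst (x :: u, x :: v) (u, v)

/-- Cancel a common last letter. -/
inductive CancelLast : Rule A → Rule A → Prop
  | mk (x : A) (u v : List A) : CancelLast (u ++ [x], v ++ [x]) (u, v)

/-- The steps of the minimization loop that follow the reduction of the right-hand side. -/
def Adjust (inv : A → A) (p q : Rule A) : Prop :=
  ∃ p₁ p₂ p₃ p₄ : Rule A, Once Interchange p p₁ ∧ Exhaust (MoveLast inv) p₁ p₂ ∧
    Once (MoveFirst inv) p₂ p₃ ∧ Exhaust CancelFirst p₃ p₄ ∧ Exhaust CancelLast p₄ q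

/-- The minimization loop: reduce the right-hand side and adjust, until adjusting gives no
change. -/
inductive MinimizeLoop (inv : A → A) (M : Automaton A) :
    Store A → Rule A → Store A → Rule A → Prop
  | done {S S₁ : Store A} {u v v₁ : List A} (hv : AutReduce M S v S₁ v₁)
      (h : Adjust inv (u, v₁) (u, v₁)) : MinimizeLoop inv M S (u, v) S₁ (u, v₁)
  | again {S S₁ S₂ : Store A} {u v v₁ : List A} {q o : Rule A} (hv : AutReduce M S v S₁ v₁)
      (h : Adjust inv (u, v₁) q) (hne : q ≠ (u, v₁)) (hloop : MinimizeLoop inv M S₁ q S₂ o) :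
      MinimizeLoop inv M S (u, v) S₂ o

/-- The minimization routine with input `r` and output `o`. -/
def Minimize (inv : A → A) (M : Automaton A) (S : Store A) (r : Rule A)
    (S' : Store A) (o : Rule A) : Prop :=
  ∃ (S₁ : Store A) (u : List A), ReduceLeft M S r.1 S₁ u ∧ MinimizeLoop inv M S₁ (u, r.2) S' o

end Minimization

/-! ## The word-difference automaton -/

/-- The automaton `WDiff`: its arrows, the arrows that are marked as needed (the needed
states are their end points), and the word attached to each state. -/
structure WordDiff (A : Type*) where
  arrows : Automaton A
  needed : Automaton A
  label : ℕ → List A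

section WDiff

variable {A : Type*} [LinearOrder A]

/-- Identify the state `t` with the state `s`; the resulting state has the name and the label
of `s`. An arrow that is identified with a needed arrow becomes needed. -/
def WordDiff.merge (D : WordDiff A) (s t : ℕ) : WordDiff A where
  arrows := D.arrows.image fun e =>
    (if e.1 = t then s else e.1, e.2.1, if e.2.2 = t then s else e.2.2)
  needed := D.needed.image fun e =>
    (if e.1 = t then s else e.1, e.2.1, if e.2.2 = t then s else e.2.2)
  label := D.label

/-- The identifications made by welding. In addition, both ends of an `(x, x)`-arrow with source
or target `0` are identified. -/
inductive WordDiff.Forced (D : WordDiff A) : ℕ → ℕ → Prop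
  | target {s t₁ t₂ : ℕ} {a : Option A × Option A}
      (h₁ : (s, a, t₁) ∈ D.arrows) (h₂ : (s, a, t₂) ∈ D.arrows) : D.Forced t₁ t₂
  | source {s₁ s₂ t : ℕ} {a : Option A × Option A}
      (h₁ : (s₁, a, t) ∈ D.arrows) (h₂ : (s₂, a, t) ∈ D.arrows) : D.Forced s₁ s₂
  | diagOut {t : ℕ} {x : A} (h : (0, (some x, some x), t) ∈ D.arrows) : D.Forced 0 t
  | diagIn {t : ℕ} {x : A} (h : (t, (some x, some x), 0) ∈ D.arrows) : D.Forced 0 t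

/-- One identification of distinct states during welding; the state `0` keeps its name. -/
inductive WeldStep : WordDiff A → WordDiff A → Prop
  | mk (D : WordDiff A) (s t : ℕ) (h : D.Forced s t) (hne : s ≠ t) (ht : t ≠ 0) :
      WeldStep D (D.merge s t)

/-- Omit the arrows labelled `(x, x)` from `0` to `0`. -/
def WordDiff.dropDiag (D : WordDiff A) : WordDiff A where
  arrows := D.arrows.filter fun e => ¬ (e.1 = 0 ∧ e.2.2 = 0 ∧ e.2.1.1 = e.2.1.2)
  needed := D.needed.filter fun e => ¬ (e.1 = 0 ∧ e.2.2 = 0 ∧ e.2.1.1 = e.2.1.2)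
  label := D.label

/-- `D'` is obtained from `D` by welding, followed by the omission of the `(x, x)`-arrows
at `0`. -/
def Weld (D D' : WordDiff A) : Prop :=
  ∃ D₁ : WordDiff A, Exhaust WeldStep D D₁ ∧ D' = D₁.dropDiag

/-- Reduction of the words attached to states, by rules of `M` and rules in the store. -/
def LabelReduce (M : Automaton A) (S : Store A) (w w' : List A) : Prop :=
  Relation.ReflTransGen (Elementary (setOfRules M ∪ ↑S.rules)) w w' ∧ IsIrred (setOfRules M) w'

/-- The arrows of the loop at `0` with label `w` and intermediate states `ns`. -/
def loopArrows (w : List (Option A × Option A)) (ns : List ℕ) : Automaton A :=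
  ((0 :: ns).zip (w.zip (ns ++ [0]))).toFinset

/-- Attach to `D` at `0` the loop that spells the padded rule `r`, through new states, and mark
it as needed. The target of an arrow `s → t` labelled `(x, y)` gets as word the reduction of
`x⁻¹ w y`, where `w` is the word of `s`. -/
inductive AttachLoop (inv : A → A) (M : Automaton A) (S : Store A) (r : Rule A) :
    WordDiff A → WordDiff A → Prop
  | mk (D : WordDiff A) (ns : List ℕ) (label : ℕ → List A)
      (hlen : ns.length + 1 = (padded r).length) (hnodup : ns.Nodup)
      (hnew : ∀ n ∈ ns, n ∉ D.arrows.states)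
      (hold : ∀ n, n ∉ ns → label n = D.label n)
      (hlabel : ∀ e ∈ loopArrows (padded r) ns, e.2.2 ≠ 0 →
        LabelReduce M S ((e.2.1.1.map inv).toList ++ label e.1 ++ e.2.1.2.toList) (label e.2.2)) :
      AttachLoop inv M S r D
        ⟨D.arrows ∪ loopArrows (padded r) ns, D.needed ∪ loopArrows (padded r) ns, label⟩

/-- Attach the loops of several rules. -/
inductive AttachLoops (inv : A → A) (M : Automaton A) (S : Store A) :
    List (Rule A) → WordDiff A → WordDiff A → Prop
  | nil (D : WordDiff A) : AttachLoops inv M S [] D D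
  | cons {r : Rule A} {L : List (Rule A)} {D D₁ D₂ : WordDiff A}
      (h : AttachLoop inv M S r D D₁) (hL : AttachLoops inv M S L D₁ D₂) :
      AttachLoops inv M S (r :: L) D D₂

/-- Incorporate a rule, by welding, into the language of `WDiff`. -/
def Incorporate (inv : A → A) (M : Automaton A) (S : Store A) (r : Rule A)
    (D D' : WordDiff A) : Prop :=
  ∃ D₁ : WordDiff A, AttachLoop inv M S r D D₁ ∧ Weld D₁ D'

/-- Distinct states have distinct labels. -/
def WordDiff.LabelsDistinct (D : WordDiff A) : Prop :=
  ∀ s ∈ D.arrows.states, ∀ t ∈ D.arrows.states, D.label s = D.label t → s = t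

/-- Reduce the words attached to the states, using the rules of `D` itself. -/
inductive Relabel (S : Store A) : WordDiff A → WordDiff A → Prop
  | mk (D : WordDiff A) (label : ℕ → List A)
      (h : ∀ s, LabelReduce D.arrows S (D.label s) (label s)) :
      Relabel S D { D with label := label }

/-- Identify two distinct states which have the same label. -/
inductive LabelMerge : WordDiff A → WordDiff A → Prop
  | mk (D : WordDiff A) (s t : ℕ) (hs : s ∈ D.arrows.states) (ht : t ∈ D.arrows.states)
      (h : D.label s = D.label t) (hne : s ≠ t) (ht0 : t ≠ 0) : LabelMerge D (D.merge s t)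

/-- Reduce the labels and, as long as there are distinct states with the same label, identify such
states, weld, and repeat. -/
inductive Amalgamate (S : Store A) : WordDiff A → WordDiff A → Prop
  | done {D D₁ : WordDiff A} (h : Relabel S D D₁) (hd : D₁.LabelsDistinct) : Amalgamate S D D₁
  | again {D D₁ D₂ D₃ D₄ : WordDiff A} (h : Relabel S D D₁) (hd : ¬ D₁.LabelsDistinct)
      (hmerge : Exhaust LabelMerge D₁ D₂) (hweld : Weld D₂ D₃) (hrep : Amalgamate S D₃ D₄) :
      Amalgamate S D D₄

end WDiff

/-! ## The Knuth-Bendix procedure -/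

section Procedure

variable {A : Type*} [LinearOrder A]

/-- Minimize the rule `r` and handle the output: incorporate the output into `WDiff` and record
it in the store; then delete `r` at once if some proper subword of its left-hand side is reducible,
and otherwise move `r` to the `Delete` list if it was not minimal. -/
inductive Treat (inv : A → A) (M : Automaton A) (r : Rule A) :
    Store A → WordDiff A → Store A → WordDiff A → Prop
  | reducible {S S₁ : Store A} {D D' : WordDiff A} {o : Rule A}
      (hmin : Minimize inv M S r S₁ o)
      (hD : (o = ([], []) ∧ D' = D) ∨ (o ≠ ([], []) ∧ Incorporate inv M S₁ o D D'))
      (hr : ¬ ProperIrred (setOfRules M) r.1) :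
      Treat inv M r S D ((S₁.recordOutput o).remove r) D'
  | nonminimal {S S₁ : Store A} {D D' : WordDiff A} {o : Rule A}
      (hmin : Minimize inv M S r S₁ o)
      (hD : (o = ([], []) ∧ D' = D) ∨ (o ≠ ([], []) ∧ Incorporate inv M S₁ o D D'))
      (hr : ProperIrred (setOfRules M) r.1) (ho : o ≠ r) :
      Treat inv M r S D ((S₁.recordOutput o).moveToDelete r) D'
  | minimal {S S₁ : Store A} {D D' : WordDiff A}
      (hmin : Minimize inv M S r S₁ r)
      (hD : Incorporate inv M S₁ r D D')
      (hr : ProperIrred (setOfRules M) r.1) :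
      Treat inv M r S D (S₁.recordOutput r) D'

/-- A non-empty suffix `z` of the left-hand side of `r` is a prefix of the left-hand side of `r'`;
`p` is the pair of words obtained from the overlap by the two elementary reductions. The overlap
of a rule with the whole of itself is excluded. -/
def Overlap (r r' : Rule A) (p : List A × List A) : Prop :=
  ∃ s₁ z s₂ : List A, z ≠ [] ∧ r.1 = s₁ ++ z ∧ r'.1 = z ++ s₂ ∧ ¬ (r = r' ∧ s₁ = []) ∧
    p = (r.2 ++ s₂, s₁ ++ r'.2)

/-- Insert the rule given by two words into `New`, unless the words are equal or the rule is
already in the store. -/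
inductive InsertPair (S : Store A) (a b : List A) : Store A → Prop
  | eq (h : a = b) : InsertPair S a b S
  | gt (h : SLt b a) : InsertPair S a b (S.addNew (a, b))
  | lt (h : SLt a b) : InsertPair S a b (S.addNew (b, a))

/-- The position in the main loop, with the items that the current loop still has to treat. -/
inductive Phase (A : Type*) where
  | processConsidered (todo : Finset (Rule A))
  | processNew
  | processNow
  | compare (todo : Finset (List A × List A))

/-- The data of the procedure at a given time: the number of the current pass, the position
in the main loop, the store, `WDiff`, and the automaton `Rules` of the current pass. -/
structure Config (A : Type*) where
  pass : ℕ
  phase : Phase A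
  store : Store A
  wdiff : WordDiff A
  rules : Automaton A

/-- The elementary steps of a Knuth-Bendix pass. -/
inductive Step (inv : A → A) : Config A → Config A → Prop
  /- treat a rule in `Considered` -/
  | considered {n : ℕ} {todo : Finset (Rule A)} {S S' : Store A} {D D' : WordDiff A}
      {M : Automaton A} (r : Rule A) (hr : r ∈ todo) (h : Treat inv M r S D S' D') :
      Step inv ⟨n, .processConsidered todo, S, D, M⟩
        ⟨n, .processConsidered (todo.erase r), S', D', M⟩
  | consideredDone {n : ℕ} {S : Store A} {D : WordDiff A} {M : Automaton A} :
      Step inv ⟨n, .processConsidered ∅, S, D, M⟩ ⟨n, .processNew, S, D, M⟩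
  /- treat a rule in `New` -/
  | new {n : ℕ} {S S' : Store A} {D D' : WordDiff A} {M : Automaton A} (r : Rule A)
      (hr : r ∈ S.new) (h : Treat inv M r S D S' D') :
      Step inv ⟨n, .processNew, S, D, M⟩ ⟨n, .processNew, S', D', M⟩
  | newDone {n : ℕ} {S : Store A} {D : WordDiff A} {M : Automaton A} (h : S.new = ∅) :
      Step inv ⟨n, .processNew, S, D, M⟩ ⟨n, .processNow, S, D, M⟩
  /- move a rule from `Now` to `Considered` and look for its overlaps with all rules in
  `Considered`, including itself -/
  | now {n : ℕ} {S : Store A} {D : WordDiff A} {M : Automaton A} (r : Rule A) (hr : r ∈ S.now)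
      (todo : Finset (List A × List A))
      (htodo : ∀ p, p ∈ todo ↔ ∃ r' ∈ insert r S.considered, Overlap r r' p ∨ Overlap r' r p) :
      Step inv ⟨n, .processNow, S, D, M⟩
        ⟨n, .compare todo, { S with considered := insert r S.considered, now := S.now.erase r },
          D, M⟩
  /- analyse a critical pair -/
  | compare {n : ℕ} {todo : Finset (List A × List A)} {S S₁ S₂ S₃ : Store A} {D : WordDiff A}
      {M : Automaton A} (p : List A × List A) (hp : p ∈ todo) (a b : List A)
      (h₁ : AutReduce M S p.1 S₁ a) (h₂ : AutReduce M S₁ p.2 S₂ b) (h : InsertPair S₂ a b S₃) :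
      Step inv ⟨n, .compare todo, S, D, M⟩ ⟨n, .compare (todo.erase p), S₃, D, M⟩
  | compareDone {n : ℕ} {S : Store A} {D : WordDiff A} {M : Automaton A} :
      Step inv ⟨n, .compare ∅, S, D, M⟩ ⟨n, .processNow, S, D, M⟩
  /- end of the pass: amalgamate states of `WDiff`, delete from it what is not needed, copy it
  to `Rules`, reset the marks, empty `Delete`, and start the next pass -/
  | endPass {n : ℕ} {S : Store A} {D D' : WordDiff A} {M : Automaton A} (h : S.now = ∅)
      (hD : Amalgamate S D D') :
      Step inv ⟨n, .processNow, S, D, M⟩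
        ⟨n + 1, .processConsidered S.considered, { S with delete := ∅ },
          ⟨D'.needed, ∅, D'.label⟩, D'.needed⟩

variable [Fintype A]

/-- The rules `(x · inv x, ε)` and the rules in `R`. -/
def initialRules (inv : A → A) (R : Finset (Rule A)) : Finset (Rule A) :=
  Finset.univ.image (fun x => ([x, inv x], [])) ∪ R

/-- The store at the start. -/
def initialStore (inv : A → A) (R : Finset (Rule A)) : Store A :=
  ⟨∅, ∅, initialRules inv R, ∅⟩

/-- The initial arrangement: all initial rules are in `New`, and their automata are welded
together to form `WDiff` and `Rules[1]`. -/
inductive Initial (inv : A → A) (R : Finset (Rule A)) : Config A → Prop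
  | mk (L : List (Rule A)) (hL : ∀ r, r ∈ L ↔ r ∈ initialRules inv R) (D₁ D₂ D : WordDiff A)
      (hloops : AttachLoops inv ∅ (initialStore inv R) L ⟨∅, ∅, fun _ => []⟩ D₁)
      (hweld : Weld D₁ D₂) (hlabel : Relabel (initialStore inv R) D₂ D) :
      Initial inv R ⟨1, .processConsidered ∅, initialStore inv R, ⟨D.arrows, D.arrows, D.label⟩,
        D.arrows⟩

/-- An execution of the procedure: `c t` describes the data at time `t`, the number of
elementary steps since the start. -/
def IsRun (inv : A → A) (R : Finset (Rule A)) (c : ℕ → Config A) : Prop :=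
  Initial inv R (c 0) ∧ ∀ t, Step inv (c t) (c (t + 1))

end Procedure

/-! ## Permanent rules -/

section Permanent

variable {A : Type*} [LinearOrder A]

/-- The set of all rules in the store at time `t`. -/
def rulesAt (c : ℕ → Config A) (t : ℕ) : Set (Rule A) := ↑(c t).store.rules

/-- `u` is irreducible at arbitrarily large times. -/
def PermIrred (c : ℕ → Config A) (u : List A) : Prop :=
  ∃ᶠ t in Filter.atTop, IsIrred (rulesAt c t) u

/-- A rule of the store is permanent if its right-hand side and every proper subword of its
left-hand side are permanently irreducible. -/
def Permanent (c : ℕ → Config A) (r : Rule A) : Prop :=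
  (∃ t, r ∈ rulesAt c t) ∧ PermIrred c r.2 ∧
    ∀ s : List A, s <:+: r.1 → s ≠ r.1 → PermIrred c s

end Permanent

end KnuthBendix

open KnuthBendix

/-!
The procedure changes its automaton and discards rules all the time, so that neither the set of
rules nor the rewriting relation grows with time. What does grow is the relation `Conn`, which
says that two words are connected by reductions of words below a given bound. Three facts carry
the proof.

* *Bounded connections survive.* When a rule `r` is treated, then either some rule reduces a
  proper subword of the left-hand side of `r`, or the output has the same left-hand side as `r`;
  in both cases the result is connected with the right-hand side of `r` below the left-hand side
  (`Minimize.spec`). Rules below the left-hand side of `r` differ from `r` and survive the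
  treatment, so by induction the current rules simulate all former rules (`run_simulates`). Hence
  reducible words stay reducible, and the Thue classes never change: they are the fibres of the
  map to the group (`thue_rulesAt_iff`). In particular, a word is permanently irreducible if and
  only if it is irreducible by the set `allRules` of all rules that ever occur.

* *Late passes recognize reducible words.* Welding may destroy the acceptance of a rule only by
  the omission of the arrows labelled `(x, x)` at `0`, and then the automaton accepts a rule whose
  left-hand side is a proper subword (`refines_dropDiag`). So what has been incorporated into
  `WDiff` stays recognized (`Recognizes`) until the next pass. Each pass ends, since only finitely
  many rules can be treated in it (`exists_end`), and each rule which stays in the store is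
  treated in each pass (`eventually_at_end`). It follows that a reducible word is reducible by the
  automaton of each late pass (`eventually_not_irred_rules`): for a minimal reducible word `l`,
  some rule with left-hand side `l` is always present, and its treatment gives an output with
  left-hand side `l`.

* *Permanent rules suffice.* By the previous fact, for a fixed left-hand side, the outputs
  of minimization with this left-hand side are permanent in all late passes. Therefore each rule is
  a consequence of a permanent rule that reduces its left-hand side, and of reductions below it
  (`exists_permanent_derivation`). Permanent rules stay in the store, end up in `Considered`, and
  all their overlaps have been analysed (`permanent_overlap`).

Two reductions of a word by `allRules` are thus connected below that word, first for permanent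
rules and then for all rules (`allRules_conn`). The generalized Newman lemma `eq_of_thue_of_irred`
shows that irreducible words of the same Thue class are equal; so the irreducible words are the
short-lex normal forms (`allRules_irred_iff`), and the permanent rules are the minimal rules of
`U` (`permanent_iff_minimal`). Finally, a rule that is not minimal is not formed again in late
passes, as it is neither irreducible nor the best rule of the automaton for its left-hand side,
and it is removed when it is treated for the last time (`eventually_notMem_rulesAt`).
-/

namespace KnuthBendix

/-! ### The short-lex order -/

section Order

variable {A : Type*}

/-- An embedding of the short-lex order into a linear order. -/
def slKey (u : List A) : ℕ ×ₗ List A := toLex (u.length, u)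

lemma slKey_injective : Function.Injective (slKey (A := A)) := fun u v h => by
  have := congrArg (fun z => (ofLex z).2) h
  simpa [slKey] using this

variable [LinearOrder A]

/-- The weak short-lex order. -/
def SLe (u v : List A) : Prop := ¬ SLt v u

lemma slt_iff_key {u v : List A} : SLt u v ↔ slKey u < slKey v := by
  unfold SLt slKey
  rw [List.shortlex_def, Prod.Lex.toLex_lt_toLex]
  rfl

lemma sle_iff_key {u v : List A} : SLe u v ↔ slKey u ≤ slKey v := by
  rw [SLe, slt_iff_key, not_lt]

lemma SLt.trans {u v w : List A} (h : SLt u v) (h' : SLt v w) : SLt u w := by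
  rw [slt_iff_key] at *; exact h.trans h'

lemma SLt.irrefl (u : List A) : ¬ SLt u u := by rw [slt_iff_key]; exact lt_irrefl _

lemma SLt.ne {u v : List A} (h : SLt u v) : u ≠ v := by
  rintro rfl; exact SLt.irrefl _ h

lemma SLt.asymm {u v : List A} (h : SLt u v) : ¬ SLt v u := fun h' => SLt.irrefl _ (h.trans h')

lemma SLt.sle {u v : List A} (h : SLt u v) : SLe u v := h.asymm

lemma SLe.refl (u : List A) : SLe u u := SLt.irrefl u

lemma SLe.trans {u v w : List A} (h : SLe u v) (h' : SLe v w) : SLe u w := by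
  rw [sle_iff_key] at *; exact h.trans h'

lemma SLe.trans_slt {u v w : List A} (h : SLe u v) (h' : SLt v w) : SLt u w := by
  rw [sle_iff_key] at h; rw [slt_iff_key] at *; exact h.trans_lt h'

lemma SLt.trans_sle {u v w : List A} (h : SLt u v) (h' : SLe v w) : SLt u w := by
  rw [sle_iff_key] at h'; rw [slt_iff_key] at *; exact h.trans_le h'

lemma sle_iff {u v : List A} : SLe u v ↔ SLt u v ∨ u = v := by
  rw [sle_iff_key, slt_iff_key, le_iff_lt_or_eq, slKey_injective.eq_iff]

lemma SLe.slt_of_ne {u v : List A} (h : SLe u v) (hne : u ≠ v) : SLt u v :=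
  (sle_iff.1 h).resolve_right hne

lemma SLt.trichotomy (u v : List A) : SLt u v ∨ u = v ∨ SLt v u := by
  rw [slt_iff_key, slt_iff_key, ← slKey_injective.eq_iff]; exact lt_trichotomy _ _

lemma SLt.of_length {u v : List A} (h : u.length < v.length) : SLt u v :=
  List.Shortlex.of_length_lt h

lemma SLt.length_le {u v : List A} (h : SLt u v) : u.length ≤ v.length := by
  rcases List.shortlex_def.1 h with h | h
  · exact h.le
  · exact h.1.le

lemma SLe.length_le {u v : List A} (h : SLe u v) : u.length ≤ v.length := by
  rcases sle_iff.1 h with h | rfl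
  · exact h.length_le
  · exact le_rfl

lemma not_slt_nil (u : List A) : ¬ SLt u [] := List.not_shortlex_nil_right

lemma slt_cons_of_lt {x y : A} {u v : List A} (h : x < y) (hl : u.length = v.length) :
    SLt (x :: u) (y :: v) :=
  List.Shortlex.of_lex (by simp [hl]) (List.Lex.rel h)

lemma SLt.append_left {u v : List A} (h : SLt u v) (a : List A) : SLt (a ++ u) (a ++ v) :=
  List.Shortlex.append_left h a

lemma lex_append_right {u v : List A} (h : List.Lex (· < ·) u v) (hl : u.length = v.length)
    (b : List A) : List.Lex (· < ·) (u ++ b) (v ++ b) := by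
  induction h with
  | nil => simp at hl
  | cons h ih => exact List.Lex.cons (ih (by simpa using hl))
  | rel h => exact List.Lex.rel h

lemma SLt.append_right {u v : List A} (h : SLt u v) (b : List A) : SLt (u ++ b) (v ++ b) := by
  rcases List.shortlex_def.1 h with h | ⟨hl, h⟩
  · exact SLt.of_length (by simpa using h)
  · exact List.Shortlex.of_lex (by simp [hl]) (lex_append_right h hl b)

lemma SLt.context {u v : List A} (h : SLt u v) (a b : List A) :
    SLt (a ++ u ++ b) (a ++ v ++ b) := (h.append_left a).append_right b

lemma SLe.context {u v : List A} (h : SLe u v) (a b : List A) :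
    SLe (a ++ u ++ b) (a ++ v ++ b) := by
  rcases sle_iff.1 h with h | rfl
  · exact (h.context a b).sle
  · exact SLe.refl _

lemma SLt.of_context {u v a b : List A} (h : SLt (a ++ u ++ b) (a ++ v ++ b)) : SLt u v := by
  rcases SLt.trichotomy u v with h' | rfl | h'
  · exact h'
  · exact absurd h (SLt.irrefl _)
  · exact absurd h (h'.context a b).asymm

lemma slt_of_infix {l w : List A} (h : l <:+: w) (hne : l ≠ w) : SLt l w :=
  SLt.of_length (lt_of_le_of_ne h.length_le fun e => hne (h.eq_of_length e))

lemma sle_of_infix {l w : List A} (h : l <:+: w) : SLe l w := by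
  by_cases e : l = w
  · rw [e]; exact SLe.refl _
  · exact (slt_of_infix h e).sle

lemma sle_context (a l b : List A) : SLe l (a ++ l ++ b) := sle_of_infix ⟨a, b, rfl⟩

lemma slt_wellFounded [Finite A] : WellFounded (SLt (A := A)) :=
  List.Shortlex.wf (wellFounded_lt (α := A))

lemma finite_slt [Finite A] (u : List A) : {v : List A | SLt v u}.Finite :=
  (List.finite_length_le A u.length).subset fun _ h => SLt.length_le h

end Order

/-! ### Connection of words through bounded words -/

section Connection

variable {A : Type*}

/-- The words `u` and `v` are connected by elementary `T`-reductions, applied in either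
direction, of words in `p`: since reductions decrease words, such a chain does not leave `p` when
`p` is an initial segment. -/
def Conn (T : Set (Rule A)) (p : List A → Prop) : List A → List A → Prop :=
  Relation.EqvGen fun u v => Elementary T u v ∧ p u

variable {T T' : Set (Rule A)} {p q : List A → Prop} {u v w : List A}

lemma Elementary.mono (h : T ⊆ T') (hs : Elementary T u v) : Elementary T' u v := by
  obtain ⟨a, b, r, hr, h1, h2⟩ := hs
  exact ⟨a, b, r, h hr, h1, h2⟩

lemma Elementary.context (hs : Elementary T u v) (a b : List A) :
    Elementary T (a ++ u ++ b) (a ++ v ++ b) := by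
  obtain ⟨a', b', r, hr, rfl, rfl⟩ := hs
  exact ⟨a ++ a', b' ++ b, r, hr, by simp, by simp⟩

lemma Elementary.of_mem {r : Rule A} (h : r ∈ T) : Elementary T r.1 r.2 :=
  ⟨[], [], r, h, by simp, by simp⟩

lemma Elementary.not_irred (hs : Elementary T u v) : ¬ IsIrred T u := by
  obtain ⟨a, b, r, hr, rfl, rfl⟩ := hs
  exact fun h => h r hr ⟨a, b, rfl⟩

lemma exists_elementary (h : ¬ IsIrred T u) : ∃ v, Elementary T u v := by
  simp only [IsIrred, not_forall, not_not] at h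
  obtain ⟨r, hr, a, b, rfl⟩ := h
  exact ⟨a ++ r.2 ++ b, a, b, r, hr, rfl, rfl⟩

lemma IsIrred.mono (h : T ⊆ T') (hu : IsIrred T' u) : IsIrred T u := fun r hr => hu r (h hr)

lemma IsIrred.of_infix (hu : IsIrred T u) (h : v <:+: u) : IsIrred T v :=
  fun r hr hi => hu r hr (hi.trans h)

lemma ProperIrred.of_infix (hu : ProperIrred T u) (h : v <:+: u) : ProperIrred T v := by
  intro s hs hne
  refine hu s (hs.trans h) ?_
  rintro rfl
  exact hne (hs.eq_of_length (le_antisymm hs.length_le h.length_le))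

lemma IsIrred.proper (hu : IsIrred T u) : ProperIrred T u := fun _ hs _ => hu.of_infix hs

lemma Conn.refl (u : List A) : Conn T p u u := Relation.EqvGen.refl u

lemma Conn.symm (h : Conn T p u v) : Conn T p v u := Relation.EqvGen.symm _ _ h

lemma Conn.trans (h : Conn T p u v) (h' : Conn T p v w) : Conn T p u w :=
  Relation.EqvGen.trans _ _ _ h h'

lemma Conn.of_step (h : Elementary T u v) (hp : p u) : Conn T p u v :=
  Relation.EqvGen.rel _ _ ⟨h, hp⟩

lemma Conn.map (hc : Conn T p u v) (hT : T ⊆ T') (hpq : ∀ y, p y → q y) : Conn T' q u v :=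
  Relation.EqvGen.mono (fun _ _ h => ⟨h.1.mono hT, hpq _ h.2⟩) _ _ hc

lemma Conn.imp (hc : Conn T p u v) (hpq : ∀ y, p y → q y) : Conn T q u v :=
  hc.map subset_rfl hpq

lemma Conn.context (hc : Conn T p u v) (a b : List A) (hpq : ∀ y, p y → q (a ++ y ++ b)) :
    Conn T q (a ++ u ++ b) (a ++ v ++ b) := by
  induction hc with
  | rel x y h => exact .of_step (h.1.context a b) (hpq _ h.2)
  | refl x => exact .refl _
  | symm x y _ ih => exact ih.symm
  | trans x y z _ _ ih ih' => exact ih.trans ih'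

lemma Conn.thue (hc : Conn T p u v) : Thue T u v := Relation.EqvGen.mono (fun _ _ h => h.1) _ _ hc

lemma reflTransGen_eq_or_not_irred {T : Set (Rule A)} {u v : List A}
    (h : Relation.ReflTransGen (Elementary T) u v) : v = u ∨ ¬ IsIrred T u := by
  rcases Relation.ReflTransGen.cases_head h with rfl | ⟨x, hx, _⟩
  · exact .inl rfl
  · exact .inr hx.not_irred

/-- The maximal proper prefix and the maximal proper suffix decide whether all proper subwords are
irreducible. -/
lemma properIrred_of_prefix_suffix {T : Set (Rule A)} {p s : List A} {x y : A}
    (heq : p ++ [x] = y :: s) (hp : IsIrred T p) (hs : IsIrred T s) :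
    ProperIrred T (p ++ [x]) := by
  rintro w ⟨a, b, hw⟩ hne
  rcases List.eq_nil_or_concat b with rfl | ⟨b, z, rfl⟩
  · cases a with
    | nil => simp only [List.nil_append, List.append_nil] at hw; exact absurd hw hne
    | cons a₀ a =>
      rw [heq] at hw
      simp only [List.cons_append, List.append_nil, List.cons.injEq] at hw
      exact hs.of_infix ⟨a, [], by simpa using hw.2⟩
  · rw [List.concat_eq_append, ← List.append_assoc] at hw
    exact hp.of_infix ⟨a, b, (List.append_inj' hw rfl).1⟩

variable [LinearOrder A]

/-- The rules of `T` that are smaller than `w` can be simulated by `X`, without exceeding their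
left-hand sides. -/
def Simulates (T X : Set (Rule A)) (w : List A) : Prop :=
  ∀ r ∈ T, SLt r.1 w → Conn X (SLe · r.1) r.1 r.2

lemma Conn.lift {X : Set (Rule A)} (hc : Conn T (SLt · w) u v) (hs : Simulates T X w) :
    Conn X (SLt · w) u v := by
  induction hc with
  | rel x y h =>
    obtain ⟨⟨a, b, r, hr, rfl, rfl⟩, hlt⟩ := h
    refine (hs r hr ((sle_context a r.1 b).trans_slt hlt)).context a b fun y hy => ?_
    exact (hy.context a b).trans_slt hlt
  | refl x => exact .refl _
  | symm x y _ ih => exact ih.symm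
  | trans x y z _ _ ih ih' => exact ih.trans ih'

lemma Elementary.slt (hT : ∀ r ∈ T, SLt r.2 r.1) (h : Elementary T u v) : SLt v u := by
  obtain ⟨a, b, r, hr, rfl, rfl⟩ := h
  exact (hT r hr).context a b

/-- A finite chain is bounded by one of its words. -/
lemma Conn.exists_bound (hc : Conn T p u v) : u = v ∨ ∃ w, p w ∧ Conn T (SLe · w) u v := by
  induction hc with
  | rel x y h => exact .inr ⟨x, h.2, .of_step h.1 (SLe.refl x)⟩
  | refl x => exact .inl rfl
  | symm x y _ ih =>
    rcases ih with rfl | ⟨w, hw, h⟩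
    · exact .inl rfl
    · exact .inr ⟨w, hw, h.symm⟩
  | trans x y z _ _ ih ih' =>
    rcases ih with rfl | ⟨w, hw, h⟩
    · exact ih'
    rcases ih' with rfl | ⟨w', hw', h'⟩
    · exact .inr ⟨w, hw, h⟩
    by_cases hww : SLe w w'
    · exact .inr ⟨w', hw', (h.imp fun y hy => hy.trans hww).trans h'⟩
    · exact .inr ⟨w, hw, h.trans (h'.imp fun y hy => hy.trans (not_not.1 hww).sle)⟩

/-- A chain bounded by `w` can be replaced by a chain strictly below `w`, up to a reduction of its
ends if these are `w`, provided that any two reductions of `w` are connected below `w`. -/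
lemma Conn.cut_peak (hT : ∀ r ∈ T, SLt r.2 r.1)
    (hloc : ∀ v₁ v₂, Elementary T w v₁ → Elementary T w v₂ → Conn T (SLt · w) v₁ v₂)
    (hc : Conn T (SLe · w) u v) :
    u = v ∨ ∃ z z', (u ≠ w ∧ z = u ∨ u = w ∧ Elementary T w z) ∧
      (v ≠ w ∧ z' = v ∨ v = w ∧ Elementary T w z') ∧ Conn T (SLt · w) z z' := by
  induction hc with
  | rel x y h =>
    obtain ⟨h, hx⟩ := h
    have hyx := h.slt hT
    have hyw : SLt y w := hyx.trans_sle hx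
    by_cases e : x = w
    · subst e
      exact .inr ⟨y, y, .inr ⟨rfl, h⟩, .inl ⟨hyx.ne, rfl⟩, .refl _⟩
    · exact .inr ⟨x, y, .inl ⟨e, rfl⟩, .inl ⟨hyw.ne, rfl⟩, .of_step h (hx.slt_of_ne e)⟩
  | refl x => exact .inl rfl
  | symm x y _ ih =>
    rcases ih with rfl | ⟨z, z', h, h', hc⟩
    · exact .inl rfl
    · exact .inr ⟨z', z, h', h, hc.symm⟩
  | trans x y t _ _ ih ih' =>
    rcases ih with rfl | ⟨z, z', h, h', hc⟩
    · exact ih'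
    rcases ih' with rfl | ⟨s, s', g, g', hd⟩
    · exact .inr ⟨z, z', h, h', hc⟩
    refine .inr ⟨z, s', h, g', hc.trans (Conn.trans ?_ hd)⟩
    rcases h' with ⟨hy, rfl⟩ | ⟨rfl, h'⟩
    · rcases g with ⟨_, rfl⟩ | ⟨rfl, g⟩
      · exact .refl _
      · exact absurd rfl hy
    · rcases g with ⟨hy, rfl⟩ | ⟨_, g⟩
      · exact absurd rfl hy
      · exact hloc _ _ h' g

/-- A generalized Newman lemma: if any two reductions of a word are connected below this word, then
irreducible words are equal as soon as they are Thue equivalent. -/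
theorem eq_of_thue_of_irred [Finite A] (hT : ∀ r ∈ T, SLt r.2 r.1)
    (hloc : ∀ w v₁ v₂, Elementary T w v₁ → Elementary T w v₂ → Conn T (SLt · w) v₁ v₂)
    (huv : Thue T u v) (hu : IsIrred T u) (hv : IsIrred T v) : u = v := by
  have key : ∀ w, Conn T (SLe · w) u v → u = v := by
    intro w
    refine slt_wellFounded.induction (C := fun w => Conn T (SLe · w) u v → u = v) w
      fun w ih hc => ?_
    · rcases hc.cut_peak hT (hloc w) with h | ⟨z, z', h, h', hd⟩
      · exact h
      rcases h with ⟨_, rfl⟩ | ⟨rfl, h⟩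
      · rcases h' with ⟨_, rfl⟩ | ⟨rfl, h'⟩
        · rcases hd.exists_bound with h | ⟨w', hw', he⟩
          · exact h
          · exact ih w' hw' he
        · exact absurd hv h'.not_irred
      · exact absurd hu h.not_irred
  have hc : Conn T (fun _ => True) u v := Relation.EqvGen.mono (fun _ _ h => ⟨h, trivial⟩) _ _ huv
  rcases hc.exists_bound with h | ⟨w', _, hc⟩
  · exact h
  · exact key w' hc

/-- A chain that starts at a word which bounds it must start with a reduction. -/
lemma Conn.not_irred (hT : ∀ r ∈ T, SLt r.2 r.1) (hc : Conn T (SLe · u) u v) (hne : u ≠ v) :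
    ¬ IsIrred T u := by
  intro hu
  have : ∀ x y, Conn T (SLe · u) x y → (x = u ↔ y = u) := by
    intro x y hc
    induction hc with
    | rel x y h =>
      have h1 : x ≠ u := by rintro rfl; exact h.1.not_irred hu
      have h2 : y ≠ u := ((h.1.slt hT).trans_sle h.2).ne
      simp [h1, h2]
    | refl x => rfl
    | symm x y _ ih => exact ih.symm
    | trans x y z _ _ ih ih' => exact ih.trans ih'
  exact hne ((this u v hc).1 rfl).symm

end Connection

/-! ### The group, and short-lex normal forms -/

section Value

variable {A : Type*} {inv : A → A} {R : Finset (Rule A)}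

@[simp] lemma value_nil : value inv R [] = 1 := rfl

@[simp] lemma value_append (u v : List A) :
    value inv R (u ++ v) = value inv R u * value inv R v := by simp [value]

lemma value_cons (x : A) (v : List A) :
    value inv R (x :: v) = value inv R [x] * value inv R v := value_append [x] v

lemma value_inv (x : A) : value inv R [x, inv x] = 1 := by
  have : FreeGroup.of x * FreeGroup.of (inv x) ∈ relators inv R := .inl ⟨x, rfl⟩
  have h := PresentedGroup.one_of_mem this
  simpa [value, PresentedGroup.of] using h

lemma value_map_of (w : List A) :
    value inv R w = PresentedGroup.mk (relators inv R) (w.map FreeGroup.of).prod := by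
  simp only [value, map_list_prod, List.map_map, Function.comp_def]
  rfl

lemma value_rule {r : Rule A} (hr : r ∈ R) : value inv R r.1 = value inv R r.2 := by
  have : (r.1.map FreeGroup.of).prod * ((r.2.map FreeGroup.of).prod)⁻¹ ∈ relators inv R :=
    .inr ⟨r, hr, rfl⟩
  have h := PresentedGroup.one_of_mem this
  rw [map_mul, map_inv, mul_inv_eq_one] at h
  rw [value_map_of, value_map_of, h]

lemma value_context {u v : List A} (h : value inv R u = value inv R v) (a b : List A) :
    value inv R (a ++ u ++ b) = value inv R (a ++ v ++ b) := by simp [h]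

lemma value_of_context {u v a b : List A}
    (h : value inv R (a ++ u ++ b) = value inv R (a ++ v ++ b)) :
    value inv R u = value inv R v := by simpa using h

/-- The rules `(x · inv x, ε)`. -/
def invRules (inv : A → A) : Set (Rule A) := Set.range fun x => ([x, inv x], [])

lemma value_invRules : ∀ r ∈ invRules inv, value inv R r.1 = value inv R r.2 := by
  rintro _ ⟨x, rfl⟩
  exact value_inv x

lemma Overlap.value_eq {r r' : Rule A} {p : List A × List A} (h : Overlap r r' p)
    (hr : value inv R r.1 = value inv R r.2) (hr' : value inv R r'.1 = value inv R r'.2) :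
    value inv R p.1 = value inv R p.2 := by
  obtain ⟨s₁, z, s₂, -, h1, h2, -, rfl⟩ := h
  rw [h1] at hr
  rw [h2] at hr'
  simp only [value_append] at *
  rw [← hr, ← hr', mul_assoc]

variable {T : Set (Rule A)}

lemma Thue.value_eq (hT : ∀ r ∈ T, value inv R r.1 = value inv R r.2) {u v : List A}
    (h : Thue T u v) : value inv R u = value inv R v := by
  induction h with
  | rel x y h =>
    obtain ⟨a, b, r, hr, rfl, rfl⟩ := h
    exact value_context (hT r hr) a b
  | refl x => rfl
  | symm x y _ ih => exact ih.symm
  | trans x y z _ _ ih ih' => exact ih.trans ih'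

lemma Thue.context {u v : List A} (h : Thue T u v) (a b : List A) :
    Thue T (a ++ u ++ b) (a ++ v ++ b) := by
  induction h with
  | rel x y h => exact .rel _ _ (h.context a b)
  | refl x => exact .refl _
  | symm x y _ ih => exact ih.symm
  | trans x y z _ _ ih ih' => exact ih.trans _ _ _ ih'

/-- Thue equivalence as a congruence on the free monoid. -/
def thueCon (T : Set (Rule A)) : Con (FreeMonoid A) where
  r u v := Thue T u.toList v.toList
  iseqv := ⟨fun _ => .refl _, fun h => .symm _ _ h, fun h h' => .trans _ _ _ h h'⟩
  mul' {a b c d} h h' := by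
    have h1 := h.context [] c.toList
    have h2 := h'.context b.toList []
    simp only [List.nil_append, List.append_nil] at h1 h2
    exact .trans _ _ _ h1 h2

/-- If `T` contains the defining relations up to Thue equivalence, then the quotient of the free
monoid by Thue equivalence satisfies the relations of the group, so that words with the same value
are Thue equivalent. -/
theorem thue_of_value_eq (hinv : Function.Involutive inv)
    (hI : ∀ x, Thue T [x, inv x] []) (hR : ∀ r ∈ R, Thue T r.1 r.2) {u v : List A}
    (h : value inv R u = value inv R v) : Thue T u v := by
  let cls : FreeMonoid A →* (thueCon T).Quotient := (thueCon T).mk'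
  have hcls : ∀ a b : List A, Thue T a b → cls (FreeMonoid.ofList a) = cls (FreeMonoid.ofList b) :=
    fun a b h => (Con.eq (thueCon T)).2 h
  have h1 : ∀ x, cls (FreeMonoid.ofList [x]) * cls (FreeMonoid.ofList [inv x]) = 1 := by
    intro x
    rw [← map_mul, ← map_one cls]
    exact hcls [x, inv x] [] (hI x)
  let f : A → (thueCon T).Quotientˣ := fun x =>
    ⟨cls (FreeMonoid.ofList [x]), cls (FreeMonoid.ofList [inv x]), h1 x, by
      have := h1 (inv x); rwa [hinv x] at this⟩
  have hf : ∀ w : List A, ((w.map f).prod : (thueCon T).Quotientˣ).val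
      = cls (FreeMonoid.ofList w) := by
    intro w
    induction w with
    | nil => simp
    | cons x w ih =>
      rw [List.map_cons, List.prod_cons, Units.val_mul, ih, ← map_mul]
      rfl
  have hlift : ∀ w : List A, FreeGroup.lift f (w.map FreeGroup.of).prod = (w.map f).prod := by
    intro w
    simp [map_list_prod, Function.comp_def]
  have hrel : ∀ g ∈ relators inv R, FreeGroup.lift f g = 1 := by
    rintro g (⟨x, rfl⟩ | ⟨r, hr, rfl⟩)
    · ext
      simpa [f] using h1 x
    · rw [map_mul, map_inv, hlift, hlift, mul_inv_eq_one]
      ext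
      rw [hf, hf]
      exact hcls _ _ (hR r hr)
  let F := PresentedGroup.toGroup hrel
  have hF : ∀ w : List A, (F (value inv R w)).val = cls (FreeMonoid.ofList w) := by
    intro w
    rw [← hf w]
    congr 1
    simp only [value, map_list_prod, List.map_map, Function.comp_def, F]
    simp
  have := hF u
  rw [h, hF v] at this
  exact ((Con.eq (thueCon T)).1 this).symm

variable [LinearOrder A]

lemma exists_normalForm [Finite A] (u : List A) :
    ∃ v, IsNormalForm inv R v ∧ value inv R v = value inv R u := by
  obtain ⟨v, hv, hmin⟩ := slt_wellFounded.has_min {v | value inv R v = value inv R u} ⟨u, rfl⟩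
  exact ⟨v, fun w hw => hmin w (hw.trans hv), hv⟩

lemma IsNormalForm.eq {u v : List A} (hu : IsNormalForm inv R u) (hv : IsNormalForm inv R v)
    (h : value inv R u = value inv R v) : u = v := by
  rcases SLt.trichotomy u v with h' | h' | h'
  · exact absurd h' (hv u h)
  · exact h'
  · exact absurd h' (hu v h.symm)

lemma isNormalForm_iff [Finite A] {u : List A} :
    IsNormalForm inv R u ↔ IsIrred (universalRules inv R) u := by
  constructor
  · rintro hu r ⟨hlt, hv⟩ ⟨a, b, rfl⟩
    exact hu _ (value_context hv a b).symm (hlt.context a b)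
  · intro hu v hv hlt
    exact hu (u, v) ⟨hlt, hv.symm⟩ List.infix_rfl

end Value

/-! ### Aut-reduction -/

section Reduction

variable {A : Type*} [LinearOrder A] {inv : A → A} {R : Finset (Rule A)} {M : Automaton A}

/-- The rules of the store that are not waiting for their final deletion. -/
def Store.active (S : Store A) : Finset (Rule A) := S.considered ∪ S.now ∪ S.new

lemma Store.mem_active {S : Store A} {r : Rule A} :
    r ∈ S.active ↔ r ∈ S.considered ∨ r ∈ S.now ∨ r ∈ S.new := by
  simp [Store.active]

lemma Store.mem_rules {S : Store A} {r : Rule A} :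
    r ∈ S.rules ↔ r ∈ S.active ∨ r ∈ S.delete := by
  simp [Store.active, Store.rules, or_assoc]

/-- The changes of the store that Aut-reduction of words of length at most `B` can make: the only
new rules are rules of `M` with a minimal reducible left-hand side and a least right-hand side. -/
structure Grows (M : Automaton A) (B : ℕ) (S S' : Store A) : Prop where
  considered : S'.considered = S.considered
  now : S'.now = S.now
  delete : S'.delete = S.delete
  subset : S.new ⊆ S'.new
  new : ∀ r ∈ S'.new, r ∈ S.new ∨ r ∉ S.rules ∧ r ∈ setOfRules M ∧
    ProperIrred (setOfRules M) r.1 ∧ (∀ σ, (r.1, σ) ∈ setOfRules M → ¬ SLt σ r.2) ∧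
    r.1.length ≤ B

lemma Grows.refl (B : ℕ) (S : Store A) : Grows M B S S :=
  ⟨rfl, rfl, rfl, subset_rfl, fun _ h => .inl h⟩

lemma Grows.active_subset {B : ℕ} {S S' : Store A} (h : Grows M B S S') :
    S.active ⊆ S'.active := by
  intro r
  simp only [Store.mem_active, h.considered, h.now]
  exact Or.imp id (Or.imp id fun hr => h.subset hr)

lemma Grows.rules_subset {B : ℕ} {S S' : Store A} (h : Grows M B S S') : S.rules ⊆ S'.rules := by
  intro r
  simp only [Store.mem_rules, h.delete]
  exact Or.imp (fun hr => h.active_subset hr) id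

lemma Grows.trans {B : ℕ} {S S' S'' : Store A} (h : Grows M B S S') (h' : Grows M B S' S'') :
    Grows M B S S'' where
  considered := h'.considered.trans h.considered
  now := h'.now.trans h.now
  delete := h'.delete.trans h.delete
  subset := h.subset.trans h'.subset
  new r hr := by
    rcases h'.new r hr with h1 | ⟨h1, h2⟩
    · exact h.new r h1
    · exact .inr ⟨fun hn => h1 (h.rules_subset hn), h2⟩

lemma Grows.mono {B C : ℕ} {S S' : Store A} (h : Grows M B S S') (hBC : B ≤ C) :
    Grows M C S S' :=
  ⟨h.considered, h.now, h.delete, h.subset, fun r hr => (h.new r hr).imp id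
    fun h => ⟨h.1, h.2.1, h.2.2.1, h.2.2.2.1, h.2.2.2.2.trans hBC⟩⟩

lemma Grows.mem_rules {B : ℕ} {S S' : Store A} (h : Grows M B S S') {r : Rule A}
    (hr : r ∈ S'.rules) : r ∈ S.rules ∨ r ∉ S.rules ∧ r ∈ S'.new ∧ r ∈ setOfRules M ∧
      ProperIrred (setOfRules M) r.1 ∧ (∀ σ, (r.1, σ) ∈ setOfRules M → ¬ SLt σ r.2) ∧
      r.1.length ≤ B := by
  by_cases hS : r ∈ S.rules
  · exact .inl hS
  have hn : r ∈ S'.new := by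
    simp only [Store.mem_rules, Store.mem_active, h.delete, h.considered, h.now] at hr hS
    tauto
  rcases h.new r hn with h1 | h1
  · exact absurd (Store.mem_rules.2 (.inl (Store.mem_active.2 (.inr (.inr h1))))) hS
  · exact .inr ⟨hS, hn, h1.2⟩

lemma Grows.subset_of_subset {B : ℕ} {S S' : Store A} (h : Grows M B S S') {U : Set (Rule A)}
    (hS : ↑S.rules ⊆ U) (hM : setOfRules M ⊆ U) : ↑S'.rules ⊆ U := by
  intro r hr
  rcases h.mem_rules hr with h1 | h1
  · exact hS h1
  · exact hM h1.2.2.1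

lemma AutStep.grows {S S' : Store A} {w w' : List A} (h : AutStep M (S, w) (S', w')) :
    Grows M w.length S S' ∧ Elementary (↑S'.rules) w w' := by
  cases h with
  | stored S a l ρ b hred hmin hρ hleast => exact ⟨.refl _ _, a, b, _, hρ, rfl, rfl⟩
  | found S a l ρ b hmin hnone hρ hleast =>
    have hn : (l, ρ) ∉ S.rules := hnone ρ
    rw [Store.addNew, if_neg hn]
    refine ⟨⟨rfl, rfl, rfl, Finset.subset_insert _ _, ?_⟩, a, b, (l, ρ), ?_, rfl, rfl⟩
    · intro r hr
      rcases Finset.mem_insert.1 hr with rfl | hr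
      · exact .inr ⟨hn, hρ, hmin, hleast, by simp; omega⟩
      · exact .inl hr
    · simp [Store.mem_rules, Store.mem_active]

/-- A sequence of reductions is a connection that is bounded by its first word. -/
lemma ReflTransGen.conn {T : Set (Rule A)} (hT : ∀ r ∈ T, SLt r.2 r.1) {u v : List A}
    (h : Relation.ReflTransGen (Elementary T) u v) : SLe v u ∧ Conn T (SLe · u) u v := by
  induction h with
  | refl => exact ⟨SLe.refl _, .refl _⟩
  | tail _ h ih =>
    exact ⟨((h.slt hT).trans_sle ih.1).sle, ih.2.trans (.of_step h ih.1)⟩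

/-- Aut-reduction adds to the store what the automaton finds, and it is a reduction by the rules of
the final store. -/
lemma AutReduce.spec {S S' : Store A} {w w' : List A} (h : AutReduce M S w S' w')
    (hS : ↑S.rules ⊆ universalRules inv R) (hM : setOfRules M ⊆ universalRules inv R) :
    Grows M w.length S S' ∧ ↑S'.rules ⊆ universalRules inv R ∧
      Relation.ReflTransGen (Elementary (↑S'.rules)) w w' := by
  have key : ∀ y : Store A × List A, Relation.ReflTransGen (AutStep M) (S, w) y →
      Grows M w.length S y.1 ∧ ↑y.1.rules ⊆ universalRules inv R ∧
        Relation.ReflTransGen (Elementary (↑y.1.rules)) w y.2 := by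
    intro y hy
    induction hy with
    | refl => exact ⟨.refl _ _, hS, .refl⟩
    | @tail y z _ hyz ih =>
      obtain ⟨h1, h2, h3⟩ := ih
      obtain ⟨S₁, w₁⟩ := y
      obtain ⟨S₂, w₂⟩ := z
      obtain ⟨g, e⟩ := hyz.grows
      have hle := (ReflTransGen.conn (fun r hr => (h2 hr).1) h3).1.length_le
      refine ⟨h1.trans (g.mono hle), g.subset_of_subset h2 hM, ?_⟩
      refine Relation.ReflTransGen.tail ?_ e
      exact Relation.ReflTransGen.mono (fun _ _ h => h.mono g.rules_subset) _ _ h3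
  exact key _ h.1

/-! ### Rules obtained by moving letters between the two sides -/

/-- The rule `q` derives the rule `p` efficiently: the left-hand side of `q` is a subword of the
left-hand side of `p`, and after the application of `q` at this place the result is connected, by
the rules in `T` and below the left-hand side of `p`, with the right-hand side of `p`. -/
def Derives (T : Set (Rule A)) (p q : Rule A) : Prop :=
  ∃ a b, p.1 = a ++ q.1 ++ b ∧ SLt (a ++ q.2 ++ b) p.1 ∧
    Conn T (SLt · p.1) (a ++ q.2 ++ b) p.2

variable {T T' : Set (Rule A)} {p q s : Rule A}

lemma Derives.mono (h : Derives T p q) (hT : T ⊆ T') : Derives T' p q := by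
  obtain ⟨a, b, h1, h2, h3⟩ := h
  exact ⟨a, b, h1, h2, h3.map hT fun _ h => h⟩

lemma Derives.refl (h : SLt p.2 p.1) : Derives T p p :=
  ⟨[], [], by simp, by simpa using h, by simpa using Conn.refl _⟩

lemma Derives.ordered (h : Derives T p q) : SLt q.2 q.1 := by
  obtain ⟨a, b, h1, h2, -⟩ := h
  rw [h1] at h2
  exact h2.of_context

lemma Derives.infix (h : Derives T p q) : q.1 <:+: p.1 := by
  obtain ⟨a, b, h1, -, -⟩ := h
  exact ⟨a, b, h1.symm⟩

lemma Derives.trans (h : Derives T p q) (h' : Derives T q s) : Derives T p s := by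
  obtain ⟨a, b, h1, h2, h3⟩ := h
  obtain ⟨a', b', g1, g2, g3⟩ := h'
  have hlt : ∀ y, SLt y q.1 → SLt (a ++ y ++ b) p.1 := fun y hy => by
    rw [h1]; exact hy.context a b
  refine ⟨a ++ a', b' ++ b, by simp [h1, g1], ?_, ?_⟩
  · simpa using hlt _ g2
  · have := g3.context (q := (SLt · p.1)) a b hlt
    simpa using this.trans h3

lemma Derives.conn (h : Derives T p q) (hq : q ∈ T) {w : List A} (hw : SLt p.1 w) :
    Conn T (SLt · w) p.1 p.2 := by
  obtain ⟨a, b, h1, h2, h3⟩ := h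
  refine Conn.trans ?_ (h3.imp fun y hy => hy.trans hw)
  exact .of_step ⟨a, b, q, hq, h1, rfl⟩ hw

lemma Derives.value_eq (h : Derives T p q) (hT : ∀ r ∈ T, value inv R r.1 = value inv R r.2)
    (hp : value inv R p.1 = value inv R p.2) : value inv R q.1 = value inv R q.2 := by
  obtain ⟨a, b, h1, h2, h3⟩ := h
  have := h3.thue.value_eq hT
  rw [← hp, h1] at this
  exact (value_of_context this).symm

/-- Moving the last letter of the left-hand side to the other side, by means of the rule
`(inv x · x, ε)`. -/
lemma Derives.append_inv (hinv : Function.Involutive inv) {u v : List A} {x : A}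
    (h : SLt (v ++ [inv x, x]) (u ++ [x])) :
    Derives (invRules inv) (u ++ [x], v) (u, v ++ [inv x]) := by
  refine ⟨[], [x], by simp, by simpa using h, .of_step ?_ (by simpa using h)⟩
  exact ⟨v, [], _, ⟨inv x, rfl⟩, by simp [hinv x], by simp⟩

lemma MoveLast.derives (hinv : Function.Involutive inv) (h : MoveLast inv p q) :
    Derives (invRules inv) p q ∧ q.1.length < p.1.length := by
  cases h with
  | long u v x h =>
    exact ⟨.append_inv hinv (SLt.of_length (by simpa using h)), by simp⟩
  | first z y x u v hlen h =>
    refine ⟨.append_inv (u := z :: u) hinv ?_, by simp⟩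
    exact slt_cons_of_lt h (by simp at hlen ⊢; omega)
  | two z x h =>
    refine ⟨.append_inv (u := [z]) (v := []) hinv ?_, by simp⟩
    exact slt_cons_of_lt h rfl

lemma MoveFirst.derives (h : MoveFirst inv p q) :
    Derives (invRules inv) p q ∧ q.1.length < p.1.length := by
  cases h with
  | mk x y u v hlen h =>
    have hlt : SLt (x :: inv x :: v) (x :: y :: u) :=
      (slt_cons_of_lt h (by simp at hlen; omega)).append_left [x]
    refine ⟨⟨[x], [], by simp, by simpa using hlt, .of_step ?_ (by simpa using hlt)⟩, by simp⟩
    exact ⟨[], v, _, ⟨x, rfl⟩, by simp, by simp⟩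

lemma CancelFirst.derives (h : CancelFirst p q) (hp : SLt p.2 p.1) :
    Derives T p q ∧ q.1.length < p.1.length := by
  cases h with
  | mk x u v => exact ⟨⟨[x], [], by simp, by simpa using hp, by simpa using Conn.refl _⟩, by simp⟩

lemma CancelLast.derives (h : CancelLast p q) (hp : SLt p.2 p.1) :
    Derives T p q ∧ q.1.length < p.1.length := by
  cases h with
  | mk x u v => exact ⟨⟨[], [x], by simp, by simpa using hp, by simpa using Conn.refl _⟩, by simp⟩

lemma derives_of_reflTransGen {step : Rule A → Rule A → Prop}
    (hstep : ∀ p q, SLt p.2 p.1 → step p q → Derives T p q ∧ q.1.length < p.1.length)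
    (hp : SLt p.2 p.1) (h : Relation.ReflTransGen step p q) :
    Derives T p q ∧ (q = p ∨ q.1.length < p.1.length) := by
  induction h with
  | refl => exact ⟨.refl hp, .inl rfl⟩
  | tail _ h ih =>
    obtain ⟨g1, g2⟩ := hstep _ _ ih.1.ordered h
    refine ⟨ih.1.trans g1, .inr ?_⟩
    rcases ih.2 with rfl | h2
    · exact g2
    · exact g2.trans h2

lemma derives_of_once {step : Rule A → Rule A → Prop}
    (hstep : ∀ p q, SLt p.2 p.1 → step p q → Derives T p q ∧ q.1.length < p.1.length)
    (hp : SLt p.2 p.1) (h : Once step p q) :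
    Derives T p q ∧ (q = p ∨ q.1.length < p.1.length) := by
  rcases h with h | ⟨rfl, -⟩
  · exact (hstep p q hp h).imp id .inr
  · exact ⟨.refl hp, .inl rfl⟩

/-- The steps of `Adjust` after the interchange, for an ordered pair. -/
lemma adjust_ordered (hinv : Function.Involutive inv) {p₁ p₂ p₃ p₄ : Rule A}
    (hp : SLt p₁.2 p₁.1) (h₂ : Exhaust (MoveLast inv) p₁ p₂) (h₃ : Once (MoveFirst inv) p₂ p₃)
    (h₄ : Exhaust CancelFirst p₃ p₄) (h₅ : Exhaust CancelLast p₄ q) :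
    Derives (invRules inv) p₁ q ∧ (q = p₁ ∧ p₂ = p₁ ∧ p₄ = p₁ ∨ q.1.length < p₁.1.length) := by
  obtain ⟨d2, e2⟩ := derives_of_reflTransGen (fun p q _ h => MoveLast.derives hinv h) hp h₂.1
  obtain ⟨d3, e3⟩ := derives_of_once (fun p q _ h => MoveFirst.derives h) d2.ordered h₃
  obtain ⟨d4, e4⟩ := derives_of_reflTransGen (T := invRules inv)
    (fun p q hp h => CancelFirst.derives h hp) d3.ordered h₄.1
  obtain ⟨d5, e5⟩ := derives_of_reflTransGen (T := invRules inv)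
    (fun p q hp h => CancelLast.derives h hp) d4.ordered h₅.1
  refine ⟨((d2.trans d3).trans d4).trans d5, ?_⟩
  rcases e2 with rfl | e2
  · rcases e3 with rfl | e3
    · rcases e4 with rfl | e4
      · rcases e5 with rfl | e5
        · exact .inl ⟨rfl, rfl, rfl⟩
        · exact .inr e5
      · exact .inr (d5.infix.length_le.trans_lt e4)
    · exact .inr ((d4.trans d5).infix.length_le.trans_lt e3)
  · exact .inr (((d3.trans d4).trans d5).infix.length_le.trans_lt e2)

lemma MoveLast.length (h : MoveLast inv p q) : p.2.length < p.1.length := by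
  cases h with
  | long u v x h => simp at h ⊢; omega
  | first z y x u v hlen h => simp at hlen ⊢; omega
  | two z x h => simp

lemma MoveFirst.length (h : MoveFirst inv p q) : p.2.length < p.1.length := by
  cases h with
  | mk x y u v hlen h => simp at hlen ⊢; omega

lemma exhaust_eq {α : Type*} {step : α → α → Prop} {a b : α} (h : Exhaust step a b)
    (ha : ∀ c, ¬ step a c) : b = a := by
  rcases Relation.ReflTransGen.cases_head h.1 with rfl | ⟨x, hx, _⟩
  · rfl
  · exact absurd hx (ha x)

lemma interchange_iff : Interchange p q ↔ SLt p.1 p.2 ∧ q = p.swap := by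
  constructor
  · rintro ⟨u, v, h⟩; exact ⟨h, rfl⟩
  · rintro ⟨h, rfl⟩; exact ⟨p.1, p.2, h⟩

/-- The effect of `Adjust`, according to the order of the two words: equal words cancel completely;
for an ordered pair, the result derives the pair, with a shorter left-hand side unless nothing is
changed; and a pair in the wrong order is interchanged first. -/
lemma Adjust.cases (hinv : Function.Involutive inv) (h : Adjust inv p q) :
    (p.1 = p.2 ∧ q = ([], [])) ∨
    (SLt p.2 p.1 ∧ Derives (invRules inv) p q ∧ (q = p ∨ q.1.length < p.1.length)) ∨
    (SLt p.1 p.2 ∧ Derives (invRules inv) p.swap q) := by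
  obtain ⟨p₁, p₂, p₃, p₄, h₁, h₂, h₃, h₄, h₅⟩ := h
  rcases SLt.trichotomy p.1 p.2 with hlt | heq | hgt
  · have : p₁ = p.swap := by
      rcases h₁ with h₁ | ⟨_, h₁⟩
      · exact (interchange_iff.1 h₁).2
      · exact absurd (interchange_iff.2 ⟨hlt, rfl⟩) (h₁ p.swap)
    subst this
    exact .inr (.inr ⟨hlt, (adjust_ordered hinv (by simpa using hlt) h₂ h₃ h₄ h₅).1⟩)
  · refine .inl ⟨heq, ?_⟩
    have e1 : p₁ = p := by
      rcases h₁ with h₁ | ⟨h₁, _⟩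
      · exact absurd heq (interchange_iff.1 h₁).1.ne
      · exact h₁.symm
    subst e1
    have e2 := exhaust_eq h₂ fun c hc => absurd hc.length (by simp [heq])
    subst e2
    have e3 : p₃ = p₂ := by
      rcases h₃ with h₃ | ⟨h₃, _⟩
      · exact absurd h₃.length (by simp [heq])
      · exact h₃.symm
    subst e3
    have e4 : ∀ q, Relation.ReflTransGen CancelFirst p₃ q → q.1 = q.2 := by
      intro q hq
      induction hq with
      | refl => exact heq
      | tail _ h ih => cases h; simpa using ih
    have e5 := e4 p₄ h₄.1
    have e6 : p₄ = ([], []) := by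
      obtain ⟨u, v⟩ := p₄
      obtain rfl : u = v := e5
      cases u with
      | nil => rfl
      | cons x u => exact absurd (CancelFirst.mk x u u) (h₄.2 _)
    subst e6
    refine exhaust_eq h₅ fun c hc => ?_
    have : ∀ r, CancelLast r c → r.1 ≠ [] := by
      rintro r ⟨x, u, v⟩; simp
    exact this _ hc rfl
  · have : p₁ = p := by
      rcases h₁ with h₁ | ⟨h₁, _⟩
      · exact absurd (interchange_iff.1 h₁).1 hgt.asymm
      · exact h₁.symm
    subst this
    obtain ⟨d, e⟩ := adjust_ordered hinv hgt h₂ h₃ h₄ h₅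
    exact .inr (.inl ⟨hgt, d, e.imp And.left id⟩)

/-- A pair on which `Adjust` has no effect belongs to `SL2`: no common first letter is left, and no
letter can be moved from a left-hand side that is too long. -/
lemma Adjust.fixed (hinv : Function.Involutive inv) (h : Adjust inv p p) :
    p = ([], []) ∨ SL2 p.1 p.2 := by
  rcases h.cases hinv with ⟨-, h⟩ | ⟨hgt, -⟩ | ⟨hlt, d⟩
  · exact .inl h
  · right
    obtain ⟨p₁, p₂, p₃, p₄, h₁, h₂, h₃, h₄, h₅⟩ := h
    have : p₁ = p := by
      rcases h₁ with h₁ | ⟨h₁, _⟩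
      · exact absurd (interchange_iff.1 h₁).1 hgt.asymm
      · exact h₁.symm
    subst this
    obtain ⟨-, ⟨-, e2, e4⟩ | e⟩ := adjust_ordered hinv hgt h₂ h₃ h₄ h₅
    · subst e2
      refine ⟨hgt, ?_, ?_⟩
      · rintro (_ | ⟨x, l⟩) hl hl'
        · rfl
        · obtain ⟨t, ht⟩ := hl
          obtain ⟨t', ht'⟩ := hl'
          have hc : CancelFirst p₂ (l ++ t, l ++ t') := by
            obtain ⟨u, v⟩ := p₂
            simp only at ht ht'
            subst ht ht'
            exact .mk x _ _
          rw [e4] at h₄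
          exact absurd hc (h₄.2 _)
      · by_contra hlen
        obtain ⟨u, v⟩ := p₂
        rcases List.eq_nil_or_concat u with rfl | ⟨u, x, rfl⟩
        · simp at hlen
        · rw [List.concat_eq_append] at *
          exact h₂.2 _ (.long u v x (by simp at hlen ⊢; omega))
    · exact absurd e (lt_irrefl _)
  · exact absurd d.ordered hlt.asymm

end Reduction

/-! ### The minimization routine -/

section Minimization

variable {A : Type*} [LinearOrder A] {inv : A → A} {R : Finset (Rule A)} {M : Automaton A}

lemma AutReduce.conn {S S' : Store A} {w w' : List A} (h : AutReduce M S w S' w')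
    (hS : ↑S.rules ⊆ universalRules inv R) (hM : setOfRules M ⊆ universalRules inv R) :
    SLe w' w ∧ Conn (↑S'.rules) (SLe · w) w w' := by
  obtain ⟨-, h2, h3⟩ := h.spec hS hM
  exact ReflTransGen.conn (fun r hr => (h2 hr).1) h3

/-- A reduction which starts in a proper subword `p` of `a p b` begins with the application of a
rule whose left-hand side is a proper subword; all that follows happens below `a p b`. -/
lemma reduceLeft_changed {S S₁ S₂ : Store A} {p p' u : List A} {a b : List A}
    (hS : ↑S.rules ⊆ universalRules inv R) (hM : setOfRules M ⊆ universalRules inv R)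
    (hab : a ++ b ≠ []) (hp : AutReduce M S p S₁ p') (hne : p' ≠ p)
    (hu : AutReduce M S₁ (a ++ p' ++ b) S₂ u) :
    Grows M (a ++ p ++ b).length S S₂ ∧ SLt u (a ++ p ++ b) ∧
      ∃ α β, ∃ r ∈ S₂.rules, r.1 ≠ a ++ p ++ b ∧ a ++ p ++ b = α ++ r.1 ++ β ∧
        Conn (↑S₂.rules) (SLt · (a ++ p ++ b)) (α ++ r.2 ++ β) u := by
  obtain ⟨g1, h1, r1⟩ := hp.spec hS hM
  obtain ⟨g2, h2, r2⟩ := hu.spec h1 hM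
  have ord1 : ∀ r ∈ (S₁.rules : Set (Rule A)), SLt r.2 r.1 := fun r hr => (h1 hr).1
  rcases Relation.ReflTransGen.cases_head r1 with rfl | ⟨x, hx, hxp⟩
  · exact absurd rfl hne
  have hxp' := ReflTransGen.conn ord1 hxp
  have hlt : SLt x p := hx.slt ord1
  obtain ⟨α, β, r, hr, rfl, rfl⟩ := hx
  have hlt' := (hxp'.1.trans_slt hlt).context a b
  obtain ⟨hle, hc⟩ := ReflTransGen.conn (fun r hr => (h2 hr).1) r2
  refine ⟨(g1.mono (by simp; omega)).trans (g2.mono hlt'.length_le), hle.trans_slt hlt',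
    a ++ α, β ++ b, r, g2.rules_subset hr, ?_, by simp, ?_⟩
  · intro e
    have := congrArg List.length e
    have h0 : 0 < (a ++ b).length := List.length_pos_of_ne_nil hab
    simp at this h0
    omega
  · have hc1 := (hxp'.2.map (T' := ↑S₂.rules) g2.rules_subset fun _ h => h).context
      (q := (SLt · (a ++ (α ++ r.1 ++ β) ++ b))) a b
      fun y hy => (hy.trans_slt hlt).context a b
    have := hc1.trans (hc.imp fun y hy => hy.trans_slt hlt')
    simpa using this

/-- The effect of the first steps of minimization: either all proper subwords of the left-hand side
are irreducible, or the left-hand side was reduced by a rule whose left-hand side is a proper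
subword. -/
lemma ReduceLeft.spec {S S' : Store A} {w u : List A} (h : ReduceLeft M S w S' u)
    (hS : ↑S.rules ⊆ universalRules inv R) (hM : setOfRules M ⊆ universalRules inv R) :
    Grows M w.length S S' ∧ ProperIrred (setOfRules M) u ∧ (u = w ∨ SLt u w ∧
      ∃ α β, ∃ r ∈ S'.rules, r.1 ≠ w ∧ w = α ++ r.1 ++ β ∧
        Conn (↑S'.rules) (SLt · w) (α ++ r.2 ++ β) u) := by
  cases h with
  | byPrefix hp hne hu =>
    rename_i S₁ p p' x
    have := reduceLeft_changed (a := []) (b := [x]) hS hM (by simp) hp hne hu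
    exact ⟨this.1, hu.2.proper, .inr this.2⟩
  | bySuffix heq hp hs hne hu =>
    rename_i S₁ S₂ p s s' x y
    obtain ⟨g1, h1, -⟩ := hp.spec hS hM
    have := reduceLeft_changed (a := [y]) (b := []) h1 hM (by simp) hs hne (by simpa using hu)
    simp only [List.append_nil, List.cons_append] at this
    rw [heq]
    refine ⟨Grows.trans (g1.mono ?_) this.1, hu.2.proper, .inr this.2⟩
    rw [← heq]; simp
  | unchanged heq hp hs =>
    rename_i S₁ p s x y
    obtain ⟨g1, h1, -⟩ := hp.spec hS hM
    obtain ⟨g2, h2, -⟩ := hs.spec h1 hM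
    refine ⟨Grows.trans (g1.mono (by simp)) (g2.mono ?_), ?_, .inl rfl⟩
    · rw [heq]; simp
    · exact properIrred_of_prefix_suffix heq hp.2 hs.2

lemma Derives.length_le {T : Set (Rule A)} {p q : Rule A} (h : Derives T p q) :
    q.1.length ≤ p.1.length ∧ q.2.length ≤ p.1.length :=
  ⟨h.infix.length_le, h.ordered.length_le.trans h.infix.length_le⟩

/-- Properties of the output of the minimization loop. -/
lemma MinimizeLoop.output (hinv : Function.Involutive inv) {S S' : Store A} {p o : Rule A}
    (hM : setOfRules M ⊆ universalRules inv R)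
    (h : MinimizeLoop inv M S p S' o) (hS : ↑S.rules ⊆ universalRules inv R) {B : ℕ}
    (hB : p.1.length ≤ B ∧ p.2.length ≤ B) :
    Grows M B S S' ∧ o.1.length ≤ B ∧ IsIrred (setOfRules M) o.2 ∧
      (o = ([], []) ∨ SL2 o.1 o.2) ∧
      (ProperIrred (setOfRules M) p.1 → ProperIrred (setOfRules M) o.1) ∧
      (value inv R p.1 = value inv R p.2 → value inv R o.1 = value inv R o.2) := by
  induction h with
  | done hv h =>
    obtain ⟨g, h', r⟩ := hv.spec hS hM
    refine ⟨g.mono hB.2, hB.1, hv.2, h.fixed hinv, id, fun e => e.trans ?_⟩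
    exact (hv.conn hS hM).2.thue.value_eq fun r hr => (h' hr).2
  | again hv h hne hloop ih =>
    rename_i S₁ S₁ S₂ u v v₁ q o
    obtain ⟨g, h', r⟩ := hv.spec hS hM
    have hle := (hv.conn hS hM).1.length_le
    have hval := (hv.conn hS hM).2.thue.value_eq fun r hr => (h' hr).2
    have hq : (q.1.length ≤ B ∧ q.2.length ≤ B) ∧
        (ProperIrred (setOfRules M) u → ProperIrred (setOfRules M) q.1) ∧
        (value inv R u = value inv R v → value inv R q.1 = value inv R q.2) := by
      rcases h.cases hinv with ⟨-, rfl⟩ | ⟨-, d, -⟩ | ⟨-, d⟩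
      · refine ⟨by simp, fun _ => ?_, fun _ => rfl⟩
        intro s hs hne
        exact absurd (List.eq_nil_of_infix_nil hs) hne
      · have := d.length_le
        simp only at this hB
        exact ⟨⟨by omega, by omega⟩, fun hu => hu.of_infix d.infix,
          fun e => d.value_eq value_invRules (e.trans hval)⟩
      · have := d.length_le
        simp only [Prod.fst_swap] at this hB
        exact ⟨⟨by omega, by omega⟩, fun _ => hv.2.proper.of_infix d.infix,
          fun e => d.value_eq value_invRules (e.trans hval).symm⟩
    obtain ⟨i1, i2, i3, i4, i5, i6⟩ := ih h' hq.1
    exact ⟨(g.mono hB.2).trans i1, i2, i3, i4, fun hu => i5 (hq.2.1 hu), fun e => i6 (hq.2.2 e)⟩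

/-- For an ordered pair, the output of the minimization loop derives the input. -/
lemma MinimizeLoop.derives (hinv : Function.Involutive inv) {S S' : Store A} {p o : Rule A}
    (hM : setOfRules M ⊆ universalRules inv R)
    (h : MinimizeLoop inv M S p S' o) (hS : ↑S.rules ⊆ universalRules inv R)
    (hp : SLt p.2 p.1) : Derives (↑S'.rules ∪ invRules inv) p o ∧
      (o.1 = p.1 → o.2 = p.2 ∨ ¬ IsIrred (↑S'.rules) p.2) := by
  induction h with
  | done hv h =>
    obtain ⟨g, h', r⟩ := hv.spec hS hM
    obtain ⟨hle, hc⟩ := hv.conn hS hM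
    refine ⟨⟨[], [], by simp, ?_, ?_⟩, fun _ => reflTransGen_eq_or_not_irred r⟩
    · simpa using hle.trans_slt hp
    · simpa using (hc.map Set.subset_union_left fun y hy => hy.trans_slt hp).symm
  | again hv h hne hloop ih =>
    rename_i S₁ S₁ S₂ u v v₁ q o
    obtain ⟨g, h', r⟩ := hv.spec hS hM
    obtain ⟨hle, hc⟩ := hv.conn hS hM
    have hlt : SLt v₁ u := hle.trans_slt hp
    have g2 := (hloop.output hinv hM h' ⟨le_max_left _ _, le_max_right _ _⟩).1
    have d0 : Derives (↑S₂.rules ∪ invRules inv) (u, v) (u, v₁) := by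
      refine ⟨[], [], by simp, by simpa using hlt, ?_⟩
      simpa using (hc.map (Set.subset_union_of_subset_left (by exact_mod_cast g2.rules_subset) _)
        fun y hy => hy.trans_slt hp).symm
    rcases h.cases hinv with ⟨e, -⟩ | ⟨-, d, e⟩ | ⟨hlt', -⟩
    · exact absurd e.symm hlt.ne
    · have := (ih h' d.ordered).1
      refine ⟨(d0.trans (d.mono Set.subset_union_right)).trans this, fun ho => ?_⟩
      have h1 := this.infix.length_le
      rcases e with e | e
      · exact absurd e hne
      · rw [ho] at h1; simp only at h1 e; omega
    · exact absurd hlt hlt'.asymm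

/-- If both words are smaller than `w`, then the output of the minimization loop connects them
below `w`. -/
lemma MinimizeLoop.conn (hinv : Function.Involutive inv) {S S' : Store A} {p o : Rule A}
    (hM : setOfRules M ⊆ universalRules inv R)
    (h : MinimizeLoop inv M S p S' o) (hS : ↑S.rules ⊆ universalRules inv R) {w : List A}
    (h₁ : SLt p.1 w) (h₂ : SLt p.2 w) :
    Conn (↑S'.rules ∪ invRules inv ∪ {o}) (SLt · w) p.1 p.2 := by
  cases h with
  | done hv h =>
    rename_i u v v₁
    obtain ⟨hle, hc⟩ := hv.conn hS hM
    refine Conn.trans (.of_step (Elementary.of_mem (r := (u, v₁)) ?_) h₁)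
      (hc.map ?_ fun y hy => hy.trans_slt h₂).symm
    · simp
    · intro r hr; exact .inl (.inl hr)
  | again hv h hne hloop =>
    rename_i S₁ u v v₁ q
    obtain ⟨g, h', r⟩ := hv.spec hS hM
    obtain ⟨hle, hc⟩ := hv.conn hS hM
    have g2 := (hloop.output hinv hM h' ⟨le_max_left _ _, le_max_right _ _⟩).1
    refine Conn.trans ?_ (hc.map (fun r hr => .inl (.inl (g2.rules_subset hr)))
      fun y hy => hy.trans_slt h₂).symm
    have hv₁ : SLt v₁ w := hle.trans_slt h₂
    have key : ∀ p, Derives (invRules inv) p q → SLt p.1 w →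
        Conn (↑S'.rules ∪ invRules inv ∪ {o}) (SLt · w) p.1 p.2 := by
      intro p d hp
      have d' := (hloop.derives hinv hM h' d.ordered).1
      refine Derives.conn (q := o) ?_ (by simp) hp
      exact (d.mono fun r hr => .inl (.inr hr)).trans (d'.mono Set.subset_union_left)
    rcases h.cases hinv with ⟨e, -⟩ | ⟨-, d, -⟩ | ⟨-, d⟩
    · simp only at e ⊢; rw [e]; exact .refl _
    · exact key _ d h₁
    · exact (key _ d hv₁).symm

/-- The first possible outcome of the minimization of `r`, with output `o` and final store `S`: a
rule of `S`, or `o`, reduces a proper subword of the left-hand side of `r`, and the result is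
connected with the right-hand side of `r` below the left-hand side. -/
def ProperDerivation (inv : A → A) (S : Store A) (r o : Rule A) : Prop :=
  ∃ α β q, (q ∈ S.rules ∨ q = o ∧ o ≠ ([], [])) ∧ q.1 ≠ r.1 ∧ r.1 = α ++ q.1 ++ β ∧
    Conn (↑S.rules ∪ invRules inv ∪ {o}) (SLt · r.1) (α ++ q.2 ++ β) r.2

/-- The second possible outcome of the minimization of `r`, with output `o` and final store `S`:
the left-hand side stays the same, and the right-hand side is reduced. -/
def RightReduction (inv : A → A) (M : Automaton A) (S : Store A) (r o : Rule A) : Prop :=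
  o.1 = r.1 ∧ ProperIrred (setOfRules M) r.1 ∧ (o.2 = r.2 ∨ ¬ IsIrred (↑S.rules) r.2) ∧
    Conn (↑S.rules ∪ invRules inv ∪ {o}) (SLt · r.1) o.2 r.2

/-- Minimization replaces a rule by rules which derive it below its left-hand side. -/
theorem Minimize.spec (hinv : Function.Involutive inv) {S S' : Store A} {r o : Rule A}
    (h : Minimize inv M S r S' o) (hS : ↑S.rules ⊆ universalRules inv R)
    (hM : setOfRules M ⊆ universalRules inv R) (hr : r ∈ universalRules inv R) :
    Grows M r.1.length S S' ∧ o.1.length ≤ r.1.length ∧ IsIrred (setOfRules M) o.2 ∧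
      (o = ([], []) ∨ SL2 o.1 o.2 ∧ o ∈ universalRules inv R) ∧
      ProperIrred (setOfRules M) o.1 ∧
      (ProperDerivation inv S' r o ∨ RightReduction inv M S' r o) := by
  obtain ⟨S₁, u, hleft, hloop⟩ := h
  obtain ⟨g, hu, hcase⟩ := hleft.spec hS hM
  have hS₁ := g.subset_of_subset hS hM
  have hle : SLe u r.1 := by
    rcases hcase with rfl | h
    · exact SLe.refl _
    · exact h.1.sle
  obtain ⟨g2, o1, o2, o3, o4, o5⟩ := hloop.output hinv hM hS₁ (B := r.1.length)
    ⟨hle.length_le, hr.1.length_le⟩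
  have hval : value inv R u = value inv R r.2 := by
    rcases hcase with rfl | ⟨-, α, β, q, hq, -, e, hc⟩
    · exact hr.2
    · have h1 := hc.thue.value_eq (inv := inv) (R := R) fun r hr => (hS₁ hr).2
      rw [← hr.2, e, ← h1]
      exact (value_context (hS₁ hq).2 α β).symm
  refine ⟨g.trans g2, o1, o2, ?_, o4 hu, ?_⟩
  · rcases o3 with h | h
    · exact .inl h
    · exact .inr ⟨h, h.1, o5 hval⟩
  rcases hcase with rfl | ⟨hlt, α, β, q, hq, hne, e, hc⟩
  · obtain ⟨d, hd⟩ := hloop.derives hinv hM hS₁ hr.1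
    by_cases ho : o.1 = r.1
    · right
      refine ⟨ho, hu, hd ho, ?_⟩
      obtain ⟨a, b, h1, h2, h3⟩ := d
      simp only [ho] at h1
      have h4 : a.length + b.length = 0 := by
        have := congrArg List.length h1
        simp at this; omega
      have ha : a = [] := List.eq_nil_of_length_eq_zero (by omega)
      have hb : b = [] := List.eq_nil_of_length_eq_zero (by omega)
      subst ha hb
      simpa using h3.map (T' := ↑S'.rules ∪ invRules inv ∪ {o}) Set.subset_union_left
        fun _ h => h
    · left
      have hord := d.ordered
      obtain ⟨a, b, h1, h2, h3⟩ := d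
      refine ⟨a, b, o, .inr ⟨rfl, ?_⟩, ho, h1, h3.map Set.subset_union_left fun _ h => h⟩
      rintro rfl
      exact hord.ne rfl
  · left
    refine ⟨α, β, q, .inl (g2.rules_subset hq), hne, e, ?_⟩
    refine (hc.map (fun r hr => .inl (.inl (g2.rules_subset hr))) fun _ h => h).trans ?_
    exact hloop.conn hinv hM hS₁ hlt hr.1

end Minimization

/-! ### Paths in two-variable automata -/

section Paths

variable {A : Type*} {M N : Automaton A}

/-- There is a path from `s` to `t` that spells the given word. -/
def Path (M : Automaton A) : ℕ → List (Option A × Option A) → ℕ → Prop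
  | s, [], t => s = t
  | s, a :: w, t => ∃ s', (s, a, s') ∈ M ∧ Path M s' w t

lemma mem_accepts_iff_path {w : List (Option A × Option A)} :
    w ∈ M.toNFA.accepts ↔ Path M 0 w 0 := by
  have key : ∀ (w : List (Option A × Option A)) (P : Set ℕ) (t : ℕ),
      t ∈ M.toNFA.evalFrom P w ↔ ∃ s ∈ P, Path M s w t := by
    intro w
    induction w with
    | nil => intro P t; simp [Path]
    | cons a w ih =>
      intro P t
      rw [NFA.evalFrom_cons, ih]
      simp only [NFA.mem_stepSet, Path]
      constructor
      · rintro ⟨s', ⟨s, hs, hst⟩, hp⟩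
        exact ⟨s, hs, s', hst, hp⟩
      · rintro ⟨s, hs, s', hst, hp⟩
        exact ⟨s', ⟨s, hs, hst⟩, hp⟩
  rw [NFA.mem_accepts]
  constructor
  · rintro ⟨t, ht, h⟩
    obtain ⟨s, hs, hp⟩ := (key _ _ _).1 h
    obtain rfl : t = 0 := ht
    obtain rfl : s = 0 := hs
    exact hp
  · intro h
    exact ⟨0, rfl, (key _ _ _).2 ⟨0, rfl, h⟩⟩

lemma Path.map (f : ℕ → ℕ) (h : ∀ s a t, (s, a, t) ∈ M → (f s, a, f t) ∈ N)
    {w : List (Option A × Option A)} {s t : ℕ} (hp : Path M s w t) : Path N (f s) w (f t) := by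
  induction w generalizing s with
  | nil => exact congrArg f hp
  | cons a w ih =>
    obtain ⟨s', h1, h2⟩ := hp
    exact ⟨f s', h _ _ _ h1, ih h2⟩

/-- A path splits at the first arrow that does not belong to `N`. -/
lemma Path.split_first {P : ℕ × (Option A × Option A) × ℕ → Prop} (hN : ∀ e ∈ M, ¬ P e → e ∈ N)
    (hP : ∀ e, P e → e.1 = 0 ∧ e.2.2 = 0 ∧ e.2.1.1 = e.2.1.2)
    {w : List (Option A × Option A)} {s t : ℕ} (hp : Path M s w t) :
    Path N s w t ∨ ∃ w₁ x w₂, w = w₁ ++ (x, x) :: w₂ ∧ Path N s w₁ 0 ∧ Path M 0 w₂ t := by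
  induction w generalizing s with
  | nil => exact .inl hp
  | cons a w ih =>
    obtain ⟨s', h1, h2⟩ := hp
    by_cases hd : P (s, a, s')
    · obtain ⟨rfl, rfl, e⟩ := hP _ hd
      simp only at e
      exact .inr ⟨[], a.1, w, by simp [Prod.ext_iff, e], rfl, h2⟩
    · have hmem := hN _ h1 hd
      rcases ih h2 with h | ⟨w₁, x, w₂, rfl, g1, g2⟩
      · exact .inl ⟨s', hmem, h⟩
      · exact .inr ⟨a :: w₁, x, w₂, rfl, ⟨s', hmem, g1⟩, g2⟩

/-- A path splits at the last arrow that does not belong to `N`. -/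
lemma Path.split_last {P : ℕ × (Option A × Option A) × ℕ → Prop} (hN : ∀ e ∈ M, ¬ P e → e ∈ N)
    (hP : ∀ e, P e → e.1 = 0 ∧ e.2.2 = 0 ∧ e.2.1.1 = e.2.1.2)
    {w : List (Option A × Option A)} {s t : ℕ} (hp : Path M s w t) :
    Path N s w t ∨ ∃ w₁ x w₂, w = w₁ ++ (x, x) :: w₂ ∧ Path N 0 w₂ t := by
  induction w generalizing s with
  | nil => exact .inl hp
  | cons a w ih =>
    obtain ⟨s', h1, h2⟩ := hp
    rcases ih h2 with h | ⟨w₁, x, w₂, rfl, g1⟩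
    · by_cases hd : P (s, a, s')
      · obtain ⟨rfl, rfl, e⟩ := hP _ hd
        simp only at e
        exact .inr ⟨[], a.1, w, by simp [Prod.ext_iff, e], h⟩
      · exact .inl ⟨s', hN _ h1 hd, h⟩
    · exact .inr ⟨a :: w₁, x, w₂, rfl, g1⟩

lemma padded_cons_cons (a b : A) (u v : List A) :
    padded (a :: u, b :: v) = (some a, some b) :: padded (u, v) := by simp [padded]

lemma padded_cons_nil (a : A) (u : List A) :
    padded (a :: u, []) = (some a, none) :: padded (u, []) := by simp [padded]

lemma padded_nil_cons (b : A) (v : List A) :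
    padded ([], b :: v) = (none, some b) :: padded ([], v) := by simp [padded]

/-- A padded pair splits at a pair of equal labels. -/
lemma padded_split {w₁ w₂ : List (Option A × Option A)} {x : Option A} {u v : List A}
    (h : padded (u, v) = w₁ ++ (x, x) :: w₂) :
    ∃ a u₁ u₂ v₁ v₂, u = u₁ ++ a :: u₂ ∧ v = v₁ ++ a :: v₂ ∧ u₁.length = v₁.length ∧
      w₁ = padded (u₁, v₁) ∧ w₂ = padded (u₂, v₂) := by
  induction w₁ generalizing u v with
  | nil =>
    cases u with
    | nil =>
      cases v with
      | nil => simp [padded] at h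
      | cons b v =>
        rw [padded_nil_cons] at h
        simp only [List.nil_append, List.cons.injEq, Prod.mk.injEq] at h
        obtain ⟨⟨rfl, h⟩, -⟩ := h
        exact absurd h (by simp)
    | cons a u =>
      cases v with
      | nil =>
        rw [padded_cons_nil] at h
        simp only [List.nil_append, List.cons.injEq, Prod.mk.injEq] at h
        obtain ⟨⟨rfl, h⟩, -⟩ := h
        exact absurd h (by simp)
      | cons b v =>
        rw [padded_cons_cons] at h
        simp only [List.nil_append, List.cons.injEq, Prod.mk.injEq] at h
        obtain ⟨⟨rfl, h⟩, rfl⟩ := h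
        obtain rfl : b = a := by simpa using h
        exact ⟨b, [], u, [], v, rfl, rfl, rfl, by simp [padded], rfl⟩
  | cons c w₁ ih =>
    cases u with
    | nil =>
      cases v with
      | nil => simp [padded] at h
      | cons b v =>
        rw [padded_nil_cons] at h
        simp only [List.cons_append, List.cons.injEq] at h
        obtain ⟨a, u₁, u₂, v₁, v₂, e, -⟩ := ih h.2
        simp at e
    | cons a u =>
      cases v with
      | nil =>
        rw [padded_cons_nil] at h
        simp only [List.cons_append, List.cons.injEq] at h
        obtain ⟨a, u₁, u₂, v₁, v₂, -, e, -⟩ := ih h.2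
        simp at e
      | cons b v =>
        rw [padded_cons_cons] at h
        simp only [List.cons_append, List.cons.injEq] at h
        obtain ⟨d, u₁, u₂, v₁, v₂, rfl, rfl, hl, rfl, rfl⟩ := ih h.2
        exact ⟨d, a :: u₁, u₂, b :: v₁, v₂, rfl, rfl, by simp [hl],
          by rw [padded_cons_cons, h.1], rfl⟩

/-- The arrows of a loop form a path; the list `ns` holds its intermediate states. -/
lemma loop_path (ns : List ℕ) (w : List (Option A × Option A)) (s : ℕ)
    (hlen : ns.length + 1 = w.length)
    (hM : ∀ e ∈ (s :: ns).zip (w.zip (ns ++ [0])), e ∈ M) : Path M s w 0 := by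
  induction ns generalizing w s with
  | nil =>
    match w, hlen with
    | [a], _ => exact ⟨0, hM _ (by simp), rfl⟩
  | cons n ns ih =>
    match w, hlen with
    | a :: w, hlen =>
      refine ⟨n, hM _ (by simp), ih w n (by simpa using hlen) fun e he => hM e ?_⟩
      simp only [List.zip_cons_cons, List.cons_append, List.mem_cons] at he ⊢
      exact .inr he

end Paths

/-! ### Soundness: the word differences -/

section Soundness

variable {A : Type*} {inv : A → A} {R : Finset (Rule A)} {M N : Automaton A}

/-- The group elements `g` attached to the states are compatible with the arrow `e`. -/
def SoundArrow (inv : A → A) (R : Finset (Rule A)) (g : ℕ → PresentedGroup (relators inv R))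
    (e : ℕ × (Option A × Option A) × ℕ) : Prop :=
  value inv R e.2.1.1.toList * g e.2.2 = g e.1 * value inv R e.2.1.2.toList

/-- The group elements `g` attached to the states are word differences for the automaton `M`. -/
def Sound (inv : A → A) (R : Finset (Rule A)) (M : Automaton A)
    (g : ℕ → PresentedGroup (relators inv R)) : Prop :=
  g 0 = 1 ∧ ∀ e ∈ M, SoundArrow inv R g e

lemma Sound.mono {g : ℕ → PresentedGroup (relators inv R)} (h : Sound inv R N g) (hM : M ⊆ N) :
    Sound inv R M g := ⟨h.1, fun e he => h.2 e (hM he)⟩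

lemma value_padded_left (u v : List A) :
    value inv R ((padded (u, v)).flatMap fun a => a.1.toList) = value inv R u := by
  induction u generalizing v with
  | nil =>
    induction v with
    | nil => simp [padded]
    | cons b v ih => rw [padded_nil_cons]; simpa using ih
  | cons a u ih =>
    cases v with
    | nil => rw [padded_cons_nil, value_cons, ← ih []]; simp; exact value_cons _ _
    | cons b v => rw [padded_cons_cons, value_cons, ← ih v]; simp; exact value_cons _ _

lemma value_padded_right (u v : List A) :
    value inv R ((padded (u, v)).flatMap fun a => a.2.toList) = value inv R v := by
  induction v generalizing u with
  | nil =>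
    induction u with
    | nil => simp [padded]
    | cons b v ih => rw [padded_cons_nil]; simpa using ih
  | cons a v ih =>
    cases u with
    | nil => rw [padded_nil_cons, value_cons, ← ih []]; simp; exact value_cons _ _
    | cons b u => rw [padded_cons_cons, value_cons, ← ih u]; simp; exact value_cons _ _

/-- Along a path, the word differences compare the two words that label the path. -/
lemma Sound.path {g : ℕ → PresentedGroup (relators inv R)} (h : Sound inv R M g)
    {w : List (Option A × Option A)} {s t : ℕ} (hp : Path M s w t) :
    value inv R (w.flatMap fun a => a.1.toList) * g t =
      g s * value inv R (w.flatMap fun a => a.2.toList) := by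
  induction w generalizing s with
  | nil => obtain rfl : s = t := hp; simp
  | cons a w ih =>
    obtain ⟨s', h1, h2⟩ := hp
    have e1 := h.2 _ h1
    simp only [SoundArrow] at e1
    simp only [List.flatMap_cons, value_append]
    rw [mul_assoc, ih h2, ← mul_assoc, e1, mul_assoc]

/-- If all arrows of a loop but the last one are compatible with word differences, and the two words
that label the loop have the same value, then the last arrow is compatible as well. -/
lemma sound_loop {g : ℕ → PresentedGroup (relators inv R)} (hg : g 0 = 1) (ns : List ℕ)
    (w : List (Option A × Option A)) (s : ℕ) (hns : 0 ∉ ns)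
    (hlen : ns.length + 1 = w.length)
    (hM : ∀ e ∈ (s :: ns).zip (w.zip (ns ++ [0])), e.2.2 ≠ 0 → SoundArrow inv R g e)
    (hw : value inv R (w.flatMap fun a => a.1.toList) =
      g s * value inv R (w.flatMap fun a => a.2.toList)) :
    ∀ e ∈ (s :: ns).zip (w.zip (ns ++ [0])), SoundArrow inv R g e := by
  induction ns generalizing w s with
  | nil =>
    match w, hlen with
    | [a], _ =>
      intro e he
      simp only [List.nil_append, List.zip_cons_cons, List.zip_nil_right, List.mem_singleton] at he
      subst he
      simp only [SoundArrow, hg, mul_one]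
      simpa using hw
  | cons n ns ih =>
    match w, hlen with
    | a :: w, hlen =>
      simp only [List.mem_cons, not_or] at hns
      have h1 := hM (s, a, n) (by simp) (Ne.symm hns.1)
      intro e he
      simp only [List.zip_cons_cons, List.cons_append, List.mem_cons] at he
      rcases he with rfl | he
      · exact h1
      refine ih w n hns.2 (by simpa using hlen) (fun e he hne => hM e ?_ hne) ?_ e he
      · simp only [List.zip_cons_cons, List.cons_append, List.mem_cons]
        exact .inr he
      · simp only [SoundArrow] at h1
        simp only [List.flatMap_cons, value_append] at hw
        rw [← mul_assoc, ← h1, mul_assoc] at hw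
        exact mul_left_cancel hw

/-- The marked part of `WDiff` is a part of `WDiff`, and the words attached to the states represent
the word differences. -/
structure WordDiff.Valid (inv : A → A) (R : Finset (Rule A)) (D : WordDiff A) : Prop where
  needed : D.needed ⊆ D.arrows
  sound : Sound inv R D.arrows fun n => value inv R (D.label n)

/-- States that are identified by welding have the same word difference. -/
lemma Sound.forced {D : WordDiff A} (h : D.Valid inv R) {s t : ℕ} (hf : D.Forced s t) :
    value inv R (D.label s) = value inv R (D.label t) := by
  cases hf with
  | target h₁ h₂ =>
    have e1 := h.sound.2 _ h₁
    have e2 := h.sound.2 _ h₂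
    simp only [SoundArrow] at e1 e2
    exact mul_left_cancel (e1.trans e2.symm)
  | source h₁ h₂ =>
    have e1 := h.sound.2 _ h₁
    have e2 := h.sound.2 _ h₂
    simp only [SoundArrow] at e1 e2
    exact mul_right_cancel (e1.symm.trans e2)
  | @diagOut t x h₁ =>
    have e1 := h.sound.2 _ h₁
    have h0 : value inv R (D.label 0) = 1 := h.sound.1
    simp only [SoundArrow, h0, one_mul] at e1
    rw [h0]
    exact (mul_eq_left.1 e1).symm
  | @diagIn t x h₁ =>
    have e1 := h.sound.2 _ h₁
    have h0 : value inv R (D.label 0) = 1 := h.sound.1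
    simp only [SoundArrow, h0, mul_one] at e1
    rw [h0]
    exact (mul_eq_right.1 e1.symm).symm

variable [LinearOrder A]

lemma Sound.subset {g : ℕ → PresentedGroup (relators inv R)} (h : Sound inv R M g) :
    setOfRules M ⊆ universalRules inv R := by
  rintro ⟨u, v⟩ ⟨h1, h2⟩
  have := h.path (mem_accepts_iff_path.1 h1)
  rw [h.1, mul_one, one_mul, value_padded_left, value_padded_right] at this
  exact ⟨h2.1, this⟩

end Soundness

/-! ### Welding -/

section Welding

variable {A : Type*} [LinearOrder A] {inv : A → A} {R : Finset (Rule A)} {M N N' : Automaton A}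

/-- The automaton `N` accepts the rule `r`, or at least reduces a proper subword of its left-hand
side. In contrast to acceptance, this is stable under welding. -/
def Recognizes (N : Automaton A) (r : Rule A) : Prop :=
  r ∈ setOfRules N ∨ ∃ q ∈ setOfRules N, q.1 <:+: r.1 ∧ q.1 ≠ r.1

/-- Every rule of `N` is recognized by `N'`. -/
def Refines (N N' : Automaton A) : Prop := ∀ r ∈ setOfRules N, Recognizes N' r

lemma Refines.recognizes (h : Refines N N') {r : Rule A} (hr : Recognizes N r) :
    Recognizes N' r := by
  rcases hr with hr | ⟨q, hq, hi, hne⟩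
  · exact h r hr
  · have hlt : q.1.length < r.1.length :=
      lt_of_le_of_ne hi.length_le fun e => hne (hi.eq_of_length e)
    rcases h q hq with h1 | ⟨s, hs, hi', -⟩
    · exact .inr ⟨q, h1, hi, hne⟩
    · refine .inr ⟨s, hs, hi'.trans hi, fun e => ?_⟩
      rw [← e] at hlt
      exact absurd hi'.length_le (not_le.2 hlt)

lemma Refines.refl (N : Automaton A) : Refines N N := fun _ hr => .inl hr

lemma Refines.trans {N₁ N₂ N₃ : Automaton A} (h : Refines N₁ N₂) (h' : Refines N₂ N₃) :
    Refines N₁ N₃ := fun r hr => h'.recognizes (h r hr)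

lemma Refines.of_map (f : ℕ → ℕ) (h0 : f 0 = 0)
    (h : ∀ s a t, (s, a, t) ∈ N → (f s, a, f t) ∈ N') : Refines N N' := by
  rintro r ⟨h1, h2⟩
  have := (mem_accepts_iff_path.1 h1).map f h
  rw [h0] at this
  exact .inl ⟨mem_accepts_iff_path.2 this, h2⟩

lemma Refines.of_subset (h : N ⊆ N') : Refines N N' :=
  .of_map id rfl fun _ _ _ he => h he

lemma Recognizes.not_irred {r : Rule A} (h : Recognizes N r) : ¬ IsIrred (setOfRules N) r.1 := by
  rcases h with h | ⟨q, hq, hi, -⟩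
  · exact fun hr => hr r h List.infix_rfl
  · exact fun hr => hr q hq hi

lemma SL2.cons_ne {x : A} {u v : List A} (h : SL2 (x :: u) (x :: v)) : False := by
  have := h.2.1 [x] ⟨u, rfl⟩ ⟨v, rfl⟩
  simp at this

/-- Omission of the loops labelled `(x, x)` at `0` from a welded automaton. A path that uses such a
loop splits: if the two words of the rule have the same length, then the part before the first such
loop is a rule, and otherwise the part after the last such loop is a rule. -/
lemma refines_dropDiag {D : WordDiff A} (hD : D.needed ⊆ D.arrows) (hw : ∀ E, ¬ WeldStep D E) :
    Refines D.needed D.dropDiag.needed := by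
  rintro ⟨u, v⟩ ⟨hacc, hsl⟩
  simp only at hsl
  have hpath := mem_accepts_iff_path.1 hacc
  let P : ℕ × (Option A × Option A) × ℕ → Prop :=
    fun e => e.1 = 0 ∧ e.2.2 = 0 ∧ e.2.1.1 = e.2.1.2
  have hN : ∀ e ∈ D.needed, ¬ P e → e ∈ D.dropDiag.needed := fun e he hP => by
    simp only [WordDiff.dropDiag, Finset.mem_filter]
    exact ⟨he, hP⟩
  -- after welding, an arrow labelled `(x, x)` that leaves `0` is a loop, and has been omitted
  have hno : ∀ (x : A) (t : ℕ), (0, (some x, some x), t) ∉ D.dropDiag.needed := by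
    intro x t ht
    obtain ⟨h1, h2⟩ := Finset.mem_filter.1 ht
    by_cases h0 : t = 0
    · exact h2 ⟨rfl, h0, rfl⟩
    · exact hw _ (.mk D 0 t (.diagOut (hD h1)) (Ne.symm h0) h0)
  by_cases hlen : u.length = v.length
  · rcases hpath.split_first hN (fun _ h => h) with h | ⟨w₁, x, w₂, e, h1, -⟩
    · exact .inl ⟨mem_accepts_iff_path.2 h, hsl⟩
    obtain ⟨a, u₁, u₂, v₁, v₂, rfl, rfl, hl, rfl, rfl⟩ := padded_split e
    refine .inr ⟨(u₁, v₁), ⟨mem_accepts_iff_path.2 h1, ?_, ?_, by simp only; omega⟩,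
      ⟨[], a :: u₂, by simp⟩, by simp⟩
    · match u₁, v₁, hl with
      | [], [], _ => exact (SL2.cons_ne hsl).elim
      | b :: u₁, c :: v₁, hl =>
        have hlt := hsl.1
        simp only [List.cons_append] at hlt
        rw [SLt, List.shortlex_iff_lex (by simpa using hlen.symm)] at hlt
        cases hlt with
        | rel h => exact slt_cons_of_lt h (by simpa using hl.symm)
        | cons h => exact (SL2.cons_ne hsl).elim
    · exact fun p hp hp' => hsl.2.1 p (hp.trans ⟨_, rfl⟩) (hp'.trans ⟨_, rfl⟩)
  · have hlt : v.length < u.length := lt_of_le_of_ne hsl.1.length_le (Ne.symm hlen)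
    rcases hpath.split_last hN (fun _ h => h) with h | ⟨w₁, x, w₂, e, h1⟩
    · exact .inl ⟨mem_accepts_iff_path.2 h, hsl⟩
    obtain ⟨a, u₁, u₂, v₁, v₂, rfl, rfl, hl, rfl, rfl⟩ := padded_split e
    have h2 := hsl.2.2
    simp only [List.length_append, List.length_cons] at h2 hlt
    refine .inr ⟨(u₂, v₂), ⟨mem_accepts_iff_path.2 h1, SLt.of_length ?_, ?_, ?_⟩,
      ⟨u₁ ++ [a], [], by simp⟩, fun e => ?_⟩
    · simp only; omega
    · rintro (_ | ⟨x, l⟩) ⟨t, ht⟩ ⟨t', ht'⟩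
      · rfl
      · simp only at ht ht'
        subst ht ht'
        rw [List.cons_append, List.cons_append, padded_cons_cons] at h1
        obtain ⟨s, hs, -⟩ := h1
        exact absurd hs (hno _ _)
    · simp only; omega
    · have := congrArg List.length e
      simp at this
      omega

lemma WordDiff.Valid.merge {D : WordDiff A} (h : D.Valid inv R) {s t : ℕ}
    (hst : value inv R (D.label s) = value inv R (D.label t)) : (D.merge s t).Valid inv R := by
  refine ⟨Finset.image_subset_image h.needed, h.sound.1, fun e he => ?_⟩
  simp only [WordDiff.merge, Finset.mem_image] at he
  obtain ⟨e, he, rfl⟩ := he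
  have := h.sound.2 e he
  simp only [SoundArrow, WordDiff.merge] at this ⊢
  have hif : ∀ n, value inv R (D.label (if n = t then s else n)) = value inv R (D.label n) := by
    intro n; split_ifs with h
    · rw [hst, h]
    · rfl
  rw [hif, hif, this]

lemma refines_merge (D : WordDiff A) {s t : ℕ} (ht : t ≠ 0) :
    Refines D.needed (D.merge s t).needed := by
  refine .of_map (fun n => if n = t then s else n) (if_neg (Ne.symm ht)) fun a b c h => ?_
  simp only [WordDiff.merge, Finset.mem_image]
  exact ⟨_, h, rfl⟩

lemma exhaust_weldStep {D D' : WordDiff A} (h : D.Valid inv R)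
    (hs : Relation.ReflTransGen WeldStep D D') :
    D'.Valid inv R ∧ Refines D.needed D'.needed := by
  induction hs with
  | refl => exact ⟨h, .refl _⟩
  | tail _ hstep ih =>
    cases hstep with
    | mk s t hf hne ht =>
      exact ⟨ih.1.merge (Sound.forced ih.1 hf), ih.2.trans (refines_merge _ ht)⟩

lemma exhaust_labelMerge {D D' : WordDiff A} (h : D.Valid inv R)
    (hs : Relation.ReflTransGen LabelMerge D D') :
    D'.Valid inv R ∧ Refines D.needed D'.needed := by
  induction hs with
  | refl => exact ⟨h, .refl _⟩
  | tail _ hstep ih =>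
    cases hstep with
    | mk s t hs ht hf hne ht0 =>
      exact ⟨ih.1.merge (congrArg _ hf), ih.2.trans (refines_merge _ ht0)⟩

lemma WordDiff.Valid.dropDiag {D : WordDiff A} (h : D.Valid inv R) : D.dropDiag.Valid inv R :=
  ⟨Finset.filter_subset_filter _ h.needed, h.sound.mono (Finset.filter_subset _ _)⟩

lemma Weld.spec {D D' : WordDiff A} (h : D.Valid inv R) (hw : Weld D D') :
    D'.Valid inv R ∧ Refines D.needed D'.needed := by
  obtain ⟨D₁, hD₁, rfl⟩ := hw
  obtain ⟨h1, h2⟩ := exhaust_weldStep h hD₁.1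
  exact ⟨h1.dropDiag, h2.trans (refines_dropDiag h1.needed hD₁.2)⟩

lemma LabelReduce.value_eq {S : Store A} {w w' : List A} (h : LabelReduce M S w w')
    (hS : ↑S.rules ⊆ universalRules inv R) (hM : setOfRules M ⊆ universalRules inv R) :
    value inv R w' = value inv R w := by
  have hU : ∀ r ∈ setOfRules M ∪ ↑S.rules, r ∈ universalRules inv R := fun r hr =>
    hr.elim (fun h => hM h) fun h => hS h
  exact ((ReflTransGen.conn (fun r hr => (hU r hr).1) h.1).2.thue.value_eq
    fun r hr => (hU r hr).2).symm

lemma AttachLoop.spec {S : Store A} {r : Rule A} {D D' : WordDiff A}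
    (h : AttachLoop inv M S r D D') (hD : D.Valid inv R)
    (hS : ↑S.rules ⊆ universalRules inv R) (hM : setOfRules M ⊆ universalRules inv R)
    (hr : value inv R r.1 = value inv R r.2) :
    D'.Valid inv R ∧ D.needed ⊆ D'.needed ∧ Path D'.needed 0 (padded r) 0 := by
  cases h with
  | mk ns label hlen hnodup hnew hold hlabel =>
    have h0 : 0 ∉ ns := fun h => hnew 0 h (by simp [Automaton.states])
    refine ⟨⟨Finset.union_subset_union_left hD.needed, ?_, ?_⟩, Finset.subset_union_left, ?_⟩
    · simp only [hold 0 h0]; exact hD.sound.1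
    · intro e he
      rcases Finset.mem_union.1 he with he | he
      · have hs : ∀ n ∈ D.arrows.states, label n = D.label n := fun n hn =>
          hold n fun h => hnew n h hn
        have h1 : e.1 ∈ D.arrows.states := by
          simp only [Automaton.states, Finset.mem_insert, Finset.mem_union, Finset.mem_image]
          exact .inr (.inl ⟨e, he, rfl⟩)
        have h2 : e.2.2 ∈ D.arrows.states := by
          simp only [Automaton.states, Finset.mem_insert, Finset.mem_union, Finset.mem_image]
          exact .inr (.inr ⟨e, he, rfl⟩)
        have := hD.sound.2 e he
        simp only [SoundArrow] at this ⊢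
        rw [hs _ h1, hs _ h2, this]
      · have hg : value inv R (label 0) = 1 := by rw [hold 0 h0]; exact hD.sound.1
        refine sound_loop (g := fun n => value inv R (label n)) hg ns (padded r) 0 h0 hlen ?_ ?_ e
          (List.mem_toFinset.1 he)
        · intro e he hne
          have := (hlabel e (List.mem_toFinset.2 he) hne).value_eq hS hM
          simp only [SoundArrow, this, value_append]
          rw [← mul_assoc, ← mul_assoc]
          congr 1
          cases e.2.1.1 with
          | none => simp
          | some x =>
            have hx : value inv R [x] * value inv R [inv x] = 1 := by
              rw [← value_append]; exact value_inv x
            simp [hx]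
        · simp only [hg, one_mul]
          rw [value_padded_left, value_padded_right, hr]
    · refine loop_path ns (padded r) 0 hlen fun e he => Finset.mem_union_right _ ?_
      exact List.mem_toFinset.2 he

lemma Incorporate.spec {S : Store A} {r : Rule A} {D D' : WordDiff A}
    (h : Incorporate inv M S r D D') (hD : D.Valid inv R)
    (hS : ↑S.rules ⊆ universalRules inv R) (hM : setOfRules M ⊆ universalRules inv R)
    (hr : value inv R r.1 = value inv R r.2) :
    D'.Valid inv R ∧ Refines D.needed D'.needed ∧ (SL2 r.1 r.2 → Recognizes D'.needed r) := by
  obtain ⟨D₁, ha, hw⟩ := h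
  obtain ⟨h1, h2, h3⟩ := ha.spec hD hS hM hr
  obtain ⟨g1, g2⟩ := Weld.spec h1 hw
  exact ⟨g1, (Refines.of_subset h2).trans g2,
    fun hsl => g2 r ⟨mem_accepts_iff_path.2 h3, hsl⟩⟩

lemma AttachLoops.valid {S : Store A} {L : List (Rule A)} {D D' : WordDiff A}
    (h : AttachLoops inv M S L D D') (hD : D.Valid inv R)
    (hS : ↑S.rules ⊆ universalRules inv R) (hM : setOfRules M ⊆ universalRules inv R)
    (hL : ∀ r ∈ L, value inv R r.1 = value inv R r.2) : D'.Valid inv R := by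
  induction h with
  | nil D => exact hD
  | cons h _ ih =>
    simp only [List.mem_cons, forall_eq_or_imp] at hL
    exact ih (h.spec hD hS hM hL.1).1 hL.2

lemma Relabel.valid {S : Store A} {D D' : WordDiff A} (h : Relabel S D D')
    (hD : D.Valid inv R) (hS : ↑S.rules ⊆ universalRules inv R) :
    D'.Valid inv R ∧ D'.needed = D.needed := by
  cases h with
  | mk label h =>
    have hv : ∀ n, value inv R (label n) = value inv R (D.label n) := fun n =>
      (h n).value_eq hS hD.sound.subset
    refine ⟨⟨hD.needed, ?_⟩, rfl⟩
    simp only [hv]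
    exact hD.sound

lemma Amalgamate.spec {S : Store A} {D D' : WordDiff A} (h : Amalgamate S D D')
    (hD : D.Valid inv R) (hS : ↑S.rules ⊆ universalRules inv R) :
    D'.Valid inv R ∧ Refines D.needed D'.needed := by
  induction h with
  | done h _ =>
    obtain ⟨h1, h2⟩ := h.valid hD hS
    exact ⟨h1, h2 ▸ .refl _⟩
  | again h _ hmerge hweld _ ih =>
    obtain ⟨h1, h2⟩ := h.valid hD hS
    obtain ⟨h3, h4⟩ := exhaust_labelMerge h1 hmerge.1
    obtain ⟨h5, h6⟩ := Weld.spec h3 hweld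
    obtain ⟨h7, h8⟩ := ih h5
    exact ⟨h7, h2 ▸ (h4.trans h6).trans h8⟩

end Welding

/-! ### The elementary steps of the procedure -/

section Steps

variable {A : Type*} [LinearOrder A] {inv : A → A} {R : Finset (Rule A)} {M : Automaton A}

/-- The effect of the treatment of the rule `r`, with output `o` of the minimization routine; `S₁`
is the store after the minimization. -/
structure TreatSpec (inv : A → A) (R : Finset (Rule A)) (M : Automaton A) (r : Rule A)
    (S : Store A) (D : WordDiff A) (S' : Store A) (D' : WordDiff A) (S₁ : Store A) (o : Rule A) :
    Prop where
  grows : Grows M r.1.length S S₁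
  out_length : o.1.length ≤ r.1.length
  out_irred : IsIrred (setOfRules M) o.2
  out_proper : ProperIrred (setOfRules M) o.1
  out_cases : o = ([], []) ∨ SL2 o.1 o.2 ∧ o ∈ universalRules inv R
  derive : ProperDerivation inv S₁ r o ∨ RightReduction inv M S₁ r o
  considered : S'.considered ⊆ S.considered
  considered_of_ne : ∀ q ∈ S.considered, q ≠ r → q ∈ S'.considered
  new_subset : S'.new ⊆ S₁.new
  new_of_ne : ∀ q ∈ S₁.new, q ≠ r → q ≠ o → q ∈ S'.new
  not_new : r ∉ S'.new
  active_of_ne : ∀ q ∈ S₁.active, q ≠ r → q ∈ S'.active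
  rules_of_ne : ∀ q ∈ S₁.rules, q ≠ r → q ∈ S'.rules
  mem_active : ∀ q ∈ S'.active, q ∈ S₁.active ∨ q = o ∧ o ≠ ([], [])
  mem_rules : ∀ q ∈ S'.rules, q ∈ S₁.rules ∨ q = o ∧ o ≠ ([], [])
  out_active : o ≠ ([], []) → o ≠ r → o ∈ S'.active
  keep : ProperIrred (setOfRules M) r.1 → (o = r → r ∈ S'.active) ∧ r ∈ S'.rules
  drop : o ≠ r → r ∉ S'.active
  valid : D'.Valid inv R
  refines : Refines D.needed D'.needed
  recognizes : o ≠ ([], []) → Recognizes D'.needed o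

lemma Store.mem_recordOutput_considered {S : Store A} {o q : Rule A} :
    q ∈ (S.recordOutput o).considered ↔ q ∈ S.considered := by
  unfold Store.recordOutput; split_ifs <;> rfl

lemma Store.mem_recordOutput_delete {S : Store A} {o q : Rule A} :
    q ∈ (S.recordOutput o).delete ↔ q ∈ S.delete := by
  unfold Store.recordOutput; split_ifs <;> rfl

lemma Store.mem_recordOutput_new {S : Store A} {o q : Rule A} :
    q ∈ (S.recordOutput o).new ↔ q ∈ S.new ∧ (o = ([], []) ∨ q ≠ o) := by
  unfold Store.recordOutput
  by_cases h : o = ([], [])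
  · simp [h]
  · rw [if_neg h]
    simp [h, and_comm]

lemma Store.mem_recordOutput_now {S : Store A} {o q : Rule A} :
    q ∈ (S.recordOutput o).now ↔ q ∈ S.now ∨ q = o ∧ o ≠ ([], []) ∧ o ∉ S.considered := by
  unfold Store.recordOutput
  by_cases h : o = ([], [])
  · simp [h]
  · rw [if_neg h]
    by_cases h' : o ∈ S.considered
    · simp [h']
    · simp [h', h, or_comm]

lemma ne_nil_of_mem {r : Rule A} (hr : r ∈ universalRules inv R) : r ≠ ([], []) := by
  rintro rfl
  exact SLt.irrefl _ hr.1

lemma Treat.spec (hinv : Function.Involutive inv) {r : Rule A} {S S' : Store A}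
    {D D' : WordDiff A} (h : Treat inv M r S D S' D') (hS : ↑S.rules ⊆ universalRules inv R)
    (hM : setOfRules M ⊆ universalRules inv R) (hD : D.Valid inv R) (hr : r ∈ S.active) :
    ∃ S₁ o, TreatSpec inv R M r S D S' D' S₁ o := by
  have hrU : r ∈ universalRules inv R := hS (Store.mem_rules.2 (.inl hr))
  have hr0 := ne_nil_of_mem hrU
  have key : ∃ S₁ o, Minimize inv M S r S₁ o ∧
      ((o = ([], []) ∧ D' = D) ∨ (o ≠ ([], []) ∧ Incorporate inv M S₁ o D D')) ∧
      (¬ ProperIrred (setOfRules M) r.1 ∧ S' = (S₁.recordOutput o).remove r ∨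
        ProperIrred (setOfRules M) r.1 ∧ o ≠ r ∧ S' = (S₁.recordOutput o).moveToDelete r ∨
        ProperIrred (setOfRules M) r.1 ∧ o = r ∧ S' = S₁.recordOutput r) := by
    cases h with
    | reducible hmin hD hr => exact ⟨_, _, hmin, hD, .inl ⟨hr, rfl⟩⟩
    | nonminimal hmin hD hr ho => exact ⟨_, _, hmin, hD, .inr (.inl ⟨hr, ho, rfl⟩)⟩
    | minimal hmin hD hr => exact ⟨_, _, hmin, .inr ⟨hr0, hD⟩, .inr (.inr ⟨hr, rfl, rfl⟩)⟩
  obtain ⟨S₁, o, hmin, hDD, hcase⟩ := key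
  obtain ⟨g, o1, o2, o3, o4, o5⟩ := hmin.spec hinv hS hM hrU
  have hS₁ := g.subset_of_subset hS hM
  have hr1 : r ∈ S₁.active := g.active_subset hr
  have hval : D'.Valid inv R ∧ Refines D.needed D'.needed ∧
      (o ≠ ([], []) → Recognizes D'.needed o) := by
    rcases hDD with ⟨rfl, rfl⟩ | ⟨ho, hI⟩
    · exact ⟨hD, .refl _, fun h => absurd rfl h⟩
    · rcases o3 with h | ⟨hsl, hU⟩
      · exact absurd h ho
      · obtain ⟨i1, i2, i3⟩ := hI.spec hD hS₁ hM hU.2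
        exact ⟨i1, i2, fun _ => i3 hsl⟩
  have hprop : o = r → ProperIrred (setOfRules M) r.1 := fun h => h ▸ o4
  have hcons := g.considered
  have hnow := g.now
  refine ⟨S₁, o, ⟨g, o1, o2, o4, o3, o5, ?_, ?_, ?_, ?_, ?_, ?_, ?_, ?_, ?_, ?_, ?_, ?_, hval.1,
    hval.2.1, hval.2.2⟩⟩
  -- the remaining claims compare the four parts of the stores, for each kind of treatment
  all_goals
    rcases hcase with ⟨hP, rfl⟩ | ⟨hP, hor, rfl⟩ | ⟨hP, rfl, rfl⟩ <;>
    simp only [Finset.subset_iff, Store.mem_rules, Store.mem_active, Store.remove,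
      Store.moveToDelete, Finset.mem_erase, Finset.mem_insert, Store.mem_recordOutput_considered,
      Store.mem_recordOutput_delete, Store.mem_recordOutput_new, Store.mem_recordOutput_now,
      hcons, hnow] at hr1 ⊢ <;>
    grind

/-- The rules which the current pass still has to treat. -/
def Config.pending (C : Config A) : Finset (Rule A) :=
  match C.phase with
  | .processConsidered todo => todo ∪ C.store.new
  | .processNew => C.store.new
  | _ => ∅

/-- The basic invariants of the procedure. -/
structure Config.Valid (inv : A → A) (R : Finset (Rule A)) (C : Config A) : Prop where
  store : ↑C.store.rules ⊆ universalRules inv R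
  wdiff : C.wdiff.Valid inv R
  rules : setOfRules C.rules ⊆ universalRules inv R
  todo : ∀ todo, C.phase = .processConsidered todo → todo ⊆ C.store.considered
  pairs : ∀ todo, C.phase = .compare todo → ∀ p ∈ todo, value inv R p.1 = value inv R p.2

/-- A step that treats the rule `r`, with output `o`. -/
def TreatStep (inv : A → A) (R : Finset (Rule A)) (C C' : Config A) (r o : Rule A) : Prop :=
  r ∈ C.store.active ∧
  (∃ S₁, TreatSpec inv R C.rules r C.store C.wdiff C'.store C'.wdiff S₁ o) ∧
  C'.pass = C.pass ∧ C'.rules = C.rules ∧ ∀ q ∈ C.pending, q ≠ r → q ≠ o → q ∈ C'.pending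

/-- A step that neither treats a rule nor ends the pass. -/
structure QuietStep (C C' : Config A) : Prop where
  pass : C'.pass = C.pass
  rules : C'.rules = C.rules
  wdiff : C'.wdiff = C.wdiff
  pending : C'.pending = C.pending
  active : C.store.active ⊆ C'.store.active
  mem_active : ∀ q ∈ C'.store.active, q ∈ C.store.active ∨ q ∉ C.store.rules
  mem_rules : ∀ q ∈ C'.store.rules, q ∈ C.store.rules ∨ q ∈ C'.store.active ∧
    (q ∈ setOfRules C.rules ∧ ProperIrred (setOfRules C.rules) q.1 ∧
      (∀ σ, (q.1, σ) ∈ setOfRules C.rules → ¬ SLt σ q.2) ∨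
    IsIrred (setOfRules C.rules) q.1 ∧ IsIrred (setOfRules C.rules) q.2)

/-- The step that ends the pass. -/
structure EndStep (C C' : Config A) : Prop where
  pass : C'.pass = C.pass + 1
  phase : C.phase = .processNow
  now : C.store.now = ∅
  store : C'.store = { C.store with delete := ∅ }
  refines : Refines C.wdiff.needed C'.rules
  phase' : C'.phase = .processConsidered C.store.considered

lemma EndStep.active {C C' : Config A} (h : EndStep C C') :
    C'.store.active = C.store.active := by rw [h.store]; rfl

lemma EndStep.rules {C C' : Config A} (h : EndStep C C') :
    C'.store.rules = C.store.active := by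
  rw [h.store]; ext q; simp [Store.rules, Store.active]

lemma EndStep.pending {C C' : Config A} (h : EndStep C C') :
    C.pending = ∅ ∧ C'.pending = C.store.active := by
  simp only [Config.pending, h.phase, h.phase', true_and, h.store]
  ext q
  simp [Store.active, h.now]

lemma quiet_of_store_eq {C C' : Config A} (h1 : C'.pass = C.pass) (h2 : C'.rules = C.rules)
    (h3 : C'.wdiff = C.wdiff) (h4 : C'.pending = C.pending) (h5 : C'.store = C.store) :
    QuietStep C C' :=
  ⟨h1, h2, h3, h4, by rw [h5], fun q hq => .inl (h5 ▸ hq), fun q hq => .inl (h5 ▸ hq)⟩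

lemma Store.addNew_spec (S : Store A) (r : Rule A) :
    S.active ⊆ (S.addNew r).active ∧ (S.addNew r).delete = S.delete ∧
      (S.addNew r).considered = S.considered ∧ (S.addNew r).now = S.now ∧
      (∀ q ∈ (S.addNew r).active, q ∈ S.active ∨ q ∉ S.rules) ∧
      (∀ q ∈ (S.addNew r).rules, q ∈ S.rules ∨ q = r ∧ r ∈ (S.addNew r).active) ∧
      r ∈ (S.addNew r).rules := by
  unfold Store.addNew
  split_ifs with h
  · exact ⟨subset_rfl, rfl, rfl, rfl, fun q hq => .inl hq, fun q hq => .inl hq, h⟩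
  · refine ⟨fun q => ?_, rfl, rfl, rfl, fun q hq => ?_, fun q hq => ?_, ?_⟩ <;>
    simp only [Store.mem_rules, Store.mem_active, Finset.mem_insert] at * <;> grind

/-- The effect of the insertion of a pair. -/
lemma InsertPair.spec {S S' : Store A} {a b : List A} (h : InsertPair S a b S') :
    S.active ⊆ S'.active ∧ S'.delete = S.delete ∧ S'.considered = S.considered ∧
      S'.now = S.now ∧ (∀ q ∈ S'.active, q ∈ S.active ∨ q ∉ S.rules) ∧
      (∀ q ∈ S'.rules, q ∈ S.rules ∨ q ∈ S'.active ∧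
        (q = (a, b) ∧ SLt b a ∨ q = (b, a) ∧ SLt a b)) ∧
      (a = b ∨ SLt b a ∧ (a, b) ∈ S'.rules ∨ SLt a b ∧ (b, a) ∈ S'.rules) := by
  cases h with
  | eq h => exact ⟨subset_rfl, rfl, rfl, rfl, fun q hq => .inl hq, fun q hq => .inl hq, .inl h⟩
  | gt h =>
    obtain ⟨h1, h2, h3, h4, h0, h5, h6⟩ := S.addNew_spec (a, b)
    refine ⟨h1, h2, h3, h4, h0, fun q hq => (h5 q hq).imp id ?_, .inr (.inl ⟨h, h6⟩)⟩
    rintro ⟨rfl, h'⟩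
    exact ⟨h', .inl ⟨rfl, h⟩⟩
  | lt h =>
    obtain ⟨h1, h2, h3, h4, h0, h5, h6⟩ := S.addNew_spec (b, a)
    refine ⟨h1, h2, h3, h4, h0, fun q hq => (h5 q hq).imp id ?_, .inr (.inr ⟨h, h6⟩)⟩
    rintro ⟨rfl, h'⟩
    exact ⟨h', .inr ⟨rfl, h⟩⟩

lemma Step.treat_spec {r : Rule A} {C C' : Config A} (hC : C.Valid inv R)
    (hinv : Function.Involutive inv) (h : Treat inv C.rules r C.store C.wdiff C'.store C'.wdiff)
    (hr : r ∈ C.store.active) (hpass : C'.pass = C.pass) (hrules : C'.rules = C.rules)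
    (hphase : (∃ todo, C.phase = .processConsidered todo ∧
      C'.phase = .processConsidered (todo.erase r)) ∨
      C.phase = .processNew ∧ C'.phase = .processNew) :
    C'.Valid inv R ∧ ∃ o, TreatStep inv R C C' r o := by
  obtain ⟨S₁, o, ts⟩ := h.spec hinv hC.store hC.rules hC.wdiff hr
  have hS₁ := ts.grows.subset_of_subset hC.store hC.rules
  refine ⟨⟨?_, ts.valid, hrules ▸ hC.rules, ?_, ?_⟩, o, hr, ⟨S₁, ts⟩, hpass, hrules, ?_⟩
  · intro q hq
    rcases ts.mem_rules q hq with h | ⟨rfl, h⟩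
    · exact hS₁ h
    · rcases ts.out_cases with h' | h'
      · exact absurd h' h
      · exact h'.2
  · intro todo htodo
    rcases hphase with ⟨todo', h1, h2⟩ | ⟨h1, h2⟩
    · rw [h2] at htodo
      simp only [Phase.processConsidered.injEq] at htodo
      subst htodo
      intro q hq
      rw [Finset.mem_erase] at hq
      exact ts.considered_of_ne q (hC.todo _ h1 hq.2) hq.1
    · rw [h2] at htodo; cases htodo
  · intro todo htodo
    rcases hphase with ⟨todo', h1, h2⟩ | ⟨h1, h2⟩
    · rw [h2] at htodo; cases htodo
    · rw [h2] at htodo; cases htodo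
  · intro q hq hqr hqo
    have hn : q ∈ C.store.new → q ∈ C'.store.new := fun h =>
      ts.new_of_ne q (ts.grows.subset h) hqr hqo
    rcases hphase with ⟨todo', h1, h2⟩ | ⟨h1, h2⟩
    · simp only [Config.pending, h1, h2, Finset.mem_union, Finset.mem_erase] at hq ⊢
      exact hq.imp (fun h => ⟨hqr, h⟩) hn
    · simp only [Config.pending, h1, h2] at hq ⊢
      exact hn hq

/-- The classification of the elementary steps. -/
theorem Step.spec (hinv : Function.Involutive inv) {C C' : Config A} (h : Step inv C C')
    (hC : C.Valid inv R) : C'.Valid inv R ∧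
      ((∃ r o, TreatStep inv R C C' r o) ∨ QuietStep C C' ∨ EndStep C C') := by
  cases h with
  | considered r hr h =>
    have hact := Store.mem_active.2 (.inl (hC.todo _ rfl hr))
    obtain ⟨h1, o, h2⟩ := Step.treat_spec (C' := ⟨_, _, _, _, _⟩) hC hinv h hact rfl rfl
      (.inl ⟨_, rfl, rfl⟩)
    exact ⟨h1, .inl ⟨r, o, h2⟩⟩
  | consideredDone =>
    refine ⟨⟨hC.store, hC.wdiff, hC.rules, ?_, ?_⟩,
      .inr (.inl (quiet_of_store_eq rfl rfl rfl ?_ rfl))⟩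
    · intro todo h; cases h
    · intro todo h; cases h
    · simp [Config.pending]
  | new r hr h =>
    have hact := Store.mem_active.2 (.inr (.inr hr))
    obtain ⟨h1, o, h2⟩ := Step.treat_spec (C' := ⟨_, _, _, _, _⟩) hC hinv h hact rfl rfl
      (.inr ⟨rfl, rfl⟩)
    exact ⟨h1, .inl ⟨r, o, h2⟩⟩
  | newDone h =>
    refine ⟨⟨hC.store, hC.wdiff, hC.rules, ?_, ?_⟩,
      .inr (.inl (quiet_of_store_eq rfl rfl rfl ?_ rfl))⟩
    · intro todo h; cases h
    · intro todo h; cases h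
    · simp [Config.pending, h]
  | @now n S D M r hr todo htodo =>
    have hact : ∀ q, q ∈ Store.active { S with
        considered := insert r S.considered, now := S.now.erase r } ↔ q ∈ S.active := by
      intro q
      simp only [Store.mem_active, Finset.mem_insert, Finset.mem_erase]
      by_cases h : q = r
      · subst h; simp [hr]
      · simp [h]
    have hrul : ∀ q, q ∈ Store.rules { S with
        considered := insert r S.considered, now := S.now.erase r } ↔ q ∈ S.rules := by
      intro q; simp only [Store.mem_rules, hact]
    refine ⟨⟨fun q hq => hC.store ((hrul q).1 hq), hC.wdiff, hC.rules, ?_, ?_⟩,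
      .inr (.inl ⟨rfl, rfl, rfl, rfl, fun q hq => (hact q).2 hq,
        fun q hq => .inl ((hact q).1 hq),
        fun q hq => .inl ((hrul q).1 hq)⟩)⟩
    · intro todo h; cases h
    · intro todo' h p hp
      simp only [Phase.compare.injEq] at h
      subst h
      obtain ⟨r', hr', ho⟩ := (htodo p).1 hp
      have e : ∀ q ∈ insert r S.considered, value inv R q.1 = value inv R q.2 := by
        intro q hq
        refine (hC.store (Store.mem_rules.2 (.inl (Store.mem_active.2 ?_)))).2
        rcases Finset.mem_insert.1 hq with rfl | hq
        · exact .inr (.inl hr)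
        · exact .inl hq
      rcases ho with ho | ho
      · exact ho.value_eq (e _ (Finset.mem_insert_self _ _)) (e _ hr')
      · exact ho.value_eq (e _ hr') (e _ (Finset.mem_insert_self _ _))
  | @compare n todo S S₁ S₂ S₃ D M p hp a b h₁ h₂ h =>
    obtain ⟨g1, k1, -⟩ := h₁.spec hC.store hC.rules
    have v1 := (h₁.conn hC.store hC.rules).2.thue.value_eq fun r hr => (k1 hr).2
    obtain ⟨g2, k2, -⟩ := h₂.spec k1 hC.rules
    have v2 := (h₂.conn k1 hC.rules).2.thue.value_eq fun r hr => (k2 hr).2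
    have hab : value inv R a = value inv R b := by
      rw [← v1, ← v2]; exact hC.pairs _ rfl p hp
    obtain ⟨i1, i2, i3, i4, i0, i5, -⟩ := h.spec
    have g := (g1.mono (le_max_left p.1.length p.2.length)).trans (g2.mono (le_max_right _ _))
    refine ⟨⟨?_, hC.wdiff, hC.rules, ?_, ?_⟩, .inr (.inl ⟨rfl, rfl, rfl, rfl,
      g.active_subset.trans i1, ?_, ?_⟩)⟩
    · intro q hq
      rcases i5 q hq with h | ⟨-, ⟨rfl, h⟩ | ⟨rfl, h⟩⟩
      · exact k2 h
      · exact ⟨h, hab⟩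
      · exact ⟨h, hab.symm⟩
    · intro todo h; cases h
    · intro todo' h q hq
      simp only [Phase.compare.injEq] at h
      subst h
      exact hC.pairs _ rfl q (Finset.mem_of_mem_erase hq)
    · intro q hq
      rcases i0 q hq with h | h
      · rw [Store.mem_active, g.considered, g.now] at h
        rcases h with h | h | h
        · exact .inl (Store.mem_active.2 (.inl h))
        · exact .inl (Store.mem_active.2 (.inr (.inl h)))
        · exact (g.new q h).imp (fun h => Store.mem_active.2 (.inr (.inr h))) And.left
      · exact .inr fun h' => h (g.rules_subset h')
    · intro q hq
      rcases i5 q hq with h | ⟨h', ⟨rfl, h⟩ | ⟨rfl, h⟩⟩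
      · rcases g.mem_rules h with h | ⟨-, h1, h2, h3, h4, -⟩
        · exact .inl h
        · exact .inr ⟨i1 (Store.mem_active.2 (.inr (.inr h1))), .inl ⟨h2, h3, h4⟩⟩
      · exact .inr ⟨h', .inr ⟨h₁.2, h₂.2⟩⟩
      · exact .inr ⟨h', .inr ⟨h₂.2, h₁.2⟩⟩
  | compareDone =>
    refine ⟨⟨hC.store, hC.wdiff, hC.rules, ?_, ?_⟩,
      .inr (.inl (quiet_of_store_eq rfl rfl rfl ?_ rfl))⟩
    · intro todo h; cases h
    · intro todo h; cases h
    · simp [Config.pending]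
  | @endPass n S D D' M h hD =>
    obtain ⟨h1, h2⟩ := hD.spec hC.wdiff hC.store
    refine ⟨⟨?_, ⟨Finset.empty_subset _, h1.sound.mono h1.needed⟩,
      (h1.sound.mono h1.needed).subset, ?_, ?_⟩, .inr (.inr ⟨rfl, rfl, h, rfl, h2, rfl⟩)⟩
    · intro q hq
      refine hC.store ?_
      simp only [Finset.mem_coe, Store.mem_rules, Finset.notMem_empty, or_false] at hq ⊢
      exact .inl hq
    · intro todo h
      simp only [Phase.processConsidered.injEq] at h
      subst h
      exact subset_rfl
    · intro todo h; cases h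

variable [Fintype A]

lemma initialRules_subset (hR : ∀ r ∈ R, SL2 r.1 r.2) :
    ↑(initialRules inv R) ⊆ universalRules inv R := by
  intro r hr
  simp only [initialRules, Finset.coe_union, Finset.coe_image, Set.mem_union, Set.mem_image] at hr
  rcases hr with ⟨x, -, rfl⟩ | hr
  · exact ⟨SLt.of_length (by simp), value_inv x⟩
  · exact ⟨(hR r hr).1, value_rule hr⟩

lemma initialStore_rules : (initialStore inv R).rules = initialRules inv R := by
  simp [initialStore, Store.rules]

lemma Initial.valid (hR : ∀ r ∈ R, SL2 r.1 r.2) {C : Config A} (h : Initial inv R C) :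
    C.Valid inv R ∧ C.store = initialStore inv R := by
  cases h with
  | mk L hL D₁ D₂ D hloops hweld hlabel =>
    have hS : ↑(initialStore inv R).rules ⊆ universalRules inv R := by
      rw [initialStore_rules]; exact initialRules_subset hR
    have h0 : WordDiff.Valid inv R (⟨∅, ∅, fun _ => []⟩ : WordDiff A) :=
      ⟨subset_rfl, rfl, fun e he => absurd he (Finset.notMem_empty e)⟩
    have h1 := hloops.valid h0 hS h0.sound.subset
      fun r hr => (initialRules_subset hR ((hL r).1 hr)).2
    have h2 := (Weld.spec h1 hweld).1
    have h3 := (hlabel.valid h2 hS).1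
    refine ⟨⟨hS, ⟨subset_rfl, h3.sound⟩, h3.sound.subset, ?_, ?_⟩, rfl⟩
    · intro todo h
      simp only [Phase.processConsidered.injEq] at h
      subst h
      exact Finset.empty_subset _
    · intro todo h; cases h

end Steps

/-! ### Simulation of old rules by later rules -/

section Simulation

variable {A : Type*} [LinearOrder A] {inv : A → A} {R : Finset (Rule A)}

/-- The set `X` simulates all rules of `T`, without exceeding their left-hand sides. -/
def SimulatesAll (T X : Set (Rule A)) : Prop := ∀ r ∈ T, Conn X (SLe · r.1) r.1 r.2

variable {T X Y : Set (Rule A)}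

lemma Conn.lift_le {u v w : List A} (hc : Conn T (SLe · w) u v)
    (hs : ∀ r ∈ T, SLe r.1 w → Conn X (SLe · r.1) r.1 r.2) : Conn X (SLe · w) u v := by
  induction hc with
  | rel x y h =>
    obtain ⟨⟨a, b, r, hr, rfl, rfl⟩, hle⟩ := h
    refine (hs r hr ((sle_context a r.1 b).trans hle)).context a b fun y hy => ?_
    exact (hy.context a b).trans hle
  | refl x => exact .refl _
  | symm x y _ ih => exact ih.symm
  | trans x y z _ _ ih ih' => exact ih.trans ih'

lemma Conn.of_mem {r : Rule A} (h : r ∈ X) : Conn X (SLe · r.1) r.1 r.2 :=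
  .of_step (Elementary.of_mem h) (SLe.refl _)

lemma SimulatesAll.trans (h : SimulatesAll T X) (h' : SimulatesAll X Y) : SimulatesAll T Y :=
  fun r hr => (h r hr).lift_le fun q hq _ => h' q hq

/-- If the rules below the left-hand side of `r` are simulated by `X`, then so is `r`, after it was
treated. The point is that a rule which is smaller than `r` is different from `r`, and survives. -/
lemma TreatSpec.simulates {M : Automaton A} {r o : Rule A} {S S' S₁ : Store A} {D D' : WordDiff A}
    (ts : TreatSpec inv R M r S D S' D' S₁ o) (hr : r ∈ universalRules inv R)
    (hsim : Simulates (↑S₁.rules ∪ invRules inv) X r.1)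
    (hX : ∀ q ∈ S'.active, q = o → q ∈ X) :
    Conn X (SLe · r.1) r.1 r.2 := by
  have hoX : o ≠ ([], []) → o ≠ r → o ∈ X := fun h h' => hX o (ts.out_active h h') rfl
  have hsim' : Simulates (↑S₁.rules ∪ invRules inv ∪ {o}) X r.1 := by
    intro q hq hlt
    rcases hq with hq | hq
    · exact hsim q hq hlt
    · obtain rfl : q = o := hq
      by_cases h0 : q = ([], [])
      · rw [h0]; exact .refl _
      · refine .of_mem (hoX h0 ?_)
        rintro rfl
        exact SLt.irrefl _ hlt
  rcases ts.derive with ⟨α, β, q, hq, hne, e, hc⟩ | ⟨ho, hP, -, hc⟩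
  · have hlt : SLt q.1 r.1 := slt_of_infix ⟨α, β, e.symm⟩ hne
    have hq' : Conn X (SLe · q.1) q.1 q.2 := by
      rcases hq with hq | ⟨rfl, h0⟩
      · exact hsim q (.inl hq) hlt
      · exact .of_mem (hoX h0 fun h => hne (by rw [h]))
    refine Conn.trans ?_ ((hc.lift hsim').imp fun y hy => hy.sle)
    have := hq'.context (q := (SLe · r.1)) α β fun y hy => by
      rw [e]; exact hy.context α β
    rwa [← e] at this
  · refine Conn.trans ?_ ((hc.lift hsim').imp fun y hy => hy.sle)
    have h0 : o ≠ ([], []) := by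
      rintro rfl
      have := hr.1
      rw [← ho] at this
      exact not_slt_nil _ this
    have hoX' : o ∈ X := by
      by_cases h : o = r
      · exact hX o (h ▸ (ts.keep hP).1 h) rfl
      · exact hoX h0 h
    rw [← ho]
    exact .of_mem hoX'

/-- After each step, the active rules simulate all previous rules. -/
lemma step_simulates {C C' : Config A} (hC : C.Valid inv R)
    (h : (∃ r o, TreatStep inv R C C' r o) ∨ QuietStep C C' ∨ EndStep C C')
    (hsim : SimulatesAll (↑C.store.rules ∪ invRules inv) ↑C.store.active) :
    SimulatesAll (↑C.store.rules ∪ invRules inv) ↑C'.store.active ∧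
      SimulatesAll (↑C'.store.rules ∪ invRules inv) ↑C'.store.active := by
  rcases h with ⟨r, o, hr, ⟨S₁, ts⟩, -, -, -⟩ | h | h
  · have hrU := hC.store (Store.mem_rules.2 (.inl hr))
    have h1 : SimulatesAll (↑S₁.rules ∪ invRules inv) ↑S₁.active := by
      rintro q (hq | hq)
      · rcases ts.grows.mem_rules hq with h | h
        · exact (hsim q (.inl h)).map ts.grows.active_subset fun _ h => h
        · exact .of_mem (Store.mem_active.2 (.inr (.inr h.2.1)))
      · exact (hsim q (.inr hq)).map ts.grows.active_subset fun _ h => h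
    have h2 : Simulates (↑S₁.rules ∪ invRules inv) ↑C'.store.active r.1 := by
      intro q hq hlt
      refine (h1 q hq).lift_le fun s hs hle => .of_mem (ts.active_of_ne s hs ?_)
      rintro rfl
      exact SLt.irrefl _ (hle.trans_slt hlt)
    have h3 := ts.simulates hrU h2 fun q hq _ => hq
    have h4 : SimulatesAll (↑S₁.active : Set (Rule A)) ↑C'.store.active := by
      intro q hq
      by_cases h : q = r
      · exact h ▸ h3
      · exact .of_mem (ts.active_of_ne q hq h)
    have h5 := h1.trans h4
    refine ⟨fun q hq => h5 q (hq.imp (fun h => ts.grows.rules_subset h) id), ?_⟩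
    rintro q (hq | hq)
    · rcases ts.mem_rules q hq with h | ⟨rfl, h0⟩
      · exact h5 q (.inl h)
      · by_cases h : q = r
        · exact h ▸ h3
        · exact .of_mem (ts.out_active h0 h)
    · exact h5 q (.inr hq)
  · have h1 : SimulatesAll (↑C.store.rules ∪ invRules inv) ↑C'.store.active :=
      fun q hq => (hsim q hq).map h.active fun _ h => h
    refine ⟨h1, ?_⟩
    rintro q (hq | hq)
    · rcases h.mem_rules q hq with h | h
      · exact h1 q (.inl h)
      · exact .of_mem h.1
    · exact h1 q (.inr hq)
  · rw [h.active, h.rules]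
    refine ⟨hsim, ?_⟩
    rintro q (hq | hq)
    · exact .of_mem hq
    · exact hsim q (.inr hq)

variable {c : ℕ → Config A}

lemma active_subset_rulesAt (t : ℕ) : (↑(c t).store.active : Set (Rule A)) ⊆ rulesAt c t :=
  fun _ hq => Store.mem_rules.2 (.inl hq)

variable [Fintype A]

section Run

variable (hinv : Function.Involutive inv) (hR : ∀ r ∈ R, SL2 r.1 r.2) (hc : IsRun inv R c)

include hinv hR hc

lemma run_valid (t : ℕ) : (c t).Valid inv R := by
  induction t with
  | zero => exact (hc.1.valid hR).1
  | succ t ih => exact ((hc.2 t).spec hinv ih).1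

lemma run_step (t : ℕ) : (∃ r o, TreatStep inv R (c t) (c (t + 1)) r o) ∨
    QuietStep (c t) (c (t + 1)) ∨ EndStep (c t) (c (t + 1)) :=
  ((hc.2 t).spec hinv (run_valid hinv hR hc t)).2

lemma run_simulates_self (t : ℕ) :
    SimulatesAll (rulesAt c t ∪ invRules inv) ↑(c t).store.active := by
  induction t with
  | zero =>
    have h0 := (hc.1.valid hR).2
    rintro q hq
    refine .of_mem ?_
    simp only [rulesAt, h0, initialStore_rules] at hq
    rw [h0]
    simp only [initialStore, Finset.mem_coe, Store.mem_active, Finset.notMem_empty, false_or]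
    rcases hq with hq | ⟨x, rfl⟩
    · exact hq
    · simp [initialRules]
  | succ t ih =>
    exact (step_simulates (run_valid hinv hR hc t) (run_step hinv hR hc t) ih).2

/-- The active rules at any time simulate all earlier rules. -/
theorem run_simulates {t s : ℕ} (hts : t ≤ s) :
    SimulatesAll (rulesAt c t ∪ invRules inv) ↑(c s).store.active := by
  induction s, hts using Nat.le_induction with
  | base => exact run_simulates_self hinv hR hc t
  | succ s _ ih =>
    have := (step_simulates (run_valid hinv hR hc s) (run_step hinv hR hc s)
      (run_simulates_self hinv hR hc s)).1
    exact ih.trans fun q hq => this q (.inl (Store.mem_rules.2 (.inl hq)))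

lemma rulesAt_ordered (t : ℕ) : ∀ r ∈ rulesAt c t, SLt r.2 r.1 :=
  fun _ hr => ((run_valid hinv hR hc t).store hr).1

/-- Once reducible, a word stays reducible. -/
theorem reducible_mono {t s : ℕ} (hts : t ≤ s) {u : List A} (hu : ¬ IsIrred (rulesAt c t) u) :
    ¬ IsIrred (↑(c s).store.active) u := by
  simp only [IsIrred, not_forall, not_not] at hu
  obtain ⟨r, hr, hi⟩ := hu
  have h1 := run_simulates hinv hR hc hts r (.inl hr)
  have h2 := h1.not_irred (fun q hq => rulesAt_ordered hinv hR hc s q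
    (active_subset_rulesAt s hq)) (rulesAt_ordered hinv hR hc t r hr).ne.symm
  exact fun h => h2 (h.of_infix hi)

theorem thue_rulesAt_iff (t : ℕ) (u v : List A) :
    Thue (rulesAt c t) u v ↔ value inv R u = value inv R v := by
  refine ⟨fun h => h.value_eq fun r hr => ((run_valid hinv hR hc t).store hr).2, fun h => ?_⟩
  have hs := run_simulates hinv hR hc (Nat.zero_le t)
  have h0 := (hc.1.valid hR).2
  have hi : ∀ r ∈ initialRules inv R, Thue (rulesAt c t) r.1 r.2 := by
    intro r hr
    refine ((hs r (.inl ?_)).map (active_subset_rulesAt t) fun _ h => h).thue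
    simp only [rulesAt, h0, initialStore_rules]
    exact hr
  refine thue_of_value_eq hinv (fun x => hi ([x, inv x], []) ?_) (fun r hr => hi r ?_) h
  · simp [initialRules]
  · simp [initialRules, hr]

end Run

end Simulation

/-! ### Every pass ends -/

section Progress

variable {A : Type*} [LinearOrder A] {inv : A → A} {R : Finset (Rule A)}

lemma step_processConsidered {C C' : Config A} (h : Step inv C C') {todo : Finset (Rule A)}
    (hp : C.phase = .processConsidered todo) :
    C'.phase = .processNew ∨ ∃ r ∈ todo, C'.phase = .processConsidered (todo.erase r) := by
  cases h <;> simp only [Phase.processConsidered.injEq, reduceCtorEq] at hp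
  · subst hp; exact .inr ⟨_, by assumption, rfl⟩
  · exact .inl rfl

lemma step_compare {C C' : Config A} (h : Step inv C C') {todo : Finset (List A × List A)}
    (hp : C.phase = .compare todo) (hC : C.Valid inv R) :
    C'.store.now = C.store.now ∧
      (C'.phase = .processNow ∨ ∃ p ∈ todo, C'.phase = .compare (todo.erase p)) := by
  cases h with
  | compare p hp' a b h₁ h₂ h =>
    simp only [Phase.compare.injEq] at hp
    subst hp
    obtain ⟨g1, k1, -⟩ := h₁.spec hC.store hC.rules
    obtain ⟨g2, -⟩ := h₂.spec k1 hC.rules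
    exact ⟨h.spec.2.2.2.1.trans (g2.now.trans g1.now), .inr ⟨p, hp', rfl⟩⟩
  | compareDone => exact ⟨rfl, .inl rfl⟩
  | _ => simp at hp

lemma step_processNow {C C' : Config A} (h : Step inv C C') (hp : C.phase = .processNow) :
    C'.pass = C.pass + 1 ∨
      ∃ r ∈ C.store.now, C'.store.now = C.store.now.erase r ∧ ∃ todo, C'.phase = .compare todo := by
  cases h with
  | now r hr todo htodo => exact .inr ⟨r, hr, rfl, todo, rfl⟩
  | endPass h hD => exact .inl rfl
  | _ => simp at hp

/-- The rules, of lengths at most `B`, which can still be treated as new rules in the current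
pass: these are the rules in `New`, and rules which may be found by Aut-reduction. -/
def treatable (B : ℕ) (C : Config A) : Set (Rule A) :=
  {r | (r.1.length ≤ B ∧ r.2.length ≤ B) ∧
    (r ∈ C.store.new ∨ r ∉ C.store.rules ∧ ProperIrred (setOfRules C.rules) r.1)}

lemma treatable_finite [Finite A] (B : ℕ) (C : Config A) : (treatable B C).Finite :=
  ((List.finite_length_le A B).prod (List.finite_length_le A B)).subset fun _ h => h.1

lemma step_processNew (hinv : Function.Involutive inv) {C C' : Config A} (h : Step inv C C')
    (hp : C.phase = .processNew) (hC : C.Valid inv R) {B : ℕ}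
    (hB : ∀ r ∈ C.store.rules, r.1.length ≤ B) :
    C'.phase = .processNow ∨ C'.phase = .processNew ∧ (∀ r ∈ C'.store.rules, r.1.length ≤ B) ∧
      treatable B C' ⊂ treatable B C := by
  cases h with
  | newDone h => exact .inl rfl
  | @new n S S' D D' M r hr h =>
    right
    refine ⟨rfl, ?_⟩
    have hact := Store.mem_active.2 (.inr (.inr hr))
    obtain ⟨S₁, o, ts⟩ := h.spec hinv hC.store hC.rules hC.wdiff hact
    have hrB := hB r (Store.mem_rules.2 (.inl hact))
    have hr2 := (hC.store (Store.mem_rules.2 (.inl hact))).1.length_le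
    constructor
    · intro q hq
      rcases ts.mem_rules q hq with h | ⟨rfl, -⟩
      · rcases ts.grows.mem_rules h with h | h
        · exact hB q h
        · exact h.2.2.2.2.2.trans hrB
      · exact ts.out_length.trans hrB
    · refine (Set.ssubset_iff_of_subset ?_).2 ⟨r, ⟨⟨hrB, hr2.trans hrB⟩, .inl hr⟩, ?_⟩
      · rintro q ⟨hq, h⟩
        refine ⟨hq, ?_⟩
        simp only at h ⊢
        rcases h with h | ⟨hn, hP⟩
        · rcases ts.grows.new q (ts.new_subset h) with h | h
          · exact .inl h
          · exact .inr ⟨h.1, h.2.2.1⟩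
        · refine .inr ⟨fun hS => ?_, hP⟩
          by_cases e : q = r
          · subst e; exact hn (ts.keep hP).2
          · exact hn (ts.rules_of_ne q (ts.grows.rules_subset hS) e)
      · rintro ⟨-, h | ⟨h, hP⟩⟩
        · exact ts.not_new h
        · exact h (ts.keep hP).2
  | _ => simp at hp

variable [Fintype A] {c : ℕ → Config A} (hinv : Function.Involutive inv)
  (hR : ∀ r ∈ R, SL2 r.1 r.2) (hc : IsRun inv R c)

include hc

lemma exists_processNew {t : ℕ} {todo : Finset (Rule A)}
    (hp : (c t).phase = .processConsidered todo) : ∃ t' ≥ t, (c t').phase = .processNew := by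
  induction h : todo.card using Nat.strong_induction_on generalizing t todo with
  | _ n ih =>
    rcases step_processConsidered (hc.2 t) hp with h' | ⟨r, hr, h'⟩
    · exact ⟨t + 1, by omega, h'⟩
    · obtain ⟨t', ht', h''⟩ := ih _ (h ▸ Finset.card_erase_lt_of_mem hr) h' rfl
      exact ⟨t', by omega, h''⟩

include hinv hR

lemma exists_processNow {t : ℕ} (hp : (c t).phase = .processNew) :
    ∃ t' ≥ t, (c t').phase = .processNow := by
  obtain ⟨B, hB⟩ : ∃ B, ∀ r ∈ (c t).store.rules, r.1.length ≤ B :=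
    ⟨(c t).store.rules.sup fun r => r.1.length, fun r hr =>
      Finset.le_sup (f := fun r : Rule A => r.1.length) hr⟩
  induction h : (treatable B (c t)).ncard using Nat.strong_induction_on generalizing t with
  | _ n ih =>
    rcases step_processNew hinv (hc.2 t) hp (run_valid hinv hR hc t) hB with h' | ⟨h1, h2, h3⟩
    · exact ⟨t + 1, by omega, h'⟩
    · obtain ⟨t', ht', h''⟩ := ih _ (h ▸ Set.ncard_lt_ncard h3 (treatable_finite B _)) h1 h2 rfl
      exact ⟨t', by omega, h''⟩

lemma exists_compareDone {t : ℕ} {todo : Finset (List A × List A)}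
    (hp : (c t).phase = .compare todo) :
    ∃ t' ≥ t, (c t').phase = .processNow ∧ (c t').store.now = (c t).store.now := by
  induction h : todo.card using Nat.strong_induction_on generalizing t todo with
  | _ n ih =>
    obtain ⟨h1, h' | ⟨r, hr, h'⟩⟩ := step_compare (hc.2 t) hp (run_valid hinv hR hc t)
    · exact ⟨t + 1, by omega, h', h1⟩
    · obtain ⟨t', ht', h'', h2⟩ := ih _ (h ▸ Finset.card_erase_lt_of_mem hr) h' rfl
      exact ⟨t', by omega, h'', h2.trans h1⟩

lemma exists_end_of_processNow {t : ℕ} (hp : (c t).phase = .processNow) :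
    ∃ t' ≥ t, EndStep (c t') (c (t' + 1)) := by
  induction h : (c t).store.now.card using Nat.strong_induction_on generalizing t with
  | _ n ih =>
    rcases step_processNow (hc.2 t) hp with h' | ⟨r, hr, h1, todo, h2⟩
    · refine ⟨t, le_rfl, ?_⟩
      rcases run_step hinv hR hc t with ⟨r, o, -, -, h, -⟩ | h | h
      · omega
      · have := h.pass; omega
      · exact h
    · obtain ⟨t₁, ht₁, h3, h4⟩ := exists_compareDone hinv hR hc h2
      have := Finset.card_erase_lt_of_mem hr
      rw [← h1, ← h4, h] at this
      obtain ⟨t', ht', h''⟩ := ih _ this h3 rfl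
      exact ⟨t', by omega, h''⟩

/-- Every pass comes to its end. -/
theorem exists_end (t : ℕ) : ∃ t' ≥ t, EndStep (c t') (c (t' + 1)) := by
  have h1 : ∀ s, (c s).phase = .processNew → ∃ t' ≥ s, EndStep (c t') (c (t' + 1)) := by
    intro s hs
    obtain ⟨t₁, h1, h2⟩ := exists_processNow hinv hR hc hs
    obtain ⟨t₂, h3, h4⟩ := exists_end_of_processNow hinv hR hc h2
    exact ⟨t₂, by omega, h4⟩
  cases h : (c t).phase with
  | processConsidered todo =>
    obtain ⟨t₁, h2, h3⟩ := exists_processNew hc h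
    obtain ⟨t₂, h4, h5⟩ := h1 t₁ h3
    exact ⟨t₂, by omega, h5⟩
  | processNew => exact h1 t h
  | processNow => exact exists_end_of_processNow hinv hR hc h
  | compare todo =>
    obtain ⟨t₁, h2, h3, -⟩ := exists_compareDone hinv hR hc h
    obtain ⟨t₂, h4, h5⟩ := exists_end_of_processNow hinv hR hc h3
    exact ⟨t₂, by omega, h5⟩

lemma pass_step (t : ℕ) :
    (c (t + 1)).pass = (c t).pass ∨ EndStep (c t) (c (t + 1)) := by
  rcases run_step hinv hR hc t with ⟨r, o, -, -, h, -⟩ | h | h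
  · exact .inl h
  · exact .inl h.pass
  · exact .inr h

lemma pass_mono : Monotone fun t => (c t).pass := by
  refine monotone_nat_of_le_succ fun t => ?_
  rcases pass_step hinv hR hc t with h | h
  · exact h.ge
  · have := h.pass; omega

lemma exists_pass_ge (n : ℕ) : ∃ t, n ≤ (c t).pass := by
  induction n with
  | zero => exact ⟨0, Nat.zero_le _⟩
  | succ n ih =>
    obtain ⟨t, ht⟩ := ih
    obtain ⟨t', ht', h⟩ := exists_end hinv hR hc t
    have h1 := pass_mono hinv hR hc ht'
    have h2 := h.pass
    simp only at h1
    exact ⟨t' + 1, by omega⟩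

/-- Every pass is reached. -/
theorem exists_pass_eq {n : ℕ} (hn : 1 ≤ n) : ∃ t, (c t).pass = n := by
  classical
  have hex := exists_pass_ge hinv hR hc n
  refine ⟨Nat.find hex, le_antisymm ?_ (Nat.find_spec hex)⟩
  rcases h : Nat.find hex with _ | t
  · have : (c 0).pass = 1 := by
      have := hc.1
      generalize c 0 = C at this
      cases this; rfl
    omega
  · have h1 := Nat.find_min hex (m := t) (by omega)
    rcases pass_step hinv hR hc t with h2 | h2
    · omega
    · have := h2.pass; omega

/-- A principle for properties which are established by the treatment of certain rules. If the
treatment of a rule with property `Y`, or with an output with property `Y`, leads to `P`; if `P` is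
kept during a pass; and if there are rules with property `Y` at the start of each late pass at
which `P` does not hold; then `P` holds at the end of each late pass. -/
theorem eventually_at_end {T : ℕ} {Y : Rule A → Prop} {P : ℕ → Prop}
    (h₁ : ∀ t ≥ T, ∀ r o, TreatStep inv R (c t) (c (t + 1)) r o → Y r ∨ Y o → P (t + 1))
    (h₂ : ∀ t ≥ T, P t → ¬ EndStep (c t) (c (t + 1)) → P (t + 1))
    (h₃ : ∀ t ≥ T, EndStep (c t) (c (t + 1)) → P (t + 1) ∨ ∃ q ∈ (c t).store.active, Y q) :
    ∃ T' ≥ T, ∀ t ≥ T', EndStep (c t) (c (t + 1)) → P t := by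
  obtain ⟨e, he, hend⟩ := exists_end hinv hR hc T
  have hstart : ∀ t ≥ T, EndStep (c t) (c (t + 1)) →
      P (t + 1) ∨ ∃ q ∈ (c (t + 1)).pending, Y q := fun t ht h => by
    rw [h.pending.2]; exact h₃ t ht h
  have key : ∀ t ≥ e + 1, P t ∨ ∃ q ∈ (c t).pending, Y q := by
    intro t ht
    induction t, ht using Nat.le_induction with
    | base => exact hstart e he hend
    | succ t ht ih =>
      rcases run_step hinv hR hc t with ⟨r, o, h⟩ | h | h
      · have hne : ¬ EndStep (c t) (c (t + 1)) := fun h' => by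
          have h1 := h'.pass
          have h2 := h.2.2.1
          omega
        rcases ih with ih | ⟨q, hq, hY⟩
        · exact .inl (h₂ t (by omega) ih hne)
        · by_cases hqr : q = r
          · exact .inl (h₁ t (by omega) r o h (.inl (hqr ▸ hY)))
          by_cases hqo : q = o
          · exact .inl (h₁ t (by omega) r o h (.inr (hqo ▸ hY)))
          exact .inr ⟨q, h.2.2.2.2 q hq hqr hqo, hY⟩
      · have hne : ¬ EndStep (c t) (c (t + 1)) := fun h' => by
          have h1 := h'.pass
          have h2 := h.pass
          omega
        rcases ih with ih | ih
        · exact .inl (h₂ t (by omega) ih hne)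
        · rw [h.pending]; exact .inr ih
      · exact hstart t (by omega) h
  refine ⟨e + 1, by omega, fun t ht h => ?_⟩
  rcases key t ht with h' | ⟨q, hq, -⟩
  · exact h'
  · rw [h.pending.1] at hq
    exact absurd hq (Finset.notMem_empty q)

end Progress

/-! ### Rules in `Considered`, and critical pairs -/

section Overlaps

variable {A : Type*} [LinearOrder A] {inv : A → A} {R : Finset (Rule A)}

/-- The two words of a pair are connected, without exceeding both words. -/
def PairConn (X : Set (Rule A)) (p : List A × List A) : Prop :=
  Conn X (fun y => SLe y p.1 ∨ SLe y p.2) p.1 p.2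

/-- The overlaps of rules in `Considered` are connected, unless they are still to be analysed. -/
def OverlapsDone (X : Set (Rule A)) (C : Config A) : Prop :=
  ∀ r ∈ C.store.considered, ∀ r' ∈ C.store.considered, ∀ p, Overlap r r' p →
    (∃ todo, C.phase = .compare todo ∧ p ∈ todo) ∨ PairConn X p

/-- The analysis of a critical pair connects its words. -/
lemma pairConn_of_reduce {M : Automaton A} {S S₁ S₂ S₃ : Store A} {p : List A × List A}
    {a b : List A} {X : Set (Rule A)} (h₁ : AutReduce M S p.1 S₁ a) (h₂ : AutReduce M S₁ p.2 S₂ b)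
    (h : InsertPair S₂ a b S₃) (hS : ↑S.rules ⊆ universalRules inv R)
    (hM : setOfRules M ⊆ universalRules inv R) (hX : ↑S₃.rules ⊆ X) : PairConn X p := by
  obtain ⟨-, k1, -⟩ := h₁.spec hS hM
  obtain ⟨l1, c1⟩ := h₁.conn hS hM
  obtain ⟨g2, -⟩ := h₂.spec k1 hM
  obtain ⟨l2, c2⟩ := h₂.conn k1 hM
  obtain ⟨i1, i2, -, -, -, -, i6⟩ := h.spec
  have h23 : S₂.rules ⊆ S₃.rules := fun q hq => by
    rw [Store.mem_rules] at *; rw [i2]; exact hq.imp (fun h => i1 h) id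
  have d1 : Conn X (fun y => SLe y p.1 ∨ SLe y p.2) p.1 a :=
    c1.map (fun q hq => hX (h23 (g2.rules_subset hq))) fun y hy => .inl hy
  have d2 : Conn X (fun y => SLe y p.1 ∨ SLe y p.2) p.2 b :=
    c2.map (fun q hq => hX (h23 hq)) fun y hy => .inr hy
  refine d1.trans (Conn.trans ?_ d2.symm)
  rcases i6 with rfl | ⟨-, h⟩ | ⟨-, h⟩
  · exact .refl _
  · exact .of_step (Elementary.of_mem (r := (a, b)) (hX h)) (.inl l1)
  · exact (Conn.of_step (Elementary.of_mem (r := (b, a)) (hX h)) (.inr l2)).symm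

lemma step_overlapsDone (hinv : Function.Involutive inv) {C C' : Config A} {X : Set (Rule A)}
    (h : Step inv C C') (hC : C.Valid inv R) (hX : ↑C'.store.rules ⊆ X) (ho : OverlapsDone X C) :
    OverlapsDone X C' := by
  -- outside the analysis of critical pairs, nothing is left to be analysed
  have hconn : (∀ todo, C.phase ≠ .compare todo) → ∀ r ∈ C.store.considered,
      ∀ r' ∈ C.store.considered, ∀ p, Overlap r r' p → PairConn X p := by
    intro hph r hr r' hr' p hp
    rcases ho r hr r' hr' p hp with ⟨todo, h, -⟩ | h
    · exact absurd h (hph todo)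
    · exact h
  intro r hr r' hr' p hp
  cases h with
  | considered q hq h =>
    obtain ⟨S₁, o, ts⟩ := h.spec hinv hC.store hC.rules hC.wdiff
      (Store.mem_active.2 (.inl (hC.todo _ rfl hq)))
    exact .inr (hconn (fun _ h => by cases h) r (ts.considered hr) r' (ts.considered hr') p hp)
  | consideredDone => exact .inr (hconn (fun _ h => by cases h) r hr r' hr' p hp)
  | new q hq h =>
    obtain ⟨S₁, o, ts⟩ := h.spec hinv hC.store hC.rules hC.wdiff
      (Store.mem_active.2 (.inr (.inr hq)))
    exact .inr (hconn (fun _ h => by cases h) r (ts.considered hr) r' (ts.considered hr') p hp)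
  | newDone => exact .inr (hconn (fun _ h => by cases h) r hr r' hr' p hp)
  | now q hq todo htodo =>
    simp only [Finset.mem_insert] at hr hr'
    rcases hr with rfl | hr
    · exact .inl ⟨todo, rfl, (htodo p).2 ⟨r', by simpa using hr', .inl hp⟩⟩
    rcases hr' with rfl | hr'
    · exact .inl ⟨todo, rfl, (htodo p).2 ⟨r, by simp [hr], .inr hp⟩⟩
    exact .inr (hconn (fun _ h => by cases h) r hr r' hr' p hp)
  | compare q hq a b h₁ h₂ h =>
    by_cases e : p = q
    · subst e
      exact .inr (pairConn_of_reduce h₁ h₂ h hC.store hC.rules hX)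
    · obtain ⟨g1, k1, -⟩ := h₁.spec hC.store hC.rules
      obtain ⟨g2, -⟩ := h₂.spec k1 hC.rules
      have hcons := h.spec.2.2.1.trans (g2.considered.trans g1.considered)
      simp only [hcons] at hr hr'
      rcases ho r hr r' hr' p hp with ⟨todo, h, h'⟩ | h
      · simp only [Phase.compare.injEq] at h
        subst h
        exact .inl ⟨_, rfl, Finset.mem_erase.2 ⟨e, h'⟩⟩
      · exact .inr h
  | compareDone =>
    rcases ho r hr r' hr' p hp with ⟨todo, h, h'⟩ | h
    · simp only [Phase.compare.injEq] at h
      subst h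
      exact absurd h' (Finset.notMem_empty p)
    · exact .inr h
  | endPass h hD => exact .inr (hconn (fun _ h => by cases h) r hr r' hr' p hp)

/-- After the treatment of the new rules, the rule `r` is in `Now` or in `Considered`. -/
def Promoted (r : Rule A) (C : Config A) : Prop :=
  C.phase = .processNow ∨ (∃ todo, C.phase = .compare todo) →
    r ∈ C.store.now ∨ r ∈ C.store.considered

lemma step_promoted {C C' : Config A} {r : Rule A} (h : Step inv C C') (hC : C.Valid inv R)
    (hr : r ∈ C.store.active) (hp : Promoted r C) : Promoted r C' := by
  intro hph
  cases h with
  | considered q hq h => simp at hph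
  | consideredDone => simp at hph
  | new q hq h => simp at hph
  | newDone h =>
    rw [Store.mem_active] at hr
    simp only [h, Finset.notMem_empty, or_false] at hr
    exact hr.symm
  | now q hq todo htodo =>
    have := hp (.inl rfl)
    simp only [Finset.mem_insert, Finset.mem_erase] at this ⊢
    tauto
  | compare q hq a b h₁ h₂ h =>
    obtain ⟨g1, k1, -⟩ := h₁.spec hC.store hC.rules
    obtain ⟨g2, -⟩ := h₂.spec k1 hC.rules
    have hcons := h.spec.2.2.1.trans (g2.considered.trans g1.considered)
    have hnow := h.spec.2.2.2.1.trans (g2.now.trans g1.now)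
    simp only [hcons, hnow]
    exact hp (.inr ⟨_, rfl⟩)
  | compareDone => exact hp (.inr ⟨_, rfl⟩)
  | endPass h hD => simp at hph

variable [Fintype A] {c : ℕ → Config A} (hinv : Function.Involutive inv)
  (hR : ∀ r ∈ R, SL2 r.1 r.2) (hc : IsRun inv R c)

include hinv hR hc

lemma run_overlapsDone (t : ℕ) : OverlapsDone (⋃ s, rulesAt c s) (c t) := by
  induction t with
  | zero =>
    have h0 := (hc.1.valid hR).2
    intro r hr
    rw [h0] at hr
    exact absurd hr (Finset.notMem_empty r)
  | succ t ih =>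
    exact step_overlapsDone hinv (hc.2 t) (run_valid hinv hR hc t)
      (Set.subset_iUnion (rulesAt c) (t + 1)) ih

/-- A rule that stays active is in `Considered` at the end of each late pass. -/
lemma eventually_considered {r : Rule A} {T : ℕ} (hr : ∀ t ≥ T, r ∈ (c t).store.active) :
    ∃ T', ∀ t ≥ T', EndStep (c t) (c (t + 1)) → r ∈ (c t).store.considered := by
  obtain ⟨e, he, hend⟩ := exists_end hinv hR hc T
  have key : ∀ t ≥ e + 1, Promoted r (c t) := by
    intro t ht
    induction t, ht using Nat.le_induction with
    | base =>
      intro h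
      rw [hend.phase'] at h
      simp at h
    | succ t ht ih =>
      exact step_promoted (hc.2 t) (run_valid hinv hR hc t) (hr t (by omega)) ih
  refine ⟨e + 1, fun t ht h => ?_⟩
  rcases key t ht (.inl h.phase) with h' | h'
  · rw [h.now] at h'
    exact absurd h' (Finset.notMem_empty r)
  · exact h'

end Overlaps

/-! ### The set of all rules of a run -/

section AllRules

variable {A : Type*}

/-- A reducible word contains a minimal reducible subword. -/
lemma exists_minimal_reducible {T : Set (Rule A)} {u : List A} (hu : ¬ IsIrred T u) :
    ∃ l, l <:+: u ∧ ¬ IsIrred T l ∧ ProperIrred T l := by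
  induction h : u.length using Nat.strong_induction_on generalizing u with
  | _ n ih =>
    by_cases hP : ProperIrred T u
    · exact ⟨u, List.infix_rfl, hu, hP⟩
    · simp only [ProperIrred, not_forall] at hP
      obtain ⟨s, hs, hne, hred⟩ := hP
      obtain ⟨l, h1, h2⟩ := ih s.length (h ▸ lt_of_le_of_ne hs.length_le
        fun e => hne (hs.eq_of_length e)) hred rfl
      exact ⟨l, h1.trans hs, h2⟩

variable [LinearOrder A] {inv : A → A} {R : Finset (Rule A)}

/-- All rules which are in the store at some time. -/
def allRules (c : ℕ → Config A) : Set (Rule A) := ⋃ t, rulesAt c t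

variable {c : ℕ → Config A}

lemma active_subset_allRules (t : ℕ) : (↑(c t).store.active : Set (Rule A)) ⊆ allRules c :=
  (active_subset_rulesAt t).trans (Set.subset_iUnion (rulesAt c) t)

variable [Fintype A] (hinv : Function.Involutive inv) (hR : ∀ r ∈ R, SL2 r.1 r.2)
  (hc : IsRun inv R c)

include hinv hR hc

lemma allRules_subset : allRules c ⊆ universalRules inv R :=
  Set.iUnion_subset fun t => (run_valid hinv hR hc t).store

lemma allRules_ordered : ∀ r ∈ allRules c, SLt r.2 r.1 :=
  fun _ hr => (allRules_subset hinv hR hc hr).1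

omit hinv in
lemma invRules_subset_allRules : invRules inv ⊆ allRules c := by
  rintro q ⟨x, rfl⟩
  refine Set.mem_iUnion.2 ⟨0, ?_⟩
  simp [rulesAt, (hc.1.valid hR).2, initialStore_rules, initialRules]

lemma eventually_reducible {u : List A} (hu : ¬ IsIrred (allRules c) u) :
    ∃ T, ∀ t ≥ T, ¬ IsIrred (↑(c t).store.active) u := by
  simp only [IsIrred, not_forall, not_not] at hu
  obtain ⟨r, hr, hi⟩ := hu
  obtain ⟨t, ht⟩ := Set.mem_iUnion.1 hr
  exact ⟨t, fun s hs => reducible_mono hinv hR hc hs fun h => h r ht hi⟩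

/-- A word is permanently irreducible if it is not reducible at any time. -/
lemma permIrred_iff {u : List A} : PermIrred c u ↔ IsIrred (allRules c) u := by
  constructor
  · intro h
    by_contra hu
    obtain ⟨T, hT⟩ := eventually_reducible hinv hR hc hu
    obtain ⟨t, ht, h'⟩ := Filter.frequently_atTop.1 h T
    exact hT t ht (h'.mono (active_subset_rulesAt t))
  · exact fun h => Filter.Frequently.of_forall fun t => h.mono (Set.subset_iUnion (rulesAt c) t)

lemma permanent_iff {r : Rule A} : Permanent c r ↔ IsMinimalRule (allRules c) r := by
  simp only [Permanent, IsMinimalRule, permIrred_iff hinv hR hc, ProperIrred, allRules,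
    Set.mem_iUnion]

lemma exists_active {r : Rule A} (hr : r ∈ allRules c) : ∃ t, r ∈ (c t).store.active := by
  obtain ⟨t, ht⟩ := Set.mem_iUnion.1 hr
  induction t with
  | zero =>
    refine ⟨0, ?_⟩
    have h0 := (hc.1.valid hR).2
    simp only [rulesAt, h0, initialStore_rules] at ht
    rw [h0]
    exact Store.mem_active.2 (.inr (.inr ht))
  | succ t ih =>
    rcases run_step hinv hR hc t with ⟨r', o, hr', ⟨S₁, ts⟩, -⟩ | h | h
    · rcases ts.mem_rules r ht with h | ⟨rfl, h0⟩
      · rcases ts.grows.mem_rules h with h | ⟨hn, h', -⟩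
        · exact ih h
        · by_cases e : r = r'
          · exact ⟨t, e ▸ hr'⟩
          · exact ⟨t + 1, ts.active_of_ne r (Store.mem_active.2 (.inr (.inr h'))) e⟩
      · by_cases e : r = r'
        · exact ⟨t, e ▸ hr'⟩
        · exact ⟨t + 1, ts.out_active h0 e⟩
    · rcases h.mem_rules r ht with h | h
      · exact ih h
      · exact ⟨t + 1, h.1⟩
    · simp only [rulesAt, h.rules] at ht
      exact ⟨t, ht⟩

section Treat

variable {t : ℕ} {r o : Rule A} (h : TreatStep inv R (c t) (c (t + 1)) r o)

include h

omit [Fintype A] hinv hR hc in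
lemma TreatStep.out_active (h0 : o ≠ ([], [])) : o ∈ (c (t + 1)).store.active := by
  obtain ⟨-, ⟨S₁, ts⟩, -⟩ := h
  by_cases e : o = r
  · exact e ▸ (ts.keep (e ▸ ts.out_proper)).1 e
  · exact ts.out_active h0 e

omit [Fintype A] hinv hR hc in
lemma TreatStep.active_of_ne {q : Rule A} (hq : q ∈ (c t).store.active) (hne : q ≠ r) :
    q ∈ (c (t + 1)).store.active := by
  obtain ⟨-, ⟨S₁, ts⟩, -⟩ := h
  exact ts.active_of_ne q (ts.grows.active_subset hq) hne

omit hinv in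
/-- The two outcomes of the treatment of a rule, in terms of the set of all rules. -/
lemma TreatStep.cases :
    (∃ α β q, q ∈ allRules c ∧ q.1 ≠ r.1 ∧ r.1 = α ++ q.1 ++ β ∧
      Conn (allRules c) (SLt · r.1) (α ++ q.2 ++ β) r.2) ∨
    (o.1 = r.1 ∧ (o.2 = r.2 ∨ ¬ IsIrred (allRules c) r.2) ∧
      Conn (allRules c) (SLt · r.1) o.2 r.2) := by
  have hout := h.out_active
  obtain ⟨hr, ⟨S₁, ts⟩, -⟩ := h
  have hS : (↑S₁.rules : Set (Rule A)) ⊆ allRules c := by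
    intro q hq
    by_cases e : q = r
    · exact active_subset_allRules t (e ▸ hr)
    · exact Set.mem_iUnion.2 ⟨t + 1, ts.rules_of_ne q hq e⟩
  have hsim : Simulates (↑S₁.rules ∪ invRules inv ∪ {o}) (allRules c) r.1 := by
    rintro q ((hq | hq) | hq) -
    · exact .of_mem (hS hq)
    · exact .of_mem (invRules_subset_allRules hR hc hq)
    · obtain rfl : q = o := hq
      by_cases h0 : q = ([], [])
      · rw [h0]; exact .refl _
      · exact .of_mem (active_subset_allRules _ (hout h0))
  rcases ts.derive with ⟨α, β, q, hq, hne, e, hconn⟩ | ⟨h1, -, h2, hconn⟩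
  · refine .inl ⟨α, β, q, ?_, hne, e, hconn.lift hsim⟩
    rcases hq with hq | ⟨rfl, h0⟩
    · exact hS hq
    · exact active_subset_allRules _ (hout h0)
  · exact .inr ⟨h1, h2.imp id fun h h' => h (h'.mono hS), hconn.lift hsim⟩

end Treat

/-! ### Late passes recognize reducible words -/

/-- The automaton `Rules` only changes at the end of a pass. -/
lemma eventually_rules {Q : Automaton A → Prop} {T : ℕ}
    (h : ∀ t ≥ T, EndStep (c t) (c (t + 1)) → Q (c (t + 1)).rules) :
    ∃ T', ∀ t ≥ T', Q (c t).rules := by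
  obtain ⟨e, he, hend⟩ := exists_end hinv hR hc T
  refine ⟨e + 1, fun t ht => ?_⟩
  induction t, ht using Nat.le_induction with
  | base => exact h e he hend
  | succ t ht ih =>
    rcases run_step hinv hR hc t with ⟨r, o, -, -, -, h', -⟩ | h' | h'
    · rwa [h']
    · rwa [h'.rules]
    · exact h t (by omega) h'

/-- During a pass, `WDiff` keeps recognizing what it recognizes. -/
lemma recognizes_step {t : ℕ} {r : Rule A} (hr : Recognizes (c t).wdiff.needed r)
    (h : ¬ EndStep (c t) (c (t + 1))) : Recognizes (c (t + 1)).wdiff.needed r := by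
  rcases run_step hinv hR hc t with ⟨r', o, -, ⟨S₁, ts⟩, -⟩ | h' | h'
  · exact ts.refines.recognizes hr
  · rwa [h'.wdiff]
  · exact absurd h' h

/-- A reducible word is reducible by the rules of the automaton of each late pass. For a minimal
reducible word `l`, each treatment of a rule with left-hand side `l` has an output with left-hand
side `l`, which is then recognized. -/
theorem eventually_not_irred_rules {u : List A} (hu : ¬ IsIrred (allRules c) u) :
    ∃ T, ∀ t ≥ T, ¬ IsIrred (setOfRules (c t).rules) u := by
  obtain ⟨l, hlu, hl, hP⟩ := exists_minimal_reducible hu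
  have hl0 : l ≠ [] := by
    rintro rfl
    refine hl fun r hr hi => not_slt_nil r.2 ?_
    have := allRules_ordered hinv hR hc r hr
    rwa [List.infix_nil.1 hi] at this
  obtain ⟨T, hT⟩ := eventually_reducible hinv hR hc hl
  obtain ⟨T', -, hT'⟩ := eventually_at_end hinv hR hc (T := T) (Y := fun q => q.1 = l)
    (P := fun t => ∃ r, r.1 = l ∧ Recognizes (c t).wdiff.needed r)
    (by
      intro t _ r o h hY
      have ho : o.1 = l := by
        rcases hY with hY | hY
        · rcases h.cases hR hc with ⟨α, β, q, hq, hne, e, -⟩ | ⟨h1, -⟩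
          · exact absurd (List.infix_rfl) (hP q.1 ⟨α, β, by rw [← hY, e]⟩ (hY ▸ hne) q hq)
          · exact h1.trans hY
        · exact hY
      obtain ⟨-, ⟨S₁, ts⟩, -⟩ := h
      exact ⟨o, ho, ts.recognizes fun h0 => hl0 (by rw [← ho, h0])⟩)
    (by
      rintro t _ ⟨r, h1, h2⟩ h
      exact ⟨r, h1, recognizes_step hinv hR hc h2 h⟩)
    (by
      intro t ht _
      have := hT t ht
      simp only [IsIrred, not_forall, not_not] at this
      obtain ⟨q, hq, hi⟩ := this
      refine .inr ⟨q, hq, ?_⟩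
      by_contra hne
      exact hP q.1 hi hne q (active_subset_allRules t hq) List.infix_rfl)
  obtain ⟨T'', h''⟩ := eventually_rules hinv hR hc (Q := fun M => ¬ IsIrred (setOfRules M) l)
    (T := T') fun t ht hend => by
      obtain ⟨r, rfl, hr⟩ := hT' t ht hend
      exact (hend.refines.recognizes hr).not_irred
  exact ⟨T'', fun t ht h => h'' t ht (h.of_infix hlu)⟩

/-- In each late pass, the words below `w` which are irreducible by the rules of its automaton are
irreducible by all rules. -/
theorem eventually_irred (w : List A) :
    ∃ T, ∀ t ≥ T, ∀ v, SLt v w → IsIrred (setOfRules (c t).rules) v → IsIrred (allRules c) v := by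
  have := (Filter.eventually_all_finite (finite_slt w) (l := Filter.atTop)
    (p := fun v t => IsIrred (setOfRules (c t).rules) v → IsIrred (allRules c) v)).2 fun v _ => by
      by_cases h : IsIrred (allRules c) v
      · exact Filter.Eventually.of_forall fun t _ => h
      · obtain ⟨T, hT⟩ := eventually_not_irred_rules hinv hR hc h
        exact Filter.eventually_atTop.2 ⟨T, fun t ht h' => absurd h' (hT t ht)⟩
  obtain ⟨T, hT⟩ := Filter.eventually_atTop.1 this
  exact ⟨T, fun t ht v hv => hT t ht v hv⟩

end AllRules

/-! ### Permanent rules -/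

section PermanentRules

variable {A : Type*} [LinearOrder A] {inv : A → A} {R : Finset (Rule A)} {c : ℕ → Config A}
  [Fintype A] (hinv : Function.Involutive inv) (hR : ∀ r ∈ R, SL2 r.1 r.2) (hc : IsRun inv R c)

include hinv hR hc

/-- Each rule follows from the reduction of its left-hand side by a permanent rule and from
reductions of words below its left-hand side. Otherwise, for a counterexample with a least
left-hand side, each treatment would replace it by another counterexample with the same left-hand
side; but the output of the treatment in a late pass is permanent. -/
theorem exists_permanent_derivation {r : Rule A} (hr : r ∈ allRules c) :
    ∃ α β q, Permanent c q ∧ r.1 = α ++ q.1 ++ β ∧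
      Conn (allRules c) (SLt · r.1) (α ++ q.2 ++ β) r.2 := by
  suffices h : ∀ w : List A, ∀ r ∈ allRules c, r.1 = w → ∃ α β q, Permanent c q ∧
      r.1 = α ++ q.1 ++ β ∧ Conn (allRules c) (SLt · r.1) (α ++ q.2 ++ β) r.2 from h _ r hr rfl
  intro w
  refine slt_wellFounded.induction (C := fun w => ∀ r ∈ allRules c, r.1 = w →
    ∃ α β q, Permanent c q ∧ r.1 = α ++ q.1 ++ β ∧
      Conn (allRules c) (SLt · r.1) (α ++ q.2 ++ β) r.2) w fun w ih r hr hrw => ?_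
  subst hrw
  by_contra hgood
  set Y : Rule A → Prop := fun q => q.1 = r.1 ∧ Conn (allRules c) (SLt · r.1) q.2 r.2 with hYdef
  have htreat : ∀ t s o, TreatStep inv R (c t) (c (t + 1)) s o → Y s → Y o := by
    rintro t s o h ⟨hs, hsr⟩
    rcases h.cases hR hc with ⟨α, β, q, hq, hne, e, h1⟩ | ⟨h1, -, h2⟩
    · rw [hs] at hne e h1
      obtain ⟨α', β', q', hq', e', h2⟩ := ih q.1 (slt_of_infix ⟨α, β, e.symm⟩ hne) q hq rfl
      refine absurd ⟨α ++ α', β' ++ β, q', hq', by rw [e, e']; simp, ?_⟩ hgood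
      have h3 := h2.context (q := (SLt · r.1)) α β fun y hy => by
        rw [e]; exact hy.context α β
      have h4 := (h3.trans h1).trans hsr
      simpa using h4
    · rw [hs] at h1 h2
      exact ⟨h1, h2.trans hsr⟩
  have hY0 : ∀ q, Y q → q ≠ ([], []) := by
    rintro q ⟨h1, -⟩ rfl
    have := allRules_ordered hinv hR hc r hr
    rw [← h1] at this
    exact not_slt_nil _ this
  obtain ⟨t₀, ht₀⟩ := exists_active hinv hR hc hr
  have hact : ∀ t ≥ t₀, ∃ q ∈ (c t).store.active, Y q := by
    intro t ht
    induction t, ht using Nat.le_induction with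
    | base => exact ⟨r, ht₀, rfl, .refl _⟩
    | succ t ht ih =>
      obtain ⟨q, hq, hY⟩ := ih
      rcases run_step hinv hR hc t with ⟨s, o, h⟩ | h | h
      · by_cases e : q = s
        · have ho := htreat t s o h (e ▸ hY)
          exact ⟨o, h.out_active (hY0 o ho), ho⟩
        · exact ⟨q, h.active_of_ne hq e, hY⟩
      · exact ⟨q, h.active hq, hY⟩
      · exact ⟨q, h.active ▸ hq, hY⟩
  obtain ⟨T, hT⟩ := eventually_irred hinv hR hc r.1
  obtain ⟨T', -, hT'⟩ := eventually_at_end hinv hR hc (T := max T t₀) (Y := Y) (P := fun _ => False)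
    (by
      intro t ht s o h hso
      have ho : Y o := hso.elim (htreat t s o h) id
      have hoX := active_subset_allRules (t + 1) (h.out_active (hY0 o ho))
      obtain ⟨-, ⟨S₁, ts⟩, -⟩ := h
      have hlt := allRules_ordered hinv hR hc o hoX
      have hperm : Permanent c o := by
        rw [permanent_iff hinv hR hc]
        refine ⟨hoX, hT t (le_trans (le_max_left _ _) ht) _ (ho.1 ▸ hlt) ts.out_irred,
          fun u hu hne => ?_⟩
        exact hT t (le_trans (le_max_left _ _) ht) u (ho.1 ▸ slt_of_infix hu hne)
          (ts.out_proper u hu hne)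
      exact hgood ⟨[], [], o, hperm, by simp [ho.1], by simpa using ho.2⟩)
    (fun _ _ h _ => h)
    (fun t ht _ => .inr (hact t (le_trans (le_max_right _ _) ht)))
  obtain ⟨t, ht, hend⟩ := exists_end hinv hR hc T'
  exact hT' t ht hend

/-- The treatment of a permanent rule gives this rule. -/
lemma permanent_treat {t : ℕ} {r o : Rule A} (hr : Permanent c r)
    (h : TreatStep inv R (c t) (c (t + 1)) r o) : o = r := by
  obtain ⟨-, h2, hP⟩ := (permanent_iff hinv hR hc).1 hr
  rcases h.cases hR hc with ⟨α, β, q, hq, hne, e, -⟩ | ⟨h1, h3, -⟩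
  · exact absurd List.infix_rfl (hP q.1 ⟨α, β, e.symm⟩ hne q hq)
  · exact Prod.ext h1 (h3.resolve_right fun h => h h2)

lemma permanent_active {r : Rule A} (hr : Permanent c r) :
    ∃ T, ∀ t ≥ T, r ∈ (c t).store.active := by
  have hrX := ((permanent_iff hinv hR hc).1 hr).1
  obtain ⟨T, hT⟩ := exists_active hinv hR hc hrX
  refine ⟨T, fun t ht => ?_⟩
  induction t, ht using Nat.le_induction with
  | base => exact hT
  | succ t ht ih =>
    rcases run_step hinv hR hc t with ⟨s, o, h⟩ | h | h
    · by_cases e : r = s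
      · subst e
        obtain rfl := permanent_treat hinv hR hc hr h
        exact h.out_active (ne_nil_of_mem (allRules_subset hinv hR hc hrX))
      · exact h.active_of_ne ih e
    · exact h.active ih
    · exact h.active ▸ ih

lemma permanent_overlap {r r' : Rule A} (hr : Permanent c r) (hr' : Permanent c r')
    {p : List A × List A} (hp : Overlap r r' p) : PairConn (allRules c) p := by
  obtain ⟨T, hT⟩ := permanent_active hinv hR hc hr
  obtain ⟨T', hT'⟩ := permanent_active hinv hR hc hr'
  obtain ⟨s, hs⟩ := eventually_considered hinv hR hc hT
  obtain ⟨s', hs'⟩ := eventually_considered hinv hR hc hT'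
  obtain ⟨t, ht, hend⟩ := exists_end hinv hR hc (max s s')
  rcases run_overlapsDone hinv hR hc t r (hs t (by omega) hend) r' (hs' t (by omega) hend) p hp with
    ⟨todo, h, -⟩ | h
  · rw [hend.phase] at h
    cases h
  · exact h

end PermanentRules

/-! ### Local confluence -/

section LocalConfluence

variable {A : Type*} [LinearOrder A]

/-- Two elementary reductions of a word are connected below this word if all overlaps are connected
and if left-hand sides do not properly contain each other: here, the first reduction does not start
to the right of the second. -/
lemma conn_of_overlap {P X : Set (Rule A)} (hPX : P ⊆ X) (hord : ∀ r ∈ P, SLt r.2 r.1)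
    (hinfix : ∀ r ∈ P, ∀ r' ∈ P, r.1 <:+: r'.1 → r.1 = r'.1)
    (hover : ∀ r ∈ P, ∀ r' ∈ P, ∀ p, Overlap r r' p → PairConn X p)
    {r r' : Rule A} (hr : r ∈ P) (hr' : r' ∈ P) {a m b b' : List A}
    (h : r.1 ++ b = m ++ (r'.1 ++ b')) :
    Conn X (SLt · (a ++ r.1 ++ b)) (a ++ r.2 ++ b) (a ++ m ++ r'.2 ++ b') := by
  have hv : SLt (a ++ r.2 ++ b) (a ++ r.1 ++ b) := (hord r hr).context a b
  have hv' : SLt (a ++ m ++ r'.2 ++ b') (a ++ r.1 ++ b) := by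
    have := (hord r' hr').context (a ++ m) b'
    rwa [show a ++ m ++ r'.1 ++ b' = a ++ r.1 ++ b by simp [h]] at this
  have hdisj : ∀ k, m = r.1 ++ k → b = k ++ (r'.1 ++ b') →
      Conn X (SLt · (a ++ r.1 ++ b)) (a ++ r.2 ++ b) (a ++ m ++ r'.2 ++ b') := by
    intro k h1 h2
    refine (Conn.of_step (p := (SLt · (a ++ r.1 ++ b))) (v := a ++ r.2 ++ k ++ r'.2 ++ b')
      ⟨a ++ r.2 ++ k, b', r', hPX hr', ?_, rfl⟩ hv).trans
      (Conn.of_step (p := (SLt · (a ++ r.1 ++ b))) ⟨a, k ++ r'.2 ++ b', r, hPX hr, ?_, ?_⟩ hv').symm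
    · simp [h2]
    · simp [h1]
    · simp
  have hov : ∀ k, k ≠ [] → ∀ s, r.1 = m ++ k → r'.1 = k ++ s → b = s ++ b' →
      Conn X (SLt · (a ++ r.1 ++ b)) (a ++ r.2 ++ b) (a ++ m ++ r'.2 ++ b') := by
    intro k hk s h1 h2 h3
    by_cases e : r = r' ∧ m = []
    · obtain ⟨rfl, rfl⟩ := e
      obtain rfl : s = [] := by
        rw [h1] at h2; simpa using h2
      simp only [List.nil_append] at h3
      subst h3
      simp only [List.append_nil]
      exact .refl _
    have := hover r hr r' hr' _ ⟨m, k, s, hk, h1, h2, e, rfl⟩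
    have h4 := Conn.context (q := (SLt · (a ++ r.1 ++ b))) this a b' fun y hy => by
      rcases hy with hy | hy
      · refine (hy.context a b').trans_slt ?_
        simpa [h3] using hv
      · refine (hy.context a b').trans_slt ?_
        simpa using hv'
    simpa [h3] using h4
  rcases List.append_eq_append_iff.1 h with ⟨k, h1, h2⟩ | ⟨k, h1, h2⟩
  · exact hdisj k h1 h2
  · by_cases hk : k = []
    · subst hk
      exact hdisj [] (by simpa using h1.symm) (by simpa using h2.symm)
    rcases List.append_eq_append_iff.1 h2 with ⟨j, h3, h4⟩ | ⟨s, h3, h4⟩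
    · -- the second left-hand side is contained in the first one, so that they are equal
      have e := hinfix r' hr' r hr ⟨m, j, by rw [h1, h3]; simp⟩
      rw [h1, h3] at e
      have hl := congrArg List.length e
      simp only [List.length_append] at hl
      obtain rfl : m = [] := List.eq_nil_of_length_eq_zero (by omega)
      obtain rfl : j = [] := List.eq_nil_of_length_eq_zero (by omega)
      exact hov k hk [] h1 (by simpa using h3.symm) (by simpa using h4.symm)
    · exact hov k hk s h1 h3 h4

end LocalConfluence

section Confluence

variable {A : Type*} [LinearOrder A] {inv : A → A} {R : Finset (Rule A)} {c : ℕ → Config A}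
  [Fintype A] (hinv : Function.Involutive inv) (hR : ∀ r ∈ R, SL2 r.1 r.2) (hc : IsRun inv R c)

include hinv hR hc

lemma permanent_conn {w v₁ v₂ : List A} (h₁ : Elementary {r | Permanent c r} w v₁)
    (h₂ : Elementary {r | Permanent c r} w v₂) : Conn (allRules c) (SLt · w) v₁ v₂ := by
  have hmin : ∀ r, Permanent c r → IsMinimalRule (allRules c) r :=
    fun r hr => (permanent_iff hinv hR hc).1 hr
  have key : ∀ {r r'}, Permanent c r → Permanent c r' → ∀ {a m b b' : List A},
      r.1 ++ b = m ++ (r'.1 ++ b') →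
      Conn (allRules c) (SLt · (a ++ r.1 ++ b)) (a ++ r.2 ++ b) (a ++ m ++ r'.2 ++ b') := by
    intro r r' hr hr' a m b b'
    refine conn_of_overlap (P := {r | Permanent c r}) (fun r hr => (hmin r hr).1)
      (fun r hr => allRules_ordered hinv hR hc r (hmin r hr).1) ?_
      (fun r hr r' hr' p hp => permanent_overlap hinv hR hc hr hr' hp) hr hr'
    intro r hr r' hr' hi
    by_contra hne
    exact (hmin r' hr').2.2 r.1 hi hne r (hmin r hr).1 List.infix_rfl
  obtain ⟨a, b, r, hr, rfl, rfl⟩ := h₁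
  obtain ⟨a', b', r', hr', e, rfl⟩ := h₂
  have e' := e
  simp only [List.append_assoc] at e'
  rcases List.append_eq_append_iff.1 e' with ⟨m, rfl, h⟩ | ⟨m, rfl, h⟩
  · exact key hr hr' h
  · rw [e]
    exact (key hr' hr h).symm

lemma allRules_conn {w v₁ v₂ : List A} (h₁ : Elementary (allRules c) w v₁)
    (h₂ : Elementary (allRules c) w v₂) : Conn (allRules c) (SLt · w) v₁ v₂ := by
  have key : ∀ v, Elementary (allRules c) w v → ∃ v', Elementary {r | Permanent c r} w v' ∧
      Conn (allRules c) (SLt · w) v' v := by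
    rintro v ⟨a, b, r, hr, rfl, rfl⟩
    obtain ⟨α, β, q, hq, e, h⟩ := exists_permanent_derivation hinv hR hc hr
    refine ⟨a ++ (α ++ q.2 ++ β) ++ b, ⟨a ++ α, β ++ b, q, hq, by simp [e], by simp⟩, ?_⟩
    exact h.context a b fun y hy => hy.context a b
  obtain ⟨v₁', h₁', k₁⟩ := key v₁ h₁
  obtain ⟨v₂', h₂', k₂⟩ := key v₂ h₂
  exact k₁.symm.trans ((permanent_conn hinv hR hc h₁' h₂').trans k₂)

/-- The irreducible words with respect to all rules are the short-lex normal forms. -/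
theorem allRules_irred_iff {u : List A} : IsIrred (allRules c) u ↔ IsNormalForm inv R u := by
  have hnf : ∀ v, IsNormalForm inv R v → IsIrred (allRules c) v := fun v hv =>
    (isNormalForm_iff.1 hv).mono (allRules_subset hinv hR hc)
  refine ⟨fun hu => ?_, hnf u⟩
  obtain ⟨v, hv, e⟩ := exists_normalForm (inv := inv) (R := R) u
  have hth : Thue (allRules c) u v :=
    Relation.EqvGen.mono (fun _ _ h => h.mono (Set.subset_iUnion (rulesAt c) 0)) _ _
      ((thue_rulesAt_iff hinv hR hc 0 u v).2 e.symm)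
  rwa [eq_of_thue_of_irred (allRules_ordered hinv hR hc)
    (fun w v₁ v₂ => allRules_conn hinv hR hc) hth hu (hnf v hv)]

lemma allRules_irred_iff_universal {u : List A} :
    IsIrred (allRules c) u ↔ IsIrred (universalRules inv R) u :=
  (allRules_irred_iff hinv hR hc).trans isNormalForm_iff

/-- The permanent rules are the minimal rules of the universal set of rules. -/
theorem permanent_iff_minimal {r : Rule A} :
    Permanent c r ↔ IsMinimalRule (universalRules inv R) r := by
  simp only [permanent_iff hinv hR hc, IsMinimalRule, ProperIrred,
    allRules_irred_iff_universal hinv hR hc]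
  refine and_congr_left fun ⟨h2, hP⟩ => ⟨fun h => allRules_subset hinv hR hc h, fun hr => ?_⟩
  have hred : ¬ IsIrred (allRules c) r.1 := by
    rw [allRules_irred_iff_universal hinv hR hc]
    exact fun h => h r hr List.infix_rfl
  simp only [IsIrred, not_forall, not_not] at hred
  obtain ⟨s, hs, hi⟩ := hred
  obtain ⟨α, β, q, hq, e, -⟩ := exists_permanent_derivation hinv hR hc hs
  obtain ⟨hqX, hq2, -⟩ := (permanent_iff hinv hR hc).1 hq
  have hqU := allRules_subset hinv hR hc hqX
  have h1 : q.1 = r.1 := by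
    by_contra hne
    exact hP q.1 (List.IsInfix.trans ⟨α, β, e.symm⟩ hi) hne q hqU List.infix_rfl
  have h3 : q.2 = r.2 := by
    refine IsNormalForm.eq (inv := inv) (R := R) ((allRules_irred_iff hinv hR hc).1 hq2)
      (isNormalForm_iff.2 h2) ?_
    rw [← hqU.2, h1, hr.2]
  rwa [← Prod.ext h1 h3]

/-- The set of permanent rules is confluent: it has the same irreducible words as the set of all
rules, and these are the normal forms. -/
theorem permanent_confluent : Confluent {r | Permanent c r} := by
  have hsub : {r | Permanent c r} ⊆ universalRules inv R := fun r hr =>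
    ((permanent_iff_minimal hinv hR hc).1 hr).1
  have hnf : ∀ u, IsIrred {r | Permanent c r} u → IsNormalForm inv R u := by
    intro u hu
    rw [← allRules_irred_iff hinv hR hc]
    intro r hr hi
    obtain ⟨α, β, q, hq, e, -⟩ := exists_permanent_derivation hinv hR hc hr
    exact hu q hq (List.IsInfix.trans ⟨α, β, e.symm⟩ hi)
  have hval : ∀ {u v}, Relation.ReflTransGen (Elementary {r | Permanent c r}) u v →
      value inv R u = value inv R v := fun h =>
    (ReflTransGen.conn (fun r hr => (hsub hr).1) h).2.thue.value_eq fun r hr => (hsub hr).2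
  intro w
  refine existsUnique_of_exists_of_unique ?_ ?_
  · refine slt_wellFounded.induction (C := fun w => ∃ w', ReducesTo {r | Permanent c r} w w') w
      fun w ih => ?_
    by_cases hw : IsIrred {r | Permanent c r} w
    · exact ⟨w, .refl, hw⟩
    · obtain ⟨v, hv⟩ := exists_elementary hw
      obtain ⟨w', h1, h2⟩ := ih v (hv.slt fun r hr => (hsub hr).1)
      exact ⟨w', .head hv h1, h2⟩
  · rintro u v ⟨h1, h2⟩ ⟨h3, h4⟩
    exact (hnf u h2).eq (hnf v h4) ((hval h1).symm.trans (hval h3))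

/-- Each minimal rule is accepted by the automata of all late passes. -/
theorem eventually_mem_setOfRules {r : Rule A} (hr : IsMinimalRule (universalRules inv R) r) :
    ∃ T, ∀ t ≥ T, r ∈ setOfRules (c t).rules := by
  have hp := (permanent_iff_minimal hinv hR hc).2 hr
  obtain ⟨T, hT⟩ := permanent_active hinv hR hc hp
  obtain ⟨T', -, hT'⟩ := eventually_at_end hinv hR hc (T := T) (Y := fun q => q = r)
    (P := fun t => Recognizes (c t).wdiff.needed r)
    (by
      intro t _ s o h hso
      have ho : o = r := by
        rcases hso with rfl | h'
        · exact permanent_treat hinv hR hc hp h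
        · exact h'
      obtain ⟨-, ⟨S₁, ts⟩, -⟩ := h
      exact ho ▸ ts.recognizes (ho ▸ ne_nil_of_mem hr.1))
    (fun t _ h h' => recognizes_step hinv hR hc h h')
    (fun t ht _ => .inr ⟨r, hT t ht, rfl⟩)
  refine eventually_rules hinv hR hc (T := T') (Q := fun M => r ∈ setOfRules M)
    fun t ht hend => ?_
  rcases hend.refines.recognizes (hT' t ht hend) with h | ⟨q, hq, hi, hne⟩
  · exact h
  · exact absurd List.infix_rfl
      (hr.2.2 q.1 hi hne q ((run_valid hinv hR hc (t + 1)).rules hq))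

end Confluence

/-! ### Rules which are in the store at arbitrarily large times -/

section Persistent

variable {A : Type*} [LinearOrder A] {inv : A → A} {R : Finset (Rule A)} {c : ℕ → Config A}

/-- The rule `r` cannot be formed with the automaton `M`: it is neither an irreducible output of
minimization, nor the rule with the least right-hand side for its left-hand side. -/
def Excluded (M : Automaton A) (r : Rule A) : Prop :=
  ProperIrred (setOfRules M) r.1 → ¬ IsIrred (setOfRules M) r.2 ∧
    ∃ σ, (r.1, σ) ∈ setOfRules M ∧ SLt σ r.2

lemma TreatStep.mem_of_excluded {C C' : Config A} {r s o : Rule A}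
    (h : TreatStep inv R C C' s o) (hr : Excluded C.rules r) :
    o ≠ r ∧ (r ∈ C'.store.active → r ∈ C.store.active) ∧
      (r ∈ C'.store.rules → r ∈ C.store.rules) := by
  obtain ⟨-, ⟨S₁, ts⟩, -⟩ := h
  have ho : o ≠ r := by
    rintro rfl
    exact (hr ts.out_proper).1 ts.out_irred
  have hS₁ : r ∈ S₁.rules → r ∈ C.store.rules := fun h => by
    rcases ts.grows.mem_rules h with h | ⟨-, -, -, hP, hl, -⟩
    · exact h
    · obtain ⟨-, σ, h1, h2⟩ := hr hP
      exact absurd h2 (hl σ h1)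
  refine ⟨ho, fun h => ?_, fun h => ?_⟩
  · rcases ts.mem_active r h with h | ⟨h, -⟩
    · rw [Store.mem_active, ts.grows.considered, ts.grows.now] at h
      rcases h with h | h | h
      · exact Store.mem_active.2 (.inl h)
      · exact Store.mem_active.2 (.inr (.inl h))
      · rcases ts.grows.new r h with h | ⟨h', -⟩
        · exact Store.mem_active.2 (.inr (.inr h))
        · exact absurd (hS₁ (Store.mem_rules.2 (.inl (Store.mem_active.2 (.inr (.inr h)))))) h'
    · exact absurd h.symm ho
  · rcases ts.mem_rules r h with h | ⟨h, -⟩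
    · exact hS₁ h
    · exact absurd h.symm ho

lemma QuietStep.mem_of_excluded {C C' : Config A} {r : Rule A} (h : QuietStep C C')
    (hr : Excluded C.rules r) : (r ∈ C'.store.active → r ∈ C.store.active) ∧
      (r ∈ C'.store.rules → r ∈ C.store.rules) := by
  have key : r ∈ C'.store.rules → r ∈ C.store.rules := fun hq => by
    rcases h.mem_rules r hq with h | ⟨-, ⟨-, hP, hl⟩ | ⟨h1, h2⟩⟩
    · exact h
    · obtain ⟨-, σ, h1, h2⟩ := hr hP
      exact absurd h2 (hl σ h1)
    · exact absurd h2 (hr h1.proper).1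
  refine ⟨fun hq => ?_, key⟩
  exact (h.mem_active r hq).resolve_right fun h' =>
    h' (key (Store.mem_rules.2 (.inl hq)))

variable [Fintype A] (hinv : Function.Involutive inv) (hR : ∀ r ∈ R, SL2 r.1 r.2)
  (hc : IsRun inv R c)

include hinv hR hc

lemma eventually_excluded {r : Rule A} (hr : r ∈ universalRules inv R)
    (hmin : ¬ IsMinimalRule (universalRules inv R) r) :
    ∃ T, ∀ t ≥ T, Excluded (c t).rules r := by
  obtain ⟨T, hT⟩ := eventually_irred hinv hR hc r.1
  simp only [allRules_irred_iff_universal hinv hR hc] at hT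
  have hproper : ∀ t ≥ T, ProperIrred (setOfRules (c t).rules) r.1 →
      ProperIrred (universalRules inv R) r.1 := fun t ht h s hs hne =>
    hT t ht s (slt_of_infix hs hne) (h s hs hne)
  by_cases hP : ProperIrred (universalRules inv R) r.1
  · have h2 : ¬ IsIrred (universalRules inv R) r.2 := fun h => hmin ⟨hr, h, hP⟩
    obtain ⟨v, hv, e⟩ := exists_normalForm (inv := inv) (R := R) r.2
    have hne : r.2 ≠ v := by
      rintro h
      exact h2 (isNormalForm_iff.1 (h ▸ hv))
    have hlt : SLt v r.2 := SLe.slt_of_ne (hv r.2 e.symm) (Ne.symm hne)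
    have hmin' : IsMinimalRule (universalRules inv R) (r.1, v) :=
      ⟨⟨hlt.trans hr.1, by rw [hr.2, ← e]⟩, isNormalForm_iff.1 hv, hP⟩
    obtain ⟨T', hT'⟩ := eventually_mem_setOfRules hinv hR hc hmin'
    exact ⟨max T T', fun t ht _ => ⟨fun h => h2 (hT t (by omega) _ hr.1 h), v,
      hT' t (by omega), hlt⟩⟩
  · exact ⟨T, fun t ht h => absurd (hproper t ht h) hP⟩

/-- A rule which is not minimal is not in the store at large times. In late passes it is not formed
again; so it disappears after it has been treated. -/
theorem eventually_notMem_rulesAt {r : Rule A} (hr : r ∈ universalRules inv R)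
    (hmin : ¬ IsMinimalRule (universalRules inv R) r) : ∃ T, ∀ t ≥ T, r ∉ rulesAt c t := by
  obtain ⟨T, hT⟩ := eventually_excluded hinv hR hc hr hmin
  have hactive : ∀ t ≥ T, r ∉ (c t).store.active → r ∉ (c (t + 1)).store.active := by
    intro t ht h h'
    rcases run_step hinv hR hc t with ⟨s, o, hs⟩ | hs | hs
    · exact h ((hs.mem_of_excluded (hT t ht)).2.1 h')
    · exact h ((hs.mem_of_excluded (hT t ht)).1 h')
    · exact h (hs.active ▸ h')
  have hrules : ∀ t ≥ T, r ∉ rulesAt c t → r ∉ rulesAt c (t + 1) := by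
    intro t ht h h'
    rcases run_step hinv hR hc t with ⟨s, o, hs⟩ | hs | hs
    · exact h ((hs.mem_of_excluded (hT t ht)).2.2 h')
    · exact h ((hs.mem_of_excluded (hT t ht)).2 h')
    · rw [rulesAt, hs.rules] at h'
      exact h (active_subset_rulesAt t h')
  obtain ⟨T', hTT', hT'⟩ := eventually_at_end hinv hR hc (T := T) (Y := fun q => q = r)
    (P := fun t => r ∉ (c t).store.active)
    (by
      intro t ht s o h hso
      have ho := (h.mem_of_excluded (hT t ht)).1
      obtain rfl : s = r := hso.resolve_right ho
      obtain ⟨-, ⟨S₁, ts⟩, -⟩ := h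
      exact ts.drop ho)
    (fun t ht h _ => hactive t ht h)
    (fun t ht _ => by
      by_cases h : r ∈ (c t).store.active
      · exact .inr ⟨r, h, rfl⟩
      · exact .inl (hactive t ht h))
  obtain ⟨e, he, hend⟩ := exists_end hinv hR hc T'
  refine ⟨e + 1, fun t ht => ?_⟩
  induction t, ht using Nat.le_induction with
  | base => rw [rulesAt, hend.rules]; exact hT' e he hend
  | succ t ht ih => exact hrules t (by omega) ih

theorem permanent_eq_persistent :
    {r | Permanent c r} = ⋂ t, ⋃ s ≥ t, rulesAt c s := by
  ext r
  simp only [Set.mem_ofPred_eq, Set.mem_iInter, Set.mem_iUnion, exists_prop]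
  constructor
  · intro hr t
    obtain ⟨T, hT⟩ := permanent_active hinv hR hc hr
    exact ⟨max T t, le_max_right _ _, active_subset_rulesAt _ (hT _ (le_max_left _ _))⟩
  · intro h
    obtain ⟨s, -, hs⟩ := h 0
    rw [permanent_iff_minimal hinv hR hc]
    by_contra hmin
    obtain ⟨T, hT⟩ := eventually_notMem_rulesAt hinv hR hc ((run_valid hinv hR hc s).store hs) hmin
    obtain ⟨t, ht, h'⟩ := h T
    exact hT t ht h'

end Persistent

end KnuthBendix

theorem mainTheorem3 {A : Type*} [Fintype A] [LinearOrder A]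
    (inv : A → A) (hinv : Function.Involutive inv)
    (R : Finset (Rule A)) (hR : ∀ r ∈ R, SL2 r.1 r.2)
    (c : ℕ → Config A) (hc : IsRun inv R c) :
    Confluent {r | Permanent c r} ∧
    {r | Permanent c r} = (⋂ t, ⋃ s ≥ t, rulesAt c s) ∧
    (∀ u : List A,
      (∀ t, IsThueLeast (rulesAt c t) u ↔ PermIrred c u) ∧
      (PermIrred c u ↔ IsNormalForm inv R u)) ∧
    {r | Permanent c r} = {r | IsMinimalRule (universalRules inv R) r} ∧
    (∀ r, IsMinimalRule (universalRules inv R) r →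
      ∃ N, ∀ n ≥ N, (∃ t, (c t).pass = n) ∧
        ∀ t, (c t).pass = n → r ∈ setOfRules (c t).rules) := by
  have hirred : ∀ u, PermIrred c u ↔ IsNormalForm inv R u := fun u =>
    (permIrred_iff hinv hR hc).trans (allRules_irred_iff hinv hR hc)
  refine ⟨permanent_confluent hinv hR hc, permanent_eq_persistent hinv hR hc,
    fun u => ⟨fun t => ?_, hirred u⟩,
    Set.ext fun r => permanent_iff_minimal hinv hR hc, fun r hr => ?_⟩
  · simp only [hirred, IsThueLeast, IsNormalForm, thue_rulesAt_iff hinv hR hc,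
      @eq_comm _ (value inv R u)]
  · obtain ⟨T, hT⟩ := eventually_mem_setOfRules hinv hR hc hr
    refine ⟨(c T).pass + 1, fun n hn => ⟨exists_pass_eq hinv hR hc (by omega), fun t ht => ?_⟩⟩
    refine hT t (not_lt.1 fun hlt => ?_)
    have := pass_mono hinv hR hc hlt.le
    simp only at this
    omega
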